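/- **Theorem 5.3.** Let $0<q<1$ and write $(u;q)_n=\prod_{k=0}^{n-1}(1-uq^k)$, $(u;q)_\infty=\lim_{n\to\infty}(u;q)_n$, and $(u_1,\dots,u_r;q)_n=\prod_j (u_j;q)_n$ for $n\in\{0,1,2,\dots\}\cup\{\infty\}$. Let $\alpha$ and $d\neq 0$ be real, and let $a,b,c$ be complex numbers that are either all real, or such that two of them are complex conjugate and the third is real. Assume $$\max(|a|,|b|,|c|,|q/d|)<1,\qquad q^{1/2}<\alpha<1 .$$ Put $\eta=\tfrac12(\alpha+\alpha^{-1})$ and, for $\nu\in\mathbb C$, let $$v_\nu(\eta;a,b,c;d)=\frac{\left(q\alpha/d,\;q^{1-\nu}/(\alpha d),\;abc\,q^{\nu}/\alpha;\,q\right)_\infty}{\left(abc/\alpha;\,q\right)_\infty}\;\sum_{n=0}^{\infty}\frac{1-Aq^{2n}}{1-A}\,\frac{\left(A,\;q^{-\nu},\;abcd\,q^{\nu-1},\;a/\alpha,\;b/\alpha,\;c/\alpha;\,q\right)_n}{\left(q,\;abc\,q^{\nu}/\alpha,\;q^{1-\nu}/(\alpha d),\;ab,\;ac,\;bc;\,q\right)_n}\left(\frac{q\alpha}{d}\right)^{n},\qquad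 A=\frac{abc}{q\alpha}.$$ The sum is the very-well-poised series ${}_8\varphi_7$ with argument $q\alpha/d$, with numerator parameters $A,\ q\sqrt A,\ -q\sqrt A,\ q^{-\nu},\ abcd\,q^{\nu-1},\ a/\alpha,\ b/\alpha,\ c/\alpha$ and denominator parameters $\sqrt A,\ -\sqrt A,\ abc\,q^{\nu}/\alpha,\ q^{1-\nu}/(\alpha d),\ bc,\ ac,\ ab$. Where a denominator vanishes the singularity is removable: with $1/\alpha$ replaced by a complex variable $y$ throughout, the value is the limit of the expression as $y\to 1/\alpha$, $y\ne 1/\alpha$. Let $$\lambda_\nu=\frac{4q^{3/2}}{(1-q)^2}\,(1-q^{-\nu})(1-abcd\,q^{\nu-1}),$$ so that $\partial\lambda_\nu/\partial\nu=0$ if and only if $abcd\,q^{2\nu-1}=1$. Let $\nu_0$ be a real zero of the function $\nu\mapsto v_\nu(\eta;a,b,c;d)$. This function is analytic at $\nu_0$, and * if $\partial\lambda_\nu/\partial\nu\neq 0$ at $\nu=\nu_0$, that is, if $abcd\,q^{2\nu_0-1}\neq 1$, then $\nu_0$ is a simple zero; * if $abcd\,q^{2\nu_0-1}=1$, then $\nu_0$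 is a zero of order exactly $2$ in $\nu$ (equivalently, a simple zero of $v_\nu(\eta;a,b,c;d)$ as a function of $\lambda_\nu$). -/

import Mathlib

open Filter Topology

/-- The finite `q`-shifted factorial `(a; q)_n = ∏_{k=0}^{n-1} (1 - a q^k)`. -/
noncomputable def qPoch (a q : ℂ) (n : ℕ) : ℂ :=
  ∏ k ∈ Finset.range n, (1 - a * q ^ k)

/-- The infinite `q`-shifted factorial `(a; q)_∞` (used for `|q| < 1`). -/
noncomputable def qPochInf (a q : ℂ) : ℂ :=
  ∏' k : ℕ, (1 - a * q ^ k)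

/-- The basic hypergeometric series `_rφ_s(as; bs; q, t)`, where `r` and `s` are the lengths
of the lists `as` and `bs`. -/
noncomputable def basicHyp (as bs : List ℂ) (q t : ℂ) : ℂ :=
  ∑' n : ℕ,
    (as.map (fun a => qPoch a q n)).prod / ((q :: bs).map (fun b => qPoch b q n)).prod
      * ((-1) ^ n * q ^ (n * (n - 1) / 2)) ^ (1 + (bs.length : ℤ) - (as.length : ℤ)) * t ^ n

/-- The very-well-poised `_8φ_7` expression for `v_ν(x; a, b, c; d)`, `x = (y + y⁻¹) / 2`:
with `A = a b c y / q`,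
`(q/(dy), q^{1-ν} y/d, abcy q^ν; q)_∞ / (abcy; q)_∞` times the `_8φ_7` series with numerator
parameters `A, q√A, -q√A, q^{-ν}, abcd q^{ν-1}, ay, by, cy`, denominator parameters
`√A, -√A, abcy q^ν, q^{1-ν} y/d, bc, ac, ab` and argument `q/(dy)`.
The series converges for `|q/(dy)| < 1`. For exceptional values of `y`, `ν` or `a, b, c`
a denominator of this expression vanishes; all these singularities are removable. -/
noncomputable def vExpr (q a b c d ν y : ℂ) : ℂ :=
  qPochInf (q / (d * y)) q * qPochInf (q ^ (1 - ν) * y / d) q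
      * qPochInf (a * b * c * y * q ^ ν) q / qPochInf (a * b * c * y) q
    * basicHyp
        [a * b * c * y / q,
          q * (a * b * c * y / q) ^ (1 / 2 : ℂ), -(q * (a * b * c * y / q) ^ (1 / 2 : ℂ)),
          q ^ (-ν), a * b * c * d * q ^ (ν - 1), a * y, b * y, c * y]
        [(a * b * c * y / q) ^ (1 / 2 : ℂ), -(a * b * c * y / q) ^ (1 / 2 : ℂ),
          a * b * c * y * q ^ ν, q ^ (1 - ν) * y / d, b * c, a * c, a * b]
        q (q / (d * y))

/-- The function `v_ν(x; a, b, c; d)`, `x = (y + y⁻¹) / 2`, for `|q/(dy)| < 1`: the expression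
`vExpr`, an analytic function of `y` with removable singularities only, with these
singularities removed (at all other points the limit is just the value of `vExpr`). -/
noncomputable def vFun (q a b c d ν y : ℂ) : ℂ :=
  limUnder (𝓝[≠] y) (fun w => vExpr q a b c d ν w)

/-- The boundary function `v_ν(η; a, b, c; d)`, `η = (α + α⁻¹) / 2`, as a function of `ν ∈ ℂ`. -/
noncomputable def vBoundary (q α a b c d ν : ℂ) : ℂ :=
  vFun q a b c d ν α⁻¹

/-! ### Finite and infinite q-shifted factorials: zeros, bounds, analyticity -/

section qPochhammer

/-! Put u = q^{-ν} and v = abc q^ν, so that uv = abc, and regard v_ν as a function of y. It is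
invariant under y ↦ 1/y and is an eigenfunction of a second order q-difference operator whose
eigenvalue, (1-u)(1-vd/q), is a constant multiple of λ_ν. The theorem comes from Green's formula for
this operator.

Let ν₀ be a zero. The eigenvalue equations for ν and ν₀ express (difference of eigenvalues) · ∫ w
v_{ν₀} v_ν over |z| = 1 as a contour integral of a flux: a weight times the Wronskian of the two
solutions. Theta factors in αz and α/z make the flux weight invariant under z ↦ 1/(qz), while the
Wronskian changes sign. The flux integral over |z| = q^{-1/2} is therefore zero. Since q^{1/2} < α <
1, the only pole between this circle and the unit circle is z = 1/α, and the residue there is a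
constant times v_ν(η), because v_{ν₀}(η) = 0. Hence (difference of eigenvalues) · I(ν) = C v_ν(η)
for all ν (`integral_div_one_sub_mul`, `fluxWeight_add_inv`, `exists_integral_circleWeight_eq`).

At ν = ν₀ the integral I is positive: w is a squared modulus on the circle, v_{ν₀} is real there
(`conj_vSum_of_norm_eq_one`) and is not identically zero (`exists_vSum_ne_zero`). So v_ν(η) vanishes
at ν₀ to the order of the difference of eigenvalues, which is (q^{-ν₀} - q^{-ν})(1 - abcd
q^{ν₀+ν-1}). The first factor has a simple zero at ν₀; the second vanishes there only if abcd
q^{2ν₀-1} = 1, and then simply.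

The q-difference equation is obtained by eliminating the shifted function between a lowering and a
raising relation (`wpSum_lower`, `wpSum_raise`), which move ν by one and the parameters by q^{1/2}
and are proved by telescoping. The symmetry in y is first proved for terminating series by
induction, then for all u by dividing by (u, abcd/(qu); q)_∞ and applying the maximum principle on
growing circles (`wpSum_symm_of_generic`). Symmetry also lets the equation be continued to the unit
circle, where the original series need not all converge (`secondOrderOp_eq_zero`). Nonvanishing
rests on Abel's theorem at the edge of the domain of convergence (`terminating_of_wpSum_eq_zero`).
-/

lemma qPoch_zero (x q : ℂ) : qPoch x q 0 = 1 := by simp [qPoch]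

lemma qPoch_succ (x q : ℂ) (n : ℕ) : qPoch x q (n + 1) = qPoch x q n * (1 - x * q ^ n) := by
  simp [qPoch, Finset.prod_range_succ]

lemma qPoch_succ' (x q : ℂ) (n : ℕ) : qPoch x q (n + 1) = (1 - x) * qPoch (x * q) q n := by
  simp only [qPoch, Finset.prod_range_succ', pow_zero, mul_one]
  rw [mul_comm]
  congr 1
  refine Finset.prod_congr rfl fun k _ => ?_
  ring

lemma qPochInf_zero (q : ℂ) : qPochInf 0 q = 1 := by simp [qPochInf]

variable {q : ℂ}

lemma summable_norm_neg_mul_pow (hq : ‖q‖ < 1) (x : ℂ) :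
    Summable fun k : ℕ => ‖-(x * q ^ k)‖ := by
  simpa [norm_mul, norm_pow] using
    (summable_geometric_of_lt_one (norm_nonneg q) hq).mul_left ‖x‖

lemma multipliable_one_sub_mul_pow (hq : ‖q‖ < 1) (x : ℂ) :
    Multipliable fun k : ℕ => 1 - x * q ^ k := by
  simpa [sub_eq_add_neg] using multipliable_one_add_of_summable (summable_norm_neg_mul_pow hq x)

lemma tendsto_qPoch (hq : ‖q‖ < 1) (x : ℂ) :
    Tendsto (fun n => qPoch x q n) atTop (𝓝 (qPochInf x q)) :=
  (multipliable_one_sub_mul_pow hq x).hasProd.tendsto_prod_nat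

lemma qPochInf_eq_qPoch_mul (hq : ‖q‖ < 1) (x : ℂ) (n : ℕ) :
    qPochInf x q = qPoch x q n * qPochInf (x * q ^ n) q := by
  refine tendsto_nhds_unique ((tendsto_add_atTop_iff_nat n).2 (tendsto_qPoch hq x)) ?_
  refine ((tendsto_qPoch hq (x * q ^ n)).const_mul (qPoch x q n)).congr fun m => ?_
  simp only [qPoch]
  rw [add_comm m n, Finset.prod_range_add]
  congr 1
  refine Finset.prod_congr rfl fun k _ => ?_
  ring

lemma qPochInf_eq (hq : ‖q‖ < 1) (x : ℂ) :
    qPochInf x q = (1 - x) * qPochInf (x * q) q := by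
  simpa [qPoch] using qPochInf_eq_qPoch_mul hq x 1

lemma qPochInf_mul_pow (hq : ‖q‖ < 1) (x : ℂ) (n : ℕ) :
    qPochInf (x * q ^ n) q = (1 - x * q ^ n) * qPochInf (x * q ^ (n + 1)) q := by
  rw [qPochInf_eq hq, pow_succ, mul_assoc]

lemma qPochInf_ne_zero_iff (hq : ‖q‖ < 1) (x : ℂ) :
    qPochInf x q ≠ 0 ↔ ∀ k : ℕ, x * q ^ k ≠ 1 := by
  constructor
  · intro h k hk
    apply h
    rw [qPochInf_eq_qPoch_mul hq x (k + 1), qPoch_succ, hk]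
    simp
  · intro h
    have := tprod_one_add_ne_zero_of_summable (f := fun k : ℕ => -(x * q ^ k))
      (fun k hk => h k (by linear_combination -hk)) (summable_norm_neg_mul_pow hq x)
    simpa [qPochInf, sub_eq_add_neg] using this

lemma qPochInf_ne_zero_of_norm_lt_one (hq : ‖q‖ < 1) {x : ℂ} (hx : ‖x‖ < 1) :
    qPochInf x q ≠ 0 := by
  rw [qPochInf_ne_zero_iff hq]
  intro k hk
  have h1 : ‖x * q ^ k‖ < 1 := by
    rw [norm_mul, norm_pow]
    exact (mul_le_of_le_one_right (norm_nonneg _)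
      (pow_le_one₀ (norm_nonneg _) hq.le)).trans_lt hx
  rw [hk] at h1
  simp at h1

lemma qPoch_ne_zero_of_qPochInf_ne_zero (hq : ‖q‖ < 1) {x : ℂ} (hx : qPochInf x q ≠ 0) (n : ℕ) :
    qPoch x q n ≠ 0 := by
  rw [qPochInf_eq_qPoch_mul hq x n] at hx
  exact left_ne_zero_of_mul hx

lemma qPoch_ne_zero_of_norm_lt_one (hq : ‖q‖ < 1) {x : ℂ} (hx : ‖x‖ < 1) (n : ℕ) :
    qPoch x q n ≠ 0 :=
  qPoch_ne_zero_of_qPochInf_ne_zero hq (qPochInf_ne_zero_of_norm_lt_one hq hx) n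

lemma norm_qPoch_le (hq : ‖q‖ < 1) (x : ℂ) (n : ℕ) :
    ‖qPoch x q n‖ ≤ Real.exp (‖x‖ / (1 - ‖q‖)) := by
  have h1 : ‖qPoch x q n‖ ≤ ∏ k ∈ Finset.range n, Real.exp (‖x‖ * ‖q‖ ^ k) := by
    rw [qPoch, norm_prod]
    refine Finset.prod_le_prod (fun _ _ => norm_nonneg _) fun k _ => ?_
    calc ‖1 - x * q ^ k‖ ≤ ‖(1 : ℂ)‖ + ‖x * q ^ k‖ := norm_sub_le _ _
      _ = ‖x‖ * ‖q‖ ^ k + 1 := by simp [add_comm]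
      _ ≤ _ := Real.add_one_le_exp _
  refine h1.trans ?_
  rw [← Real.exp_sum]
  apply Real.exp_le_exp.2
  rw [← Finset.mul_sum, div_eq_mul_inv]
  refine mul_le_mul_of_nonneg_left ?_ (norm_nonneg _)
  rw [← tsum_geometric_of_lt_one (norm_nonneg _) hq]
  exact (summable_geometric_of_lt_one (norm_nonneg _) hq).sum_le_tsum _
    (fun _ _ => by positivity)

lemma norm_qPochInf_le (hq : ‖q‖ < 1) (x : ℂ) :
    ‖qPochInf x q‖ ≤ Real.exp (‖x‖ / (1 - ‖q‖)) :=
  le_of_tendsto (tendsto_qPoch hq x).norm (Eventually.of_forall fun n => norm_qPoch_le hq x n)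

lemma norm_qPoch_le_of_le (hq : ‖q‖ < 1) {x : ℂ} {M : ℝ} (hx : ‖x‖ ≤ M) (n : ℕ) :
    ‖qPoch x q n‖ ≤ Real.exp (M / (1 - ‖q‖)) :=
  (norm_qPoch_le hq x n).trans (Real.exp_le_exp.2
    (div_le_div_of_nonneg_right hx (by linarith)))

lemma norm_qPochInf_le_of_le (hq : ‖q‖ < 1) {x : ℂ} {M : ℝ} (hx : ‖x‖ ≤ M) :
    ‖qPochInf x q‖ ≤ Real.exp (M / (1 - ‖q‖)) :=
  (norm_qPochInf_le hq x).trans (Real.exp_le_exp.2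
    (div_le_div_of_nonneg_right hx (by linarith)))

/-- The finite products converge to a nonzero limit, so their inverses converge and are bounded.
This controls the denominators (q, ab, ac, bc; q)_n uniformly in n. -/
lemma exists_norm_inv_qPoch_le (hq : ‖q‖ < 1) {x : ℂ} (hx : qPochInf x q ≠ 0) :
    ∃ M : ℝ, 0 < M ∧ ∀ n, ‖(qPoch x q n)⁻¹‖ ≤ M := by
  obtain ⟨M, hM⟩ := ((tendsto_qPoch hq x).inv₀ hx).norm.bddAbove_range
  refine ⟨max M 1, by positivity, fun n => (hM ⟨n, rfl⟩).trans (le_max_left _ _)⟩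

lemma differentiable_qPoch (q : ℂ) (n : ℕ) : Differentiable ℂ fun x => qPoch x q n := by
  unfold qPoch
  fun_prop

lemma continuous_qPoch (q : ℂ) (n : ℕ) : Continuous fun x => qPoch x q n :=
  (differentiable_qPoch q n).continuous

lemma differentiable_qPochInf (hq : ‖q‖ < 1) : Differentiable ℂ fun x => qPochInf x q := by
  have key : ∀ R : ℝ, DifferentiableOn ℂ (fun x => qPochInf x q) (Metric.ball 0 R) := by
    intro R
    have h := Summable.hasProdLocallyUniformlyOn_nat_one_add (R := ℂ)
      (f := fun (k : ℕ) (x : ℂ) => -(x * q ^ k))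
      (K := Metric.ball (0 : ℂ) R) Metric.isOpen_ball (u := fun k => R * ‖q‖ ^ k)
      ((summable_geometric_of_lt_one (norm_nonneg q) hq).mul_left R)
      (Eventually.of_forall fun k x hx => by
        rw [norm_neg, norm_mul, norm_pow]
        have : ‖x‖ < R := by simpa using hx
        exact mul_le_mul_of_nonneg_right this.le (by positivity))
      (fun k => by fun_prop)
    have := h.differentiableOn (.of_forall fun s => by
      simpa [Finset.prod_fn] using
        DifferentiableOn.finsetProd (fun _ _ => by fun_prop)) Metric.isOpen_ball
    simpa [qPochInf, sub_eq_add_neg] using this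
  intro x
  exact (key (‖x‖ + 1)).differentiableAt (Metric.isOpen_ball.mem_nhds (by simp))

lemma continuous_qPochInf (hq : ‖q‖ < 1) : Continuous fun x => qPochInf x q :=
  (differentiable_qPochInf hq).continuous

lemma DifferentiableOn.qPochInf (hq : ‖q‖ < 1) {f : ℂ → ℂ} {s : Set ℂ}
    (hf : DifferentiableOn ℂ f s) : DifferentiableOn ℂ (fun z => qPochInf (f z) q) s :=
  (differentiable_qPochInf hq).comp_differentiableOn hf

lemma DifferentiableOn.qPoch (n : ℕ) {f : ℂ → ℂ} {s : Set ℂ}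
    (hf : DifferentiableOn ℂ f s) : DifferentiableOn ℂ (fun z => qPoch (f z) q n) s :=
  (differentiable_qPoch q n).comp_differentiableOn hf

lemma tendsto_mul_pow_zero (hq : ‖q‖ < 1) (x : ℂ) :
    Tendsto (fun n : ℕ => x * q ^ n) atTop (𝓝 0) := by
  simpa using (tendsto_pow_atTop_nhds_zero_of_norm_lt_one hq).const_mul x

lemma tendsto_qPochInf_mul_pow (hq : ‖q‖ < 1) (x : ℂ) :
    Tendsto (fun n : ℕ => qPochInf (x * q ^ n) q) atTop (𝓝 1) := by
  have h := ((continuous_qPochInf hq).tendsto 0).comp (tendsto_mul_pow_zero hq x)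
  rw [qPochInf_zero] at h
  exact h

/-- The zeros of `x ↦ (x; q)_∞` are simple. -/
lemma deriv_qPochInf_ne_zero (hq : ‖q‖ < 1) (hq0 : q ≠ 0) {x : ℂ} (hx : qPochInf x q = 0) :
    deriv (fun x => qPochInf x q) x ≠ 0 := by
  obtain ⟨k, hk⟩ : ∃ k : ℕ, x * q ^ k = 1 := by
    by_contra! h
    exact (qPochInf_ne_zero_iff hq x).2 h hx
  have hx0 : x ≠ 0 := by rintro rfl; simp at hk
  -- The one vanishing factor 1 - x q^k is isolated, and the derivative there is the rest of the
  -- product times -q^k. A second vanishing factor would make a positive power of q equal to 1.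
  have hfac : (fun x => qPochInf x q) =
      fun x => (qPoch x q k * qPochInf (x * q ^ (k + 1)) q) * (1 - x * q ^ k) := by
    funext w
    rw [qPochInf_eq_qPoch_mul hq w (k + 1), qPoch_succ]
    ring
  have hd1 : DifferentiableAt ℂ (fun x => qPoch x q k * qPochInf (x * q ^ (k + 1)) q) x :=
    ((differentiable_qPoch q k) x).mul
      (((differentiable_qPochInf hq) _).comp x (f := fun x => x * q ^ (k + 1)) (by fun_prop))
  have hd2 : HasDerivAt (fun x : ℂ => 1 - x * q ^ k) (-(q ^ k)) x := by
    simpa using ((hasDerivAt_id x).mul_const (q ^ k)).const_sub 1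
  have := hd1.hasDerivAt.mul hd2
  rw [hfac]
  have h2 : deriv (fun x => (qPoch x q k * qPochInf (x * q ^ (k + 1)) q) * (1 - x * q ^ k)) x
      = _ := this.deriv
  rw [h2]
  simp only [hk, sub_self, mul_zero, zero_add]
  refine mul_ne_zero (mul_ne_zero ?_ ?_) (neg_ne_zero.2 (pow_ne_zero _ hq0))
  · simp only [qPoch]
    rw [Finset.prod_ne_zero_iff]
    intro j hj hj0
    have h3 : x * q ^ j = 1 := by linear_combination -hj0
    have hjk : j < k := Finset.mem_range.1 hj
    have h4 : x * q ^ j = x * q ^ j * q ^ (k - j) := by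
      rw [mul_assoc, ← pow_add, Nat.add_sub_cancel' hjk.le, hk, h3]
    rw [h3, one_mul] at h4
    have h5 : ‖q ^ (k - j)‖ < 1 := by
      rw [norm_pow]
      exact pow_lt_one₀ (norm_nonneg _) hq (by omega)
    rw [← h4] at h5
    simp at h5
  · apply qPochInf_ne_zero_of_norm_lt_one hq
    rw [pow_succ, ← mul_assoc, hk, one_mul]
    exact hq

end qPochhammer

/-! ### The very-well-poised series, its domination, continuity and analyticity, and the removal of
its zero at abcy = 1 -/

section VeryWellPoised

/-- The very-well-poised factor `(1 - A q^{2n}) (Aq; q)_{n-1}`, equal to `1` for `n = 0`. -/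
noncomputable def wpWeight (q : ℂ) : ℕ → ℂ → ℂ
  | 0, _ => 1
  | n + 1, A => (1 - A * q ^ (2 * (n + 1))) * qPoch (A * q) q n

/-- The part of `wpWeight` that is divisible by `1 - A q`, divided by `1 - A q`. -/
noncomputable def regWeight (q : ℂ) : ℕ → ℂ → ℂ
  | 0, _ => 0
  | 1, _ => 1
  | n + 2, A => (1 - A * q ^ (2 * (n + 2))) * qPoch (A * q ^ 2) q n

/-- The common part of the terms of the series for `v_ν`, with `u = q^{-ν}` and `u v = a b c`. -/
noncomputable def wpTerm (q a b c d u v y : ℂ) (n : ℕ) : ℂ :=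
  qPoch u q n * qPoch (v * d / q) q n * qPoch (a * y) q n * qPoch (b * y) q n * qPoch (c * y) q n
    / (qPoch q q n * qPoch (a * b) q n * qPoch (a * c) q n * qPoch (b * c) q n)
    * (q / (d * y)) ^ n * (qPochInf (v * y * q ^ n) q * qPochInf (u * y / d * q ^ (n + 1)) q)

/-- `v_ν` multiplied by `(a b c y; q)_∞`. -/
noncomputable def wpSum (q a b c d u v y : ℂ) : ℂ :=
  qPochInf (q / (d * y)) q *
    ∑' n, wpWeight q n (a * b * c * y / q) * wpTerm q a b c d u v y n

/-- The first two terms of the series for `wpSum`, up to a multiple of `1 - a b c y`, divided by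
`1 - a b c y`. -/
noncomputable def regHead (q a b c d u v y : ℂ) : ℂ :=
  let F := (1 - a * b) * (1 - a * c) * (1 - b * c)
  let S := a * b * c * q / d * (1 - u) * (1 - v * d / q)
  qPochInf (v * y * q) q * qPochInf (u * y / d * q ^ 2) q *
    (F + S + (-F * (v + q * u / d) - S * (a + b + c) + a * b * c * (F + S)) * y + S * y ^ 2) / F

/-- `wpSum` divided by `1 - a b c y`. -/
noncomputable def regSum (q a b c d u v y : ℂ) : ℂ :=
  qPochInf (q / (d * y)) q *
    (regHead q a b c d u v y +
      ∑' n, regWeight q n (a * b * c * y / q) * wpTerm q a b c d u v y n)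

/-- Sequences of entire functions that are bounded on discs uniformly in the index. -/
def IsTameWeight (ω : ℕ → ℂ → ℂ) : Prop :=
  (∀ n, Differentiable ℂ (ω n)) ∧ ∀ M : ℝ, ∃ K : ℝ, 0 < K ∧ ∀ n A, ‖A‖ ≤ M → ‖ω n A‖ ≤ K

variable {q : ℂ}

lemma norm_one_sub_mul_pow_le (hq : ‖q‖ < 1) {A : ℂ} {M : ℝ} (hA : ‖A‖ ≤ M) (n : ℕ) :
    ‖1 - A * q ^ n‖ ≤ 1 + M := by
  refine (norm_sub_le _ _).trans ?_
  rw [norm_one, norm_mul, norm_pow]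
  have : ‖A‖ * ‖q‖ ^ n ≤ ‖A‖ * 1 :=
    mul_le_mul_of_nonneg_left (pow_le_one₀ (norm_nonneg _) hq.le) (norm_nonneg _)
  linarith

lemma norm_mul_pow_le (hq : ‖q‖ < 1) {A : ℂ} {M : ℝ} (hA : ‖A‖ ≤ M) (n : ℕ) :
    ‖A * q ^ n‖ ≤ M := by
  rw [norm_mul, norm_pow]
  exact (mul_le_of_le_one_right (norm_nonneg _) (pow_le_one₀ (norm_nonneg _) hq.le)).trans hA

lemma isTameWeight_wpWeight (hq : ‖q‖ < 1) : IsTameWeight (wpWeight q) := by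
  constructor
  · rintro (_ | n)
    · exact differentiable_const _
    · exact (by fun_prop : Differentiable ℂ fun A : ℂ => 1 - A * q ^ (2 * (n + 1))).mul
        ((differentiable_qPoch q n).comp (by fun_prop : Differentiable ℂ fun A : ℂ => A * q))
  · intro M
    refine ⟨(1 + |M|) * Real.exp (|M| / (1 - ‖q‖)) + 1, by positivity, ?_⟩
    rintro (_ | n) A hA
    · simp only [wpWeight, norm_one]
      have : 0 ≤ (1 + |M|) * Real.exp (|M| / (1 - ‖q‖)) := by positivity
      linarith
    · have hA' : ‖A‖ ≤ |M| := hA.trans (le_abs_self M)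
      simp only [wpWeight, norm_mul]
      have h1 := norm_one_sub_mul_pow_le hq hA' (2 * (n + 1))
      have h2 := norm_qPoch_le_of_le hq (pow_one q ▸ norm_mul_pow_le hq hA' 1) n
      calc _ ≤ (1 + |M|) * Real.exp (|M| / (1 - ‖q‖)) :=
            mul_le_mul h1 h2 (norm_nonneg _) (by positivity)
        _ ≤ _ := by linarith

lemma isTameWeight_regWeight (hq : ‖q‖ < 1) : IsTameWeight (regWeight q) := by
  constructor
  · rintro (_ | _ | n)
    · exact differentiable_const _
    · exact differentiable_const _
    · exact (by fun_prop : Differentiable ℂ fun A : ℂ => 1 - A * q ^ (2 * (n + 2))).mul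
        ((differentiable_qPoch q n).comp (by fun_prop : Differentiable ℂ fun A : ℂ => A * q ^ 2))
  · intro M
    have h0 : 0 ≤ (1 + |M|) * Real.exp (|M| / (1 - ‖q‖)) := by positivity
    refine ⟨(1 + |M|) * Real.exp (|M| / (1 - ‖q‖)) + 1, by positivity, ?_⟩
    rintro (_ | _ | n) A hA
    · simp only [regWeight, norm_zero]
      linarith
    · simp only [regWeight, norm_one]
      linarith
    · have hA' : ‖A‖ ≤ |M| := hA.trans (le_abs_self M)
      simp only [regWeight, norm_mul]
      have h1 := norm_one_sub_mul_pow_le hq hA' (2 * (n + 2))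
      have h2 := norm_qPoch_le_of_le hq (norm_mul_pow_le hq hA' 2) n
      calc _ ≤ (1 + |M|) * Real.exp (|M| / (1 - ‖q‖)) :=
            mul_le_mul h1 h2 (norm_nonneg _) (by positivity)
        _ ≤ _ := by linarith

variable {a b c : ℂ}

lemma norm_mul_lt_one {a b : ℂ} (ha : ‖a‖ < 1) (hb : ‖b‖ < 1) : ‖a * b‖ < 1 := by
  rw [norm_mul]
  exact mul_lt_one_of_nonneg_of_lt_one_left (norm_nonneg _) ha hb.le

lemma one_sub_ne_zero_of_norm_lt_one {x : ℂ} (hx : ‖x‖ < 1) : 1 - x ≠ 0 := by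
  intro h
  have : x = 1 := by linear_combination -h
  rw [this] at hx
  simp at hx

/-- The two factors containing u are kept on the right: on circles with |u| → ∞ they must be
compared with (u; q)_∞ and cannot be replaced by a constant. -/
lemma exists_norm_wpTerm_div_le (hq : ‖q‖ < 1) (ha : ‖a‖ < 1) (hb : ‖b‖ < 1) (hc : ‖c‖ < 1)
    (M : ℝ) : ∃ K : ℝ, 0 < K ∧ ∀ (d v y : ℂ) (n : ℕ), ‖v * d / q‖ ≤ M →
      ‖v * y‖ ≤ M → ‖y‖ ≤ M →
      ∀ u : ℂ, ‖wpTerm q a b c d u v y n‖ ≤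
        K * ‖q / (d * y)‖ ^ n * ‖qPoch u q n * qPochInf (u * y / d * q ^ (n + 1)) q‖ := by
  obtain ⟨M1, hM1, h1⟩ := exists_norm_inv_qPoch_le hq (qPochInf_ne_zero_of_norm_lt_one hq hq)
  obtain ⟨M2, hM2, h2⟩ := exists_norm_inv_qPoch_le hq
    (qPochInf_ne_zero_of_norm_lt_one hq (norm_mul_lt_one ha hb))
  obtain ⟨M3, hM3, h3⟩ := exists_norm_inv_qPoch_le hq
    (qPochInf_ne_zero_of_norm_lt_one hq (norm_mul_lt_one ha hc))
  obtain ⟨M4, hM4, h4⟩ := exists_norm_inv_qPoch_le hq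
    (qPochInf_ne_zero_of_norm_lt_one hq (norm_mul_lt_one hb hc))
  set E := Real.exp (M / (1 - ‖q‖)) with hE
  have hE0 : 0 < E := Real.exp_pos _
  refine ⟨E * E * E * E * E * (M1 * M2 * M3 * M4), by positivity, ?_⟩
  intro d v y n hv hvy hy u
  have bnd : ∀ x : ℂ, ‖x‖ ≤ M → ‖qPoch x q n‖ ≤ E := fun x hx => norm_qPoch_le_of_le hq hx n
  have hay : ∀ x : ℂ, ‖x‖ < 1 → ‖x * y‖ ≤ M := fun x hx => by
    rw [norm_mul]
    exact (mul_le_of_le_one_left (norm_nonneg _) hx.le).trans hy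
  have e1 := bnd _ hv
  have e2 := bnd _ (hay a ha)
  have e3 := bnd _ (hay b hb)
  have e4 := bnd _ (hay c hc)
  have e5 : ‖qPochInf (v * y * q ^ n) q‖ ≤ E :=
    norm_qPochInf_le_of_le hq (norm_mul_pow_le hq hvy n)
  have hrew : wpTerm q a b c d u v y n =
      (qPoch (v * d / q) q n * qPoch (a * y) q n * qPoch (b * y) q n * qPoch (c * y) q n
        * qPochInf (v * y * q ^ n) q)
      * ((qPoch q q n)⁻¹ * (qPoch (a * b) q n)⁻¹ * (qPoch (a * c) q n)⁻¹ * (qPoch (b * c) q n)⁻¹)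
      * (q / (d * y)) ^ n * (qPoch u q n * qPochInf (u * y / d * q ^ (n + 1)) q) := by
    unfold wpTerm
    rw [div_eq_mul_inv, mul_inv, mul_inv, mul_inv]
    ring
  rw [hrew, norm_mul, norm_mul, norm_pow]
  refine mul_le_mul_of_nonneg_right (mul_le_mul_of_nonneg_right ?_ (by positivity))
    (norm_nonneg _)
  rw [norm_mul]
  refine mul_le_mul ?_ ?_ (norm_nonneg _) (by positivity)
  · simp only [norm_mul]
    gcongr
  · simp only [norm_mul]
    gcongr
    · exact h1 n
    · exact h2 n
    · exact h3 n
    · exact h4 n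

lemma exists_norm_wpTerm_le (hq : ‖q‖ < 1) (ha : ‖a‖ < 1) (hb : ‖b‖ < 1) (hc : ‖c‖ < 1)
    (M : ℝ) : ∃ K : ℝ, 0 < K ∧ ∀ (d u v y : ℂ) (n : ℕ), ‖u‖ ≤ M → ‖v * d / q‖ ≤ M →
      ‖v * y‖ ≤ M → ‖u * y / d‖ ≤ M → ‖y‖ ≤ M →
      ‖wpTerm q a b c d u v y n‖ ≤ K * ‖q / (d * y)‖ ^ n := by
  obtain ⟨K, hK, h⟩ := exists_norm_wpTerm_div_le hq ha hb hc M
  set E := Real.exp (M / (1 - ‖q‖)) with hE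
  refine ⟨K * (E * E), by positivity, fun d u v y n hu hv hvy huy hy => ?_⟩
  refine (h d v y n hv hvy hy u).trans ?_
  rw [mul_right_comm]
  refine mul_le_mul_of_nonneg_right (mul_le_mul_of_nonneg_left ?_ hK.le) (by positivity)
  rw [norm_mul]
  exact mul_le_mul (norm_qPoch_le_of_le hq hu n)
    (norm_qPochInf_le_of_le hq (norm_mul_pow_le hq huy _)) (norm_nonneg _) (by positivity)

variable {X : Type*} {l : Filter X} {ω : ℕ → ℂ → ℂ}

/-- Local uniform domination of the terms of the series. -/
lemma eventually_norm_wpTerm_le (hq : ‖q‖ < 1) (ha : ‖a‖ < 1) (hb : ‖b‖ < 1) (hc : ‖c‖ < 1)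
    (hω : IsTameWeight ω) {d u v y : X → ℂ} {d₀ u₀ v₀ y₀ : ℂ} (hd : Tendsto d l (𝓝 d₀))
    (hu : Tendsto u l (𝓝 u₀)) (hv : Tendsto v l (𝓝 v₀)) (hy : Tendsto y l (𝓝 y₀))
    (hd0 : d₀ ≠ 0) (hy0 : y₀ ≠ 0) (ht : ‖q / (d₀ * y₀)‖ < 1) :
    ∃ B : ℕ → ℝ, Summable B ∧ ∀ᶠ x in l, ∀ n,
      ‖ω n (a * b * c * y x / q) * wpTerm q a b c (d x) (u x) (v x) (y x) n‖ ≤ B n := by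
  have t1 := hu.norm
  have t2 := ((hv.mul hd).div_const q).norm
  have t3 := (hv.mul hy).norm
  have t4 : Tendsto (fun x => ‖u x * y x / d x‖) l (𝓝 ‖u₀ * y₀ / d₀‖) :=
    ((hu.mul hy).div hd hd0).norm
  have t5 := hy.norm
  have t6 : Tendsto (fun x => ‖q / (d x * y x)‖) l (𝓝 ‖q / (d₀ * y₀)‖) :=
    (tendsto_const_nhds.div (hd.mul hy) (mul_ne_zero hd0 hy0)).norm
  have t7 := ((hy.const_mul (a * b * c)).div_const q).norm
  obtain ⟨r, hr1, hr2⟩ := exists_between ht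
  obtain ⟨M, hM⟩ : ∃ M : ℝ, ‖u₀‖ < M ∧ ‖v₀ * d₀ / q‖ < M ∧ ‖v₀ * y₀‖ < M ∧ ‖u₀ * y₀ / d₀‖ < M ∧
      ‖y₀‖ < M ∧ ‖a * b * c * y₀ / q‖ < M := by
    refine ⟨‖u₀‖ + ‖v₀ * d₀ / q‖ + ‖v₀ * y₀‖ + ‖u₀ * y₀ / d₀‖ + ‖y₀‖ + ‖a * b * c * y₀ / q‖ + 1, ?_⟩
    have := norm_nonneg u₀
    have := norm_nonneg (v₀ * d₀ / q)
    have := norm_nonneg (v₀ * y₀)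
    have := norm_nonneg (u₀ * y₀ / d₀)
    have := norm_nonneg y₀
    have := norm_nonneg (a * b * c * y₀ / q)
    refine ⟨?_, ?_, ?_, ?_, ?_, ?_⟩ <;> linarith
  obtain ⟨K, hK, hbd⟩ := exists_norm_wpTerm_le hq ha hb hc M
  obtain ⟨K', hK', hbd'⟩ := hω.2 M
  have hr0 : 0 ≤ r := (norm_nonneg _).trans hr1.le
  refine ⟨fun n => K' * (K * r ^ n), ((summable_geometric_of_lt_one hr0 hr2).mul_left K).mul_left K',
    ?_⟩
  filter_upwards [t1.eventually_le_const hM.1, t2.eventually_le_const hM.2.1,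
    t3.eventually_le_const hM.2.2.1, t4.eventually_le_const hM.2.2.2.1,
    t5.eventually_le_const hM.2.2.2.2.1, t7.eventually_le_const hM.2.2.2.2.2,
    t6.eventually_le_const hr1] with x h1 h2 h3 h4 h5 h7 h6 n
  rw [norm_mul]
  refine mul_le_mul (hbd' n _ h7) ((hbd _ _ _ _ n h1 h2 h3 h4 h5).trans ?_) (norm_nonneg _) hK'.le
  gcongr

lemma summable_wpTerm (hq : ‖q‖ < 1) (ha : ‖a‖ < 1) (hb : ‖b‖ < 1) (hc : ‖c‖ < 1)
    (hω : IsTameWeight ω) {d u v y : ℂ} (hd0 : d ≠ 0) (hy0 : y ≠ 0) (ht : ‖q / (d * y)‖ < 1) :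
    Summable fun n => ω n (a * b * c * y / q) * wpTerm q a b c d u v y n := by
  -- Along the one-point filter the eventual bound is an ordinary bound.
  obtain ⟨B, hB, h⟩ := eventually_norm_wpTerm_le (l := pure ()) (X := Unit) hq ha hb hc hω
    (d := fun _ => d) (u := fun _ => u) (v := fun _ => v) (y := fun _ => y)
    tendsto_const_nhds tendsto_const_nhds tendsto_const_nhds tendsto_const_nhds hd0 hy0 ht
  exact Summable.of_norm_bounded hB h

/-- Dominated convergence with all of d, u, v, y moving along an arbitrary filter. Later this gives
joint continuity in ν and the point of the circle, and removes generic conditions on y and d by a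
limit. -/
lemma tendsto_tsum_wpTerm (hq : ‖q‖ < 1) (ha : ‖a‖ < 1) (hb : ‖b‖ < 1) (hc : ‖c‖ < 1)
    (hω : IsTameWeight ω) {d u v y : X → ℂ} {d₀ u₀ v₀ y₀ : ℂ} (hd : Tendsto d l (𝓝 d₀))
    (hu : Tendsto u l (𝓝 u₀)) (hv : Tendsto v l (𝓝 v₀)) (hy : Tendsto y l (𝓝 y₀))
    (hd0 : d₀ ≠ 0) (hy0 : y₀ ≠ 0) (ht : ‖q / (d₀ * y₀)‖ < 1) :
    Tendsto (fun x => ∑' n, ω n (a * b * c * y x / q) * wpTerm q a b c (d x) (u x) (v x) (y x) n) l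
      (𝓝 (∑' n, ω n (a * b * c * y₀ / q) * wpTerm q a b c d₀ u₀ v₀ y₀ n)) := by
  obtain ⟨B, hB, h⟩ := eventually_norm_wpTerm_le hq ha hb hc hω hd hu hv hy hd0 hy0 ht
  refine tendsto_tsum_of_dominated_convergence hB (fun n => ?_) h
  have P : ∀ {f : X → ℂ} {f₀ : ℂ}, Tendsto f l (𝓝 f₀) →
      Tendsto (fun x => qPoch (f x) q n) l (𝓝 (qPoch f₀ q n)) := fun hf =>
    ((continuous_qPoch q n).tendsto _).comp hf
  have PI : ∀ {f : X → ℂ} {f₀ : ℂ}, Tendsto f l (𝓝 f₀) →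
      Tendsto (fun x => qPochInf (f x) q) l (𝓝 (qPochInf f₀ q)) := fun hf =>
    ((continuous_qPochInf hq).tendsto _).comp hf
  refine Tendsto.mul (((hω.1 n).continuous.tendsto _).comp
    ((hy.const_mul (a * b * c)).div_const q)) ?_
  unfold wpTerm
  exact ((((((((P hu).mul (P ((hv.mul hd).div_const q))).mul (P (hy.const_mul a))).mul
    (P (hy.const_mul b))).mul (P (hy.const_mul c)))).div_const _).mul
    ((tendsto_const_nhds.div (hd.mul hy) (mul_ne_zero hd0 hy0)).pow n)).mul
    ((PI ((hv.mul hy).mul_const _)).mul (PI (((hu.mul hy).div hd hd0).mul_const _)))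

lemma tendsto_wpSum (hq : ‖q‖ < 1) (ha : ‖a‖ < 1) (hb : ‖b‖ < 1) (hc : ‖c‖ < 1)
    {d u v y : X → ℂ} {d₀ u₀ v₀ y₀ : ℂ} (hd : Tendsto d l (𝓝 d₀))
    (hu : Tendsto u l (𝓝 u₀)) (hv : Tendsto v l (𝓝 v₀)) (hy : Tendsto y l (𝓝 y₀))
    (hd0 : d₀ ≠ 0) (hy0 : y₀ ≠ 0) (ht : ‖q / (d₀ * y₀)‖ < 1) :
    Tendsto (fun x => wpSum q a b c (d x) (u x) (v x) (y x)) l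
      (𝓝 (wpSum q a b c d₀ u₀ v₀ y₀)) :=
  (((continuous_qPochInf hq).tendsto _).comp
    (tendsto_const_nhds.div (hd.mul hy) (mul_ne_zero hd0 hy0))).mul
    (tendsto_tsum_wpTerm hq ha hb hc (isTameWeight_wpWeight hq) hd hu hv hy hd0 hy0 ht)

lemma tendsto_regSum (hq : ‖q‖ < 1) (ha : ‖a‖ < 1) (hb : ‖b‖ < 1) (hc : ‖c‖ < 1)
    {d u v y : X → ℂ} {d₀ u₀ v₀ y₀ : ℂ} (hd : Tendsto d l (𝓝 d₀))
    (hu : Tendsto u l (𝓝 u₀)) (hv : Tendsto v l (𝓝 v₀)) (hy : Tendsto y l (𝓝 y₀))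
    (hd0 : d₀ ≠ 0) (hy0 : y₀ ≠ 0) (ht : ‖q / (d₀ * y₀)‖ < 1) :
    Tendsto (fun x => regSum q a b c (d x) (u x) (v x) (y x)) l
      (𝓝 (regSum q a b c d₀ u₀ v₀ y₀)) := by
  have PI : ∀ {f : X → ℂ} {f₀ : ℂ}, Tendsto f l (𝓝 f₀) →
      Tendsto (fun x => qPochInf (f x) q) l (𝓝 (qPochInf f₀ q)) := fun hf =>
    ((continuous_qPochInf hq).tendsto _).comp hf
  refine (PI (tendsto_const_nhds.div (hd.mul hy) (mul_ne_zero hd0 hy0))).mul (Tendsto.add ?_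
    (tendsto_tsum_wpTerm hq ha hb hc (isTameWeight_regWeight hq) hd hu hv hy hd0 hy0 ht))
  have hS : Tendsto (fun x => a * b * c * q / d x * (1 - u x) * (1 - v x * d x / q)) l
      (𝓝 (a * b * c * q / d₀ * (1 - u₀) * (1 - v₀ * d₀ / q))) :=
    ((tendsto_const_nhds.div hd hd0).mul (hu.const_sub 1)).mul (((hv.mul hd).div_const q).const_sub 1)
  unfold regHead
  exact (((PI ((hv.mul hy).mul_const _)).mul (PI (((hu.mul hy).div hd hd0).mul_const _))).mul
    (((hS.const_add _).add (((((hv.add ((hu.const_mul q).div hd hd0)).const_mul _).sub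
      (hS.mul_const _)).add ((hS.const_add _).const_mul _)).mul hy)).add
      (hS.mul (hy.pow 2)))).div_const _

section Differentiability

variable {d : ℂ} {u v y : ℂ → ℂ} {s : Set ℂ}

lemma differentiableOn_tsum_wpTerm (hq : ‖q‖ < 1) (ha : ‖a‖ < 1) (hb : ‖b‖ < 1) (hc : ‖c‖ < 1)
    (hω : IsTameWeight ω) (hs : IsOpen s) (hd : d ≠ 0) (hu : DifferentiableOn ℂ u s)
    (hv : DifferentiableOn ℂ v s) (hy : DifferentiableOn ℂ y s) (hy0 : ∀ z ∈ s, y z ≠ 0)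
    (ht : ∀ z ∈ s, ‖q / (d * y z)‖ < 1) :
    DifferentiableOn ℂ (fun z => ∑' n, ω n (a * b * c * y z / q) *
      wpTerm q a b c d (u z) (v z) (y z) n) s := by
  intro z hz
  have hsz : s ∈ 𝓝 z := hs.mem_nhds hz
  obtain ⟨B, hB, h⟩ := eventually_norm_wpTerm_le (d := fun _ => d) hq ha hb hc hω tendsto_const_nhds
    (hu.differentiableAt hsz).continuousAt (hv.differentiableAt hsz).continuousAt
    (hy.differentiableAt hsz).continuousAt hd (hy0 z hz) (ht z hz)
  obtain ⟨s', hs's, hs'o, hzs'⟩ := mem_nhds_iff.1 (inter_mem hsz h)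
  have key := Complex.differentiableOn_tsum_of_summable_norm (U := s')
    (F := fun n z => ω n (a * b * c * y z / q) * wpTerm q a b c d (u z) (v z) (y z) n) hB
    (fun n => ?_) hs'o (fun n w hw => (hs's hw).2 n)
  · exact (key.differentiableAt (hs'o.mem_nhds hzs')).differentiableWithinAt
  · have hss : s' ⊆ s := fun w hw => (hs's hw).1
    have hu' := hu.mono hss
    have hv' := hv.mono hss
    have hy' := hy.mono hss
    have hdy : ∀ w ∈ s', d * y w ≠ 0 := fun w hw => mul_ne_zero hd (hy0 w (hss hw))
    refine DifferentiableOn.mul ((hω.1 n).comp_differentiableOn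
      ((hy'.const_mul (a * b * c)).div_const q)) ?_
    unfold wpTerm
    have hdiv : DifferentiableOn ℂ (fun w => q / (d * y w)) s' :=
      (differentiableOn_const q).div (hy'.const_mul d) hdy
    exact ((((((((hu'.qPoch n).mul (((hv'.mul_const d).div_const q).qPoch n)).mul
      ((hy'.const_mul a).qPoch n)).mul ((hy'.const_mul b).qPoch n)).mul
      ((hy'.const_mul c).qPoch n))).div_const _).mul (hdiv.pow n)).mul
      ((((hv'.mul hy').mul_const _).qPochInf hq).mul
        ((((hu'.mul hy').div_const d).mul_const _).qPochInf hq))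

lemma differentiableOn_wpSum (hq : ‖q‖ < 1) (ha : ‖a‖ < 1) (hb : ‖b‖ < 1) (hc : ‖c‖ < 1)
    (hs : IsOpen s) (hd : d ≠ 0) (hu : DifferentiableOn ℂ u s)
    (hv : DifferentiableOn ℂ v s) (hy : DifferentiableOn ℂ y s) (hy0 : ∀ z ∈ s, y z ≠ 0)
    (ht : ∀ z ∈ s, ‖q / (d * y z)‖ < 1) :
    DifferentiableOn ℂ (fun z => wpSum q a b c d (u z) (v z) (y z)) s :=
  ((((differentiableOn_const q).div (hy.const_mul d)
    fun w hw => mul_ne_zero hd (hy0 w hw))).qPochInf hq).mul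
    (differentiableOn_tsum_wpTerm hq ha hb hc (isTameWeight_wpWeight hq) hs hd hu hv hy hy0 ht)

lemma differentiableOn_regSum (hq : ‖q‖ < 1) (ha : ‖a‖ < 1) (hb : ‖b‖ < 1) (hc : ‖c‖ < 1)
    (hs : IsOpen s) (hd : d ≠ 0) (hu : DifferentiableOn ℂ u s)
    (hv : DifferentiableOn ℂ v s) (hy : DifferentiableOn ℂ y s) (hy0 : ∀ z ∈ s, y z ≠ 0)
    (ht : ∀ z ∈ s, ‖q / (d * y z)‖ < 1) :
    DifferentiableOn ℂ (fun z => regSum q a b c d (u z) (v z) (y z)) s := by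
  refine ((((differentiableOn_const q).div (hy.const_mul d)
    fun w hw => mul_ne_zero hd (hy0 w hw))).qPochInf hq).mul (DifferentiableOn.add ?_
    (differentiableOn_tsum_wpTerm hq ha hb hc (isTameWeight_regWeight hq) hs hd hu hv hy hy0 ht))
  unfold regHead
  have h1 := ((hv.mul hy).mul_const q).qPochInf hq
  have h2 := (((hu.mul hy).div_const d).mul_const (q ^ 2)).qPochInf hq
  refine ((h1.mul h2).mul ?_).div_const _
  fun_prop

end Differentiability

/-- `wpSum` vanishes at `a b c y = 1`. -/
lemma wpSum_eq_mul_regSum (hq0 : q ≠ 0) (hq : ‖q‖ < 1) (ha : ‖a‖ < 1) (hb : ‖b‖ < 1)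
    (hc : ‖c‖ < 1) {d u v y : ℂ} (hd : d ≠ 0) (hy : y ≠ 0) (ht : ‖q / (d * y)‖ < 1)
    (huv : u * v = a * b * c) :
    wpSum q a b c d u v y = (1 - a * b * c * y) * regSum q a b c d u v y := by
  set A := a * b * c * y / q with hA
  have hAq : A * q = a * b * c * y := by rw [hA]; field_simp
  have s1 := summable_wpTerm (u := u) (v := v) hq ha hb hc (isTameWeight_wpWeight hq) hd hy ht
  have s2 := summable_wpTerm (u := u) (v := v) hq ha hb hc (isTameWeight_regWeight hq) hd hy ht
  rw [← hA] at s1 s2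
  unfold wpSum regSum
  rw [← hA]
  -- From the third term on, the weight itself contains the factor 1 - Aq = 1 - abcy. Only the first
  -- two terms need the relation uv = abc.
  have hw : ∀ n, wpWeight q (n + 2) A = (1 - a * b * c * y) * regWeight q (n + 2) A := by
    intro n
    simp only [wpWeight, regWeight]
    rw [qPoch_succ', ← hAq]
    ring_nf
  rw [← s1.sum_add_tsum_nat_add 2, ← s2.sum_add_tsum_nat_add 2]
  simp only [hw, mul_assoc (1 - a * b * c * y), tsum_mul_left]
  simp only [Finset.sum_range_succ, Finset.sum_range_zero, wpWeight, regWeight, qPoch_zero]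
  have h1q := one_sub_ne_zero_of_norm_lt_one hq
  have hab := one_sub_ne_zero_of_norm_lt_one (norm_mul_lt_one ha hb)
  have hac := one_sub_ne_zero_of_norm_lt_one (norm_mul_lt_one ha hc)
  have hbc := one_sub_ne_zero_of_norm_lt_one (norm_mul_lt_one hb hc)
  have key : wpTerm q a b c d u v y 0 + A * q * (1 - q) * wpTerm q a b c d u v y 1 =
      (1 - a * b * c * y) * regHead q a b c d u v y := by
    have e1 : wpTerm q a b c d u v y 0 = (1 - v * y) * (1 - u * y / d * q) *
        (qPochInf (v * y * q) q * qPochInf (u * y / d * q ^ 2) q) := by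
      unfold wpTerm
      simp only [qPoch_zero, pow_zero, mul_one, zero_add, pow_one]
      rw [qPochInf_eq hq (v * y), qPochInf_eq hq (u * y / d * q),
        show u * y / d * q ^ 2 = u * y / d * q * q by ring]
      ring
    have e2 : wpTerm q a b c d u v y 1 = (1 - u) * (1 - v * d / q) * (1 - a * y) * (1 - b * y) *
        (1 - c * y) / ((1 - q) * (1 - a * b) * (1 - a * c) * (1 - b * c)) * (q / (d * y)) *
        (qPochInf (v * y * q) q * qPochInf (u * y / d * q ^ 2) q) := by
      unfold wpTerm
      simp only [qPoch, Finset.prod_range_one, pow_zero, mul_one, pow_one]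
    rw [e1, e2, hAq, ← sub_eq_zero]
    unfold regHead
    generalize qPochInf (v * y * q) q = X
    generalize qPochInf (u * y / d * q ^ 2) q = Y
    -- The difference of the two sides is a multiple of uv - abc.
    trans X * Y * y ^ 2 * (q / d - a * b * c) * (u * v - a * b * c)
    · field_simp
      ring
    · rw [huv, sub_self, mul_zero]
  -- The weight 1 - Aq² is split as (1 - Aq) + Aq(1 - q): the first part is accounted for by
  -- `regWeight q 1`, the second is combined with the zeroth term in `key`.
  have hA' : wpTerm q a b c d u v y 1 * (1 - A * q ^ (2 * (0 + 1))) =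
      wpTerm q a b c d u v y 1 * (1 - a * b * c * y + A * q * (1 - q)) := by
    rw [hAq.symm]
    ring
  linear_combination qPochInf (q / (d * y)) q * (key + hA')

end VeryWellPoised

/-! ### Lowering relation: telescoping certificate -/

section Lowering

/-- The polynomial in the certificate for the lowering relation. -/
noncomputable def lowerPoly (q a b c w p : ℂ) : ℂ :=
  p * (1 - a * w) * (1 - b * w) * (1 - c * w) -
    (1 - a * b * c * w / q * p) *
      (1 + p * (1 - (a * w + b * w + c * w)) + a * b * c * w ^ 3 * p ^ 2)

/-- The partial sums of the difference of the two sides of the lowering relation. -/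
noncomputable def lowerCert (q a b c d u v w : ℂ) (N : ℕ) : ℂ :=
  qPoch u q (N + 1) * qPoch (v * d / q) q (N + 1) *
    (qPoch (a * w * q) q N * qPoch (b * w * q) q N * qPoch (c * w * q) q N) *
    qPoch (a * b * c * w) q N /
    (qPoch q q N * (qPoch (a * b) q (N + 1) * qPoch (a * c) q (N + 1) * qPoch (b * c) q (N + 1))) *
    (1 / (d * w)) ^ (N + 1) *
    (qPochInf (v * w * q ^ (N + 1)) q * qPochInf (u * w / d * q ^ (N + 2)) q) *
    lowerPoly q a b c w (q ^ (N + 1))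

/-- With the common factors removed and P in place of q^(N+1), this says that the next term of the
relation equals the increment of the certificate. Eliminating v leaves a rational identity in
independent variables. -/
lemma lowerPoly_step {q a b c d w P u v : ℂ} (hq : q ≠ 0) (hw : w ≠ 0) (hd : d ≠ 0)
    (hu : u ≠ 0) (huv : u * v = a * b * c) :
    (1 - q * w / d) * (1 - a * b * c * w * P ^ 2) * (1 - a * b * c * w / q * P) *
        ((1 - a * w * P) * (1 - b * w * P) * (1 - c * w * P)) *
        ((1 - a * b * P) * (1 - a * c * P) * (1 - b * c * P))
      - (1 - a * b * c * w / q * P ^ 2) * ((1 - a * w) * (1 - b * w) * (1 - c * w)) * P *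
        (1 - v * w * P) * (1 - u * w / d * q * P) *
        ((1 - a * b * P) * (1 - a * c * P) * (1 - b * c * P))
      + 1 / d * (q * w - 1 / w) * ((1 - u * P) * (1 - v * d / q * P)) *
        (1 - a * b * c * w * q * P ^ 2) * (1 - a * b * c * w / q * P) * (1 - a * b * c * w * P) *
        ((1 - a * w * P) * (1 - b * w * P) * (1 - c * w * P))
    = (1 - u * P) * (1 - v * d / q * P) * ((1 - a * w * P) * (1 - b * w * P) * (1 - c * w * P)) *
        (1 - a * b * c * w / q * P) * (1 / (d * w)) * lowerPoly q a b c w (q * P)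
      - (1 - P) * ((1 - a * b * P) * (1 - a * c * P) * (1 - b * c * P)) *
        lowerPoly q a b c w P * (1 - v * w * P) * (1 - u * w / d * q * P) := by
  obtain rfl : v = a * b * c / u := by rw [← huv]; field_simp
  unfold lowerPoly
  field_simp
  ring

/-- The bookkeeping of the induction step in `sum_lower`: Pochhammer symbols become independent
variables linked only by the listed relations, so the algebra reduces to a multiple of `step`. -/
lemma lower_combine {U0 E0 U1 E1 Xa Xb Xc B0 Z0 Z1 Z2 Z3 I1 J1 W1 W3 τ P g0 g1 k1 b1 b2 b3 b4 b5 b6 b7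
    e0 e1 e2 e3 x1 x2 x3 y4 y5 y6 z1 z2 z3 r1 r2 r3 r4 r5 r6 r7 r8 r9 : ℂ}
    (hZ0 : Z0 ≠ 0) (hZ1 : Z1 ≠ 0) (hZ2 : Z2 ≠ 0) (hZ3 : Z3 ≠ 0) (he0 : e0 ≠ 0) (he1 : e1 ≠ 0)
    (he2 : e2 ≠ 0) (he3 : e3 ≠ 0) (hz1 : z1 ≠ 0) (hz2 : z2 ≠ 0) (hz3 : z3 ≠ 0)
    (fac1 : b7 * W1 = b3 * B0 * b4) (fac3 : b7 * b6 * W3 = b1 * B0 * b4 * b5)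
    (y1 : r5 * U1 = U0 * r3) (y2 : r6 * E1 = E0 * r4)
    (step : k1 * b3 * b4 * (x1 * x2 * x3) * (e1 * e2 * e3) - b2 * (y4 * y5 * y6) * P * r1 * r2 *
      (e1 * e2 * e3) + r9 * r7 * (r3 * r4) * b1 * b4 * b5 * (x1 * x2 * x3) =
      r3 * r4 * (x1 * x2 * x3) * b4 * r8 * g1 - e0 * (e1 * e2 * e3) * g0 * r1 * r2) :
    U0 * E0 * (Xa * Xb * Xc) * B0 / (Z0 * (Z1 * Z2 * Z3)) * τ *
      (r1 * I1 * (r2 * J1)) * g0 + (k1 * b7 * (W1 * (U0 * E0 *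
      (Xa * x1 * (Xb * x2) * (Xc * x3)) /
        (Z0 * e0 * (Z1 * Z2 * Z3)) * τ * (I1 * J1))) - b2 * B0 * (U0 * E0 * (y4 * Xa) *
      (y5 * Xb) * (y6 * Xc) / (Z0 * e0 * Z1 * Z2 * Z3) * (P * τ) *
      (r1 * I1 * (r2 * J1))) + r9 * (r5 * r6) / (z1 * z2 * z3) *
      r7 * (b7 * b6) *
      (W3 * (U1 * E1 * (Xa * x1 * (Xb * x2) * (Xc * x3)) /
      (Z0 * e0 * (Z1 * e1 / z1 * (Z2 * e2 / z2) *
      (Z3 * e3 / z3))) * τ * (I1 * J1)))) = U0 * r3 * (E0 * r4) *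
      (Xa * x1 * (Xb * x2) * (Xc * x3)) *
      (B0 * b4) / (Z0 * e0 * (Z1 * e1 *
      (Z2 * e2) * (Z3 * e3))) * (τ * r8) * (I1 * J1) * g1 := by
  have d0 : ∀ x, x / (Z0 * (Z1 * Z2 * Z3)) =
      x * (e0 * e1 * e2 * e3) / (Z0 * Z1 * Z2 * Z3 * (e0 * e1 * e2 * e3)) := fun x => by field_simp
  have d1 : ∀ x, x / (Z0 * e0 * (Z1 * Z2 * Z3)) =
      x * (e1 * e2 * e3) / (Z0 * Z1 * Z2 * Z3 * (e0 * e1 * e2 * e3)) := fun x => by field_simp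
  have d2 : ∀ x, x / (Z0 * e0 * Z1 * Z2 * Z3) =
      x * (e1 * e2 * e3) / (Z0 * Z1 * Z2 * Z3 * (e0 * e1 * e2 * e3)) := fun x => by field_simp
  have d3 : ∀ x, x / (Z0 * e0 * (Z1 * e1 / z1 * (Z2 * e2 / z2) * (Z3 * e3 / z3))) =
      (z1 * z2 * z3) * (x / (Z0 * Z1 * Z2 * Z3 * (e0 * e1 * e2 * e3))) := fun x => by field_simp
  have d4 : ∀ x, x / (Z0 * e0 * (Z1 * e1 * (Z2 * e2) * (Z3 * e3))) =
      x / (Z0 * Z1 * Z2 * Z3 * (e0 * e1 * e2 * e3)) := fun x => by field_simp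
  have d5 : (z1 * z2 * z3)⁻¹ * (z1 * z2 * z3) = 1 := by field_simp
  rw [d0, d1, d2, d3, d4]
  generalize Z0 * Z1 * Z2 * Z3 * (e0 * e1 * e2 * e3) = D
  rw [div_eq_mul_inv _ (z1 * z2 * z3)]
  generalize (z1 * z2 * z3)⁻¹ = ζ at *
  generalize z1 * z2 * z3 = z at *
  simp only [div_eq_mul_inv]
  generalize D⁻¹ = M
  have q1 : k1 * b7 * (W1 * (U0 * E0 * (Xa * x1 * (Xb * x2) * (Xc * x3)) * (e1 * e2 * e3) * M * τ *
      (I1 * J1))) = k1 * (b3 * B0 * b4) * (U0 * E0 * (Xa * x1 * (Xb * x2) * (Xc * x3)) *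
      (e1 * e2 * e3) * M * τ * (I1 * J1)) := by rw [← fac1]; ring
  have q3 : r9 * (r5 * r6) * ζ * r7 * (b7 * b6) * (W3 * (z * (U1 * E1 *
      (Xa * x1 * (Xb * x2) * (Xc * x3)) * M) * τ * (I1 * J1))) = r9 * r7 * (b1 * B0 * b4 * b5) *
      ((U0 * r3) * (E0 * r4)) * (ζ * z) * (Xa * x1 * (Xb * x2) * (Xc * x3)) * M * τ * (I1 * J1) := by
    rw [← fac3, ← y1, ← y2]; ring
  rw [q1, q3, d5]
  linear_combination (U0 * E0 * (Xa * Xb * Xc) * B0 * τ * (I1 * J1) * M) * step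

variable {q a b c d u v w s : ℂ}

lemma wpTerm_mul_q (hq0 : q ≠ 0) (n : ℕ) : wpTerm q a b c d u v (q * w) n =
    qPoch u q n * qPoch (v * d / q) q n *
      (qPoch (a * w * q) q n * qPoch (b * w * q) q n * qPoch (c * w * q) q n)
    / (qPoch q q n * (qPoch (a * b) q n * qPoch (a * c) q n * qPoch (b * c) q n))
    * (1 / (d * w)) ^ n * (qPochInf (v * w * q ^ (n + 1)) q * qPochInf (u * w / d * q ^ (n + 2)) q)
    := by
  unfold wpTerm
  rw [show a * (q * w) = a * w * q by ring, show b * (q * w) = b * w * q by ring,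
    show c * (q * w) = c * w * q by ring, show q / (d * (q * w)) = 1 / (d * w) by field_simp,
    show v * (q * w) * q ^ n = v * w * q ^ (n + 1) by ring,
    show u * (q * w) / d * q ^ (n + 1) = u * w / d * q ^ (n + 2) by ring]
  simp only [mul_assoc]

/-- The parameters and the variable are scaled by s = √q, with u ↦ uq and v ↦ vs, which is
compatible with uv = abc. Every finite factorial then has its base multiplied by q relative to the
unshifted parameters, so its terms are comparable with those at w and qw. -/
lemma wpTerm_shift (hs : s * s = q) (hq0 : q ≠ 0) (n : ℕ) :
    wpTerm q (s * a) (s * b) (s * c) (s * d) (u * q) (v * s) (s * w) n =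
    qPoch (u * q) q n * qPoch (v * d / q * q) q n *
      (qPoch (a * w * q) q n * qPoch (b * w * q) q n * qPoch (c * w * q) q n)
    / (qPoch q q n * (qPoch (a * b * q) q n * qPoch (a * c * q) q n * qPoch (b * c * q) q n))
    * (1 / (d * w)) ^ n * (qPochInf (v * w * q ^ (n + 1)) q * qPochInf (u * w / d * q ^ (n + 2)) q)
    := by
  have hs0 : s ≠ 0 := by rintro rfl; simp at hs; exact hq0 hs.symm
  subst hs
  unfold wpTerm
  rw [show s * a * (s * w) = a * w * (s * s) by ring,
    show s * b * (s * w) = b * w * (s * s) by ring,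
    show s * c * (s * w) = c * w * (s * s) by ring,
    show s * a * (s * b) = a * b * (s * s) by ring, show s * a * (s * c) = a * c * (s * s) by ring,
    show s * b * (s * c) = b * c * (s * s) by ring,
    show v * s * (s * d) / (s * s) = v * d / (s * s) * (s * s) by field_simp,
    show s * s / (s * d * (s * w)) = 1 / (d * w) by field_simp,
    show v * s * (s * w) * (s * s) ^ n = v * w * (s * s) ^ (n + 1) by ring,
    show u * (s * s) * (s * w) / (s * d) * (s * s) ^ (n + 1) = u * w / d * (s * s) ^ (n + 2) by
      rw [pow_succ _ (n + 1)]; field_simp]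
  simp only [mul_assoc]

/-- The weights in the relations are taken at A, Aq and Aq². This and the following lemma bring the
last two to factorials comparable with those of the first. -/
lemma wpWeight_mul_succ (A : ℂ) (n : ℕ) :
    (1 - A * q) * wpWeight q (n + 1) (A * q) =
      (1 - A * q * q ^ (2 * (n + 1))) * qPoch (A * q) q n * (1 - A * q * q ^ n) := by
  simp only [wpWeight]
  rw [mul_assoc _ (qPoch (A * q) q n), ← qPoch_succ, qPoch_succ']
  ring

lemma wpWeight_mul_succ' (A : ℂ) (n : ℕ) :
    (1 - A) * (1 - A * q) * wpWeight q (n + 1) (A * q) =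
      (1 - A * q * q ^ (2 * (n + 1))) * qPoch A q n * (1 - A * q ^ n) * (1 - A * q ^ (n + 1)) := by
  simp only [wpWeight]
  have : qPoch A q n * (1 - A * q ^ n) * (1 - A * q ^ (n + 1)) =
      (1 - A) * ((1 - A * q) * qPoch (A * q * q) q n) := by
    rw [← qPoch_succ, ← qPoch_succ, qPoch_succ', qPoch_succ']
  linear_combination -(1 - A * q * q ^ (2 * (n + 1))) * this

/-- The sum of the first `N + 1` terms of the lowering relation. -/
lemma sum_lower (hs : s * s = q) (hq0 : q ≠ 0) (hq : ‖q‖ < 1) (ha : ‖a‖ < 1) (hb : ‖b‖ < 1)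
    (hc : ‖c‖ < 1) (hd : d ≠ 0) (hw : w ≠ 0) (hu : u ≠ 0) (huv : u * v = a * b * c) (N : ℕ) :
    ∑ n ∈ Finset.range (N + 1),
      ((1 - q * w / d) * (1 - a * b * c * w) *
          (wpWeight q n (a * b * c * w) * wpTerm q a b c d u v (q * w) n)
        - wpWeight q n (a * b * c * w / q) * wpTerm q a b c d u v w n
        + 1 / d * ((1 - u) * (1 - v * d / q)) / ((1 - a * b) * (1 - a * c) * (1 - b * c)) *
          (q * w - 1 / w) * ((1 - a * b * c * w) * (1 - a * b * c * w * q)) *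
          (wpWeight q n (a * b * c * w * q) *
            wpTerm q (s * a) (s * b) (s * c) (s * d) (u * q) (v * s) (s * w) n))
      = lowerCert q a b c d u v w N := by
  have nzq := qPoch_ne_zero_of_norm_lt_one hq hq
  have nzab := qPoch_ne_zero_of_norm_lt_one hq (norm_mul_lt_one ha hb)
  have nzac := qPoch_ne_zero_of_norm_lt_one hq (norm_mul_lt_one ha hc)
  have nzbc := qPoch_ne_zero_of_norm_lt_one hq (norm_mul_lt_one hb hc)
  have hab := one_sub_ne_zero_of_norm_lt_one (norm_mul_lt_one ha hb)
  have hac := one_sub_ne_zero_of_norm_lt_one (norm_mul_lt_one ha hc)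
  have hbc := one_sub_ne_zero_of_norm_lt_one (norm_mul_lt_one hb hc)
  simp only [wpTerm_mul_q hq0, wpTerm_shift hs hq0]
  induction N with
  | zero =>
    rw [Finset.sum_range_one]
    unfold wpTerm lowerCert lowerPoly
    simp only [wpWeight, qPoch, Finset.prod_range_one, Finset.prod_range_zero, pow_zero, zero_add,
      pow_one, mul_one]
    rw [qPochInf_eq hq (v * w), qPochInf_eq hq (u * w / d * q),
      show u * w / d * q ^ 2 = u * w / d * q * q by ring]
    obtain rfl : v = a * b * c / u := by rw [← huv]; field_simp
    generalize qPochInf (a * b * c / u * w * q) q = X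
    generalize qPochInf (u * w / d * q * q) q = Y
    field_simp
    ring
  | succ N ih =>
    rw [Finset.sum_range_succ, ih]
    have hP1 : 1 - q ^ (N + 1) ≠ 0 := by
      have := nzq (N + 1)
      rw [qPoch_succ] at this
      have := right_ne_zero_of_mul this
      rwa [← pow_succ'] at this
    have hPx : ∀ x, (∀ n, qPoch x q n ≠ 0) → 1 - x * q ^ (N + 1) ≠ 0 := fun x hx => by
      have := hx (N + 2)
      rw [qPoch_succ] at this
      exact right_ne_zero_of_mul this
    have hPab := hPx _ nzab
    have hPac := hPx _ nzac
    have hPbc := hPx _ nzbc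
    have step := lowerPoly_step (P := q ^ (N + 1)) hq0 hw hd hu huv
    have fac1 : (1 - a * b * c * w) * wpWeight q (N + 1) (a * b * c * w) =
        (1 - a * b * c * w * (q ^ (N + 1)) ^ 2) * qPoch (a * b * c * w) q N *
          (1 - a * b * c * w / q * q ^ (N + 1)) := by
      have := wpWeight_mul_succ (q := q) (a * b * c * w / q) N
      rw [div_mul_cancel₀ _ hq0] at this
      rw [this, mul_comm 2 (N + 1), pow_mul, pow_succ q N]
      field_simp
    have fac2 : wpWeight q (N + 1) (a * b * c * w / q) =
        (1 - a * b * c * w / q * (q ^ (N + 1)) ^ 2) * qPoch (a * b * c * w) q N := by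
      simp only [wpWeight]
      rw [div_mul_cancel₀ _ hq0, mul_comm 2 (N + 1), pow_mul]
    have fac3 : (1 - a * b * c * w) * (1 - a * b * c * w * q) *
        wpWeight q (N + 1) (a * b * c * w * q) =
        (1 - a * b * c * w * q * (q ^ (N + 1)) ^ 2) * qPoch (a * b * c * w) q N *
          (1 - a * b * c * w / q * q ^ (N + 1)) * (1 - a * b * c * w * q ^ (N + 1)) := by
      rw [wpWeight_mul_succ', mul_comm 2 (N + 1), pow_mul,
        show a * b * c * w / q * q ^ (N + 1) = a * b * c * w * q ^ N by
          rw [pow_succ]; field_simp]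
    have x1 : ∀ x, qPoch (x * w * q) q (N + 1) =
        qPoch (x * w * q) q N * (1 - x * w * q ^ (N + 1)) := fun x => by
      rw [qPoch_succ]; ring
    have x2 : ∀ x, qPoch (x * w) q (N + 1) = (1 - x * w) * qPoch (x * w * q) q N := fun x =>
      qPoch_succ' _ _ _
    have x3 : ∀ x, (1 - x) * qPoch (x * q) q (N + 1) =
        qPoch x q (N + 1) * (1 - x * q ^ (N + 1)) := fun x => by
      rw [← qPoch_succ', qPoch_succ]
    have x4 : qPoch q q (N + 1) = qPoch q q N * (1 - q ^ (N + 1)) := by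
      rw [qPoch_succ]; ring
    have x5 : ∀ x, (1 - x) ≠ 0 → qPoch (x * q) q (N + 1) =
        qPoch x q (N + 1) * (1 - x * q ^ (N + 1)) / (1 - x) := fun x hx => by
      rw [← x3]; field_simp
    have hI := qPochInf_mul_pow hq (v * w) (N + 1)
    have hJ := qPochInf_mul_pow hq (u * w / d) (N + 2)
    unfold lowerCert wpTerm
    rw [show u * w / d * q ^ (N + 1 + 1) = u * w / d * q ^ (N + 2) by ring,
      show u * w / d * q ^ (N + 1 + 2) = u * w / d * q ^ (N + 2 + 1) by ring, hI, hJ,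
      x5 _ hab, x5 _ hac, x5 _ hbc, x2 a, x2 b, x2 c, x1 a, x1 b, x1 c, x4, fac2,
      show (q / (d * w)) ^ (N + 1) = q ^ (N + 1) * (1 / (d * w)) ^ (N + 1) by
        rw [← mul_pow]; congr 1; ring,
      show (1 / (d * w)) ^ (N + 1 + 1) = (1 / (d * w)) ^ (N + 1) * (1 / (d * w)) from pow_succ _ _,
      qPoch_succ u q (N + 1), qPoch_succ (v * d / q) q (N + 1), qPoch_succ (a * b) q (N + 1),
      qPoch_succ (a * c) q (N + 1), qPoch_succ (b * c) q (N + 1),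
      qPoch_succ (a * b * c * w) q N,
      show a * b * c * w * q ^ N = a * b * c * w / q * q ^ (N + 1) by
        rw [pow_succ]; field_simp,
      show q ^ (N + 1 + 1) = q * q ^ (N + 1) by ring,
      show u * w / d * (q * q ^ (N + 1)) = u * w / d * q * q ^ (N + 1) by ring]
    -- From here on only the relations used by `lower_combine` are kept.
    have y1 := x3 u
    have y2 := x3 (v * d / q)
    have n1 := nzq N
    have n2 := nzab (N + 1)
    have n3 := nzac (N + 1)
    have n4 := nzbc (N + 1)
    generalize qPochInf (v * w * (q * q ^ (N + 1))) q = I1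
    generalize qPochInf (u * w / d * q ^ (N + 2 + 1)) q = J1
    generalize (1 / (d * w)) ^ (N + 1) = τ
    generalize qPoch q q N = Z0 at *
    generalize qPoch (a * b) q (N + 1) = Z1 at *
    generalize qPoch (a * c) q (N + 1) = Z2 at *
    generalize qPoch (b * c) q (N + 1) = Z3 at *
    generalize qPoch (a * w * q) q N = Xa at *
    generalize qPoch (b * w * q) q N = Xb at *
    generalize qPoch (c * w * q) q N = Xc at *
    generalize qPoch (a * b * c * w) q N = B0 at *
    generalize qPoch u q (N + 1) = U0 at *
    generalize qPoch (v * d / q) q (N + 1) = E0 at *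
    generalize qPoch (u * q) q (N + 1) = U1 at *
    generalize qPoch (v * d / q * q) q (N + 1) = E1 at *
    generalize wpWeight q (N + 1) (a * b * c * w) = W1 at *
    generalize wpWeight q (N + 1) (a * b * c * w * q) = W3 at *
    generalize lowerPoly q a b c w (q * q ^ (N + 1)) = g1 at *
    generalize lowerPoly q a b c w (q ^ (N + 1)) = g0 at *
    generalize q ^ (N + 1) = P at *
    clear hI hJ x1 x2 x3 x4 x5 hPx ih nzq nzab nzac nzbc fac2
    exact lower_combine n1 n2 n3 n4 hP1 hPab hPac hPbc hab hac hbc fac1 fac3 y1 y2 step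

end Lowering

/-! ### Raising relation: telescoping certificate -/

section Raising

/-- The polynomial in the certificate for the raising relation. -/
noncomputable def raisePoly (q a b c d z u v p : ℂ) : ℂ :=
  (z - 1 / z) * ((1 - u) * (1 - v * d / q) * p
      - (1 - a * b * c * z / q * p) * (p - a * b * c * d / q * p ^ 2))
    + (1 - a * b * c * z / q * p) * ((1 - u * p) * (1 - v * d / q * p)) / z

/-- The partial sums of the difference of the two sides of the raising relation. -/
noncomputable def raiseCert (q a b c d u v z : ℂ) (N : ℕ) : ℂ :=
  qPoch (u * q) q N * qPoch (v * d / q * q) q N *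
    (qPoch (a * z) q (N + 1) * qPoch (b * z) q (N + 1) * qPoch (c * z) q (N + 1)) *
    qPoch (a * b * c * z) q N /
    (qPoch q q N * (qPoch (a * b * q) q N * qPoch (a * c * q) q N * qPoch (b * c * q) q N)) *
    (1 / (d * z)) ^ (N + 1) *
    (qPochInf (v * z * q ^ (N + 1)) q * qPochInf (u * z / d * q ^ (N + 2)) q) *
    raisePoly q a b c d z u v (q ^ (N + 1))

/-- The counterpart of `lowerPoly_step`: the increment of the raising certificate with P in place of
q^(N+1). -/
lemma raisePoly_step {q a b c d z P u v : ℂ} (hq : q ≠ 0) (hw : z ≠ 0) (hd : d ≠ 0) (hu : u ≠ 0)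
    (huv : u * v = a * b * c) :
    z * ((1 - a / z) * (1 - b / z) * (1 - c / z)) * (1 - a * b * c * z * P ^ 2) *
        (1 - a * b * c * z / q * P) * ((1 - u * P) * (1 - v * d / q * P)) * P *
        ((1 - v * z * P) * (1 - u * z / d * q * P))
      - (1 - 1 / (d * z)) / z * ((1 - a * z * P) * (1 - b * z * P) * (1 - c * z * P)) *
        (1 - a * b * c * z * q * P ^ 2) * (1 - a * b * c * z * P) * (1 - a * b * c * z / q * P) *
        ((1 - u * P) * (1 - v * d / q * P))
      - (z - 1 / z) * ((1 - u) * (1 - v * d / q)) * (1 - a * b * c * z / q * P ^ 2) * P *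
        ((1 - a * b * P) * (1 - a * c * P) * (1 - b * c * P)) *
        ((1 - v * z * P) * (1 - u * z / d * q * P))
    = ((1 - u * P) * (1 - v * d / q * P)) *
        ((1 - a * z * P) * (1 - b * z * P) * (1 - c * z * P)) * (1 - a * b * c * z / q * P) *
        (1 / (d * z)) * raisePoly q a b c d z u v (q * P)
      - (1 - P) * ((1 - a * b * P) * (1 - a * c * P) * (1 - b * c * P)) *
        ((1 - v * z * P) * (1 - u * z / d * q * P)) * raisePoly q a b c d z u v P := by
  obtain rfl : v = a * b * c / u := by rw [← huv]; field_simp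
  unfold raisePoly
  field_simp
  ring

lemma raise_combine {U1 E1 Xa Xb Xc Ya Yb Yc B0 Z0 Z1 Z2 Z3 I1 J1 W1 W2 τ P g0 g1 m t b1 b2 b3 b4 b5
    b6 b7 e0 e1 e2 e3 x1 x2 x3 y4 y5 y6 z1 z2 z3 r1 r2 r3 r4 r5 r6 r7 r8 : ℂ}
    (hZ0 : Z0 ≠ 0) (hZ1 : Z1 ≠ 0) (hZ2 : Z2 ≠ 0) (hZ3 : Z3 ≠ 0) (he0 : e0 ≠ 0) (he1 : e1 ≠ 0)
    (he2 : e2 ≠ 0) (he3 : e3 ≠ 0) (hz1 : z1 ≠ 0) (hz2 : z2 ≠ 0) (hz3 : z3 ≠ 0)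
    (fac1 : b7 * W1 = b3 * B0 * b4) (fac3 : b7 * b6 * W2 = b1 * B0 * b4 * b5)
    (ya : y4 * Ya = Xa * x1) (yb : y5 * Yb = Xb * x2) (yc : y6 * Yc = Xc * x3)
    (step : m * b3 * b4 * (r3 * r4) * P * (r1 * r2) - t * (x1 * x2 * x3) * b1 * b5 * b4 * (r3 * r4)
      - r7 * (r5 * r6) * b2 * P * (e1 * e2 * e3) * (r1 * r2) =
      r3 * r4 * (x1 * x2 * x3) * b4 * r8 * g1 - e0 * (e1 * e2 * e3) * (r1 * r2) * g0) :
    U1 * E1 * (Xa * Xb * Xc) * B0 / (Z0 * (Z1 * Z2 * Z3)) * τ * (r1 * I1 * (r2 * J1)) * g0 +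
      (m * b7 * (W1 * (U1 * r3 * (E1 * r4) * (Xa * Xb * Xc) /
          (Z0 * e0 * (Z1 * e1 * (Z2 * e2) * (Z3 * e3))) * (P * τ) * (r1 * I1 * (r2 * J1))))
        - t * (y4 * y5 * y6) * (b7 * b6) * (W2 * (U1 * r3 * (E1 * r4) * (Ya * Yb * Yc) /
          (Z0 * e0 * (Z1 * e1 * (Z2 * e2) * (Z3 * e3))) * τ * (I1 * J1)))
        - z1 * z2 * z3 * r7 * (b2 * B0 * (r5 * U1 * (r6 * E1) * Xa * Xb * Xc /
          (Z0 * e0 * (z1 * Z1) * (z2 * Z2) * (z3 * Z3)) * (P * τ) * (r1 * I1 * (r2 * J1)))))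
    = U1 * r3 * (E1 * r4) * (Xa * x1 * (Xb * x2) * (Xc * x3)) * (B0 * b4) /
        (Z0 * e0 * (Z1 * e1 * (Z2 * e2) * (Z3 * e3))) * (τ * r8) * (I1 * J1) * g1 := by
  have d0 : ∀ x, x / (Z0 * (Z1 * Z2 * Z3)) =
      x * (e0 * e1 * e2 * e3) / (Z0 * Z1 * Z2 * Z3 * (e0 * e1 * e2 * e3)) := fun x => by field_simp
  have d2 : ∀ x, x / (Z0 * e0 * (z1 * Z1) * (z2 * Z2) * (z3 * Z3)) =
      (z1 * z2 * z3)⁻¹ * (x * (e1 * e2 * e3) / (Z0 * Z1 * Z2 * Z3 * (e0 * e1 * e2 * e3))) :=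
    fun x => by field_simp
  have d4 : ∀ x, x / (Z0 * e0 * (Z1 * e1 * (Z2 * e2) * (Z3 * e3))) =
      x / (Z0 * Z1 * Z2 * Z3 * (e0 * e1 * e2 * e3)) := fun x => by field_simp
  have d5 : (z1 * z2 * z3)⁻¹ * (z1 * z2 * z3) = 1 := by field_simp
  rw [d0, d4, d4, d2, d4]
  generalize Z0 * Z1 * Z2 * Z3 * (e0 * e1 * e2 * e3) = D
  generalize (z1 * z2 * z3)⁻¹ = ζ at *
  generalize z1 * z2 * z3 = z at *
  simp only [div_eq_mul_inv]
  generalize D⁻¹ = M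
  have q1 : m * b7 * (W1 * (U1 * r3 * (E1 * r4) * (Xa * Xb * Xc) * M * (P * τ) *
      (r1 * I1 * (r2 * J1)))) = m * (b3 * B0 * b4) * (U1 * r3 * (E1 * r4) * (Xa * Xb * Xc) * M *
      (P * τ) * (r1 * I1 * (r2 * J1))) := by rw [← fac1]; ring
  have q2 : t * (y4 * y5 * y6) * (b7 * b6) * (W2 * (U1 * r3 * (E1 * r4) * (Ya * Yb * Yc) * M * τ *
      (I1 * J1))) = t * (b1 * B0 * b4 * b5) * (U1 * r3 * (E1 * r4)) * (Xa * x1 * (Xb * x2) *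
      (Xc * x3)) * M * τ * (I1 * J1) := by
    rw [← fac3, ← ya, ← yb, ← yc]; ring
  have q3 : z * r7 * (b2 * B0 * (ζ * (r5 * U1 * (r6 * E1) * Xa * Xb * Xc * (e1 * e2 * e3) * M) *
      (P * τ) * (r1 * I1 * (r2 * J1)))) = ζ * z * r7 * (b2 * B0 * (r5 * U1 * (r6 * E1) * Xa * Xb *
      Xc * (e1 * e2 * e3) * M * (P * τ) * (r1 * I1 * (r2 * J1)))) := by ring
  rw [q1, q2, q3, d5]
  linear_combination (U1 * E1 * (Xa * Xb * Xc) * B0 * τ * (I1 * J1) * M) * step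

variable {q a b c d u v z s : ℂ}

lemma wpTerm_shift_div (hs : s * s = q) (hq0 : q ≠ 0) (n : ℕ) :
    wpTerm q (s * a) (s * b) (s * c) (s * d) (u * q) (v * s) (z / s) n =
    qPoch (u * q) q n * qPoch (v * d / q * q) q n *
      (qPoch (a * z) q n * qPoch (b * z) q n * qPoch (c * z) q n)
    / (qPoch q q n * (qPoch (a * b * q) q n * qPoch (a * c * q) q n * qPoch (b * c * q) q n))
    * (q / (d * z)) ^ n * (qPochInf (v * z * q ^ n) q * qPochInf (u * z / d * q ^ (n + 1)) q)
    := by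
  have hs0 : s ≠ 0 := by rintro rfl; simp at hs; exact hq0 hs.symm
  subst hs
  unfold wpTerm
  rw [show s * a * (z / s) = a * z by field_simp, show s * b * (z / s) = b * z by field_simp,
    show s * c * (z / s) = c * z by field_simp,
    show s * a * (s * b) = a * b * (s * s) by ring, show s * a * (s * c) = a * c * (s * s) by ring,
    show s * b * (s * c) = b * c * (s * s) by ring,
    show v * s * (s * d) / (s * s) = v * d / (s * s) * (s * s) by field_simp,
    show s * d * (z / s) = d * z by field_simp,
    show v * s * (z / s) = v * z by field_simp,
    show u * (s * s) * (z / s) / (s * d) = u * z / d by field_simp]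
  simp only [mul_assoc]

/-- The sum of the first `N + 1` terms of the raising relation. -/
lemma sum_raise (hs : s * s = q) (hq0 : q ≠ 0) (hq : ‖q‖ < 1) (ha : ‖a‖ < 1) (hb : ‖b‖ < 1)
    (hc : ‖c‖ < 1) (hd : d ≠ 0) (hz : z ≠ 0) (hu : u ≠ 0) (huv : u * v = a * b * c) (N : ℕ) :
    ∑ n ∈ Finset.range (N + 1),
      (z * ((1 - a / z) * (1 - b / z) * (1 - c / z)) * (1 - a * b * c * z) *
          (wpWeight q n (a * b * c * z) *
            wpTerm q (s * a) (s * b) (s * c) (s * d) (u * q) (v * s) (z / s) n)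
        - (1 - 1 / (d * z)) / z * ((1 - a * z) * (1 - b * z) * (1 - c * z)) *
          ((1 - a * b * c * z) * (1 - a * b * c * z * q)) *
          (wpWeight q n (a * b * c * z * q) *
            wpTerm q (s * a) (s * b) (s * c) (s * d) (u * q) (v * s) (s * z) n)
        - (1 - a * b) * (1 - a * c) * (1 - b * c) * (z - 1 / z) *
          (wpWeight q n (a * b * c * z / q) * wpTerm q a b c d u v z n))
      = raiseCert q a b c d u v z N := by
  have nzq := qPoch_ne_zero_of_norm_lt_one hq hq
  have hab := one_sub_ne_zero_of_norm_lt_one (norm_mul_lt_one ha hb)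
  have hac := one_sub_ne_zero_of_norm_lt_one (norm_mul_lt_one ha hc)
  have hbc := one_sub_ne_zero_of_norm_lt_one (norm_mul_lt_one hb hc)
  have nzab := qPoch_ne_zero_of_norm_lt_one hq (norm_mul_lt_one (norm_mul_lt_one ha hb) hq)
  have nzac := qPoch_ne_zero_of_norm_lt_one hq (norm_mul_lt_one (norm_mul_lt_one ha hc) hq)
  have nzbc := qPoch_ne_zero_of_norm_lt_one hq (norm_mul_lt_one (norm_mul_lt_one hb hc) hq)
  simp only [wpTerm_shift_div hs hq0, wpTerm_shift hs hq0]
  induction N with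
  | zero =>
    rw [Finset.sum_range_one]
    unfold wpTerm raiseCert raisePoly
    simp only [wpWeight, qPoch, Finset.prod_range_one, Finset.prod_range_zero, pow_zero, zero_add,
      pow_one, mul_one]
    rw [qPochInf_eq hq (v * z), qPochInf_eq hq (u * z / d * q),
      show u * z / d * q ^ 2 = u * z / d * q * q by ring]
    obtain rfl : v = a * b * c / u := by rw [← huv]; field_simp
    generalize qPochInf (a * b * c / u * z * q) q = X
    generalize qPochInf (u * z / d * q * q) q = Y
    field_simp
    ring
  | succ N ih =>
    rw [Finset.sum_range_succ, ih]
    have hP1 : 1 - q ^ (N + 1) ≠ 0 := by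
      have := nzq (N + 1)
      rw [qPoch_succ] at this
      have := right_ne_zero_of_mul this
      rwa [← pow_succ'] at this
    have hPx : ∀ x, (∀ n, qPoch (x * q) q n ≠ 0) → 1 - x * q ^ (N + 1) ≠ 0 := fun x hx => by
      have := hx (N + 1)
      rw [qPoch_succ] at this
      rw [pow_succ', ← mul_assoc]
      exact right_ne_zero_of_mul this
    have hPab := hPx _ nzab
    have hPac := hPx _ nzac
    have hPbc := hPx _ nzbc
    have step := raisePoly_step (P := q ^ (N + 1)) hq0 hz hd hu huv
    have fac1 : (1 - a * b * c * z) * wpWeight q (N + 1) (a * b * c * z) =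
        (1 - a * b * c * z * (q ^ (N + 1)) ^ 2) * qPoch (a * b * c * z) q N *
          (1 - a * b * c * z / q * q ^ (N + 1)) := by
      have := wpWeight_mul_succ (q := q) (a * b * c * z / q) N
      rw [div_mul_cancel₀ _ hq0] at this
      rw [this, mul_comm 2 (N + 1), pow_mul, pow_succ q N]
      field_simp
    have fac2 : wpWeight q (N + 1) (a * b * c * z / q) =
        (1 - a * b * c * z / q * (q ^ (N + 1)) ^ 2) * qPoch (a * b * c * z) q N := by
      simp only [wpWeight]
      rw [div_mul_cancel₀ _ hq0, mul_comm 2 (N + 1), pow_mul]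
    have fac3 : (1 - a * b * c * z) * (1 - a * b * c * z * q) *
        wpWeight q (N + 1) (a * b * c * z * q) =
        (1 - a * b * c * z * q * (q ^ (N + 1)) ^ 2) * qPoch (a * b * c * z) q N *
          (1 - a * b * c * z / q * q ^ (N + 1)) * (1 - a * b * c * z * q ^ (N + 1)) := by
      rw [wpWeight_mul_succ', mul_comm 2 (N + 1), pow_mul,
        show a * b * c * z / q * q ^ (N + 1) = a * b * c * z * q ^ N by
          rw [pow_succ]; field_simp]
    have x1 : ∀ x, qPoch (x * q) q (N + 1) =
        qPoch (x * q) q N * (1 - x * q ^ (N + 1)) := fun x => by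
      rw [qPoch_succ]; ring
    have x2 : ∀ x, qPoch x q (N + 1) = (1 - x) * qPoch (x * q) q N := fun x =>
      qPoch_succ' _ _ _
    have x3 : ∀ x, (1 - x) * qPoch (x * q) q (N + 1) =
        qPoch x q (N + 1) * (1 - x * q ^ (N + 1)) := fun x => by
      rw [← qPoch_succ', qPoch_succ]
    have x4 : qPoch q q (N + 1) = qPoch q q N * (1 - q ^ (N + 1)) := by
      rw [qPoch_succ]; ring
    have hI := qPochInf_mul_pow hq (v * z) (N + 1)
    have hJ := qPochInf_mul_pow hq (u * z / d) (N + 2)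
    have hya := x3 (a * z)
    have hyb := x3 (b * z)
    have hyc := x3 (c * z)
    unfold raiseCert wpTerm
    rw [show u * z / d * q ^ (N + 1 + 1) = u * z / d * q ^ (N + 2) by ring,
      show u * z / d * q ^ (N + 1 + 2) = u * z / d * q ^ (N + 2 + 1) by ring, hI, hJ,
      x1 (a * b), x1 (a * c), x1 (b * c), x2 (a * b), x2 (a * c), x2 (b * c),
      x4, fac2, x1 u, x1 (v * d / q), x2 u, x2 (v * d / q),
      show (q / (d * z)) ^ (N + 1) = q ^ (N + 1) * (1 / (d * z)) ^ (N + 1) by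
        rw [← mul_pow]; congr 1; ring,
      show (1 / (d * z)) ^ (N + 1 + 1) = (1 / (d * z)) ^ (N + 1) * (1 / (d * z)) from pow_succ _ _,
      qPoch_succ (a * z) q (N + 1), qPoch_succ (b * z) q (N + 1), qPoch_succ (c * z) q (N + 1),
      qPoch_succ (a * b * c * z) q N,
      show a * b * c * z * q ^ N = a * b * c * z / q * q ^ (N + 1) by
        rw [pow_succ]; field_simp,
      show q ^ (N + 1 + 1) = q * q ^ (N + 1) by ring,
      show u * z / d * (q * q ^ (N + 1)) = u * z / d * q * q ^ (N + 1) by ring]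
    exact raise_combine (nzq N) (nzab N) (nzac N) (nzbc N) hP1 hPab hPac hPbc hab hac hbc fac1 fac3
      hya hyb hyc step

end Raising

/-! ### Summation of the lowering and raising relations -/

section Relations

variable {q a b c d u v w y z s : ℂ} {ω : ℕ → ℂ → ℂ}

lemma qPoch_eq_zero_of_lt {n m : ℕ} (h : u * q ^ n = 1) (hm : n < m) : qPoch u q m = 0 := by
  rw [qPoch]
  exact Finset.prod_eq_zero (Finset.mem_range.2 hm) (by rw [h, sub_self])

lemma wpTerm_eq_zero_of_lt {n m : ℕ} (h : u * q ^ n = 1) (hm : n < m) :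
    wpTerm q a b c d u v y m = 0 := by
  simp [wpTerm, qPoch_eq_zero_of_lt h hm]

lemma summable_wpTerm_of_terminating (h : ∃ n : ℕ, u * q ^ n = 1) (A : ℂ) :
    Summable fun n => ω n A * wpTerm q a b c d u v y n := by
  obtain ⟨n, hn⟩ := h
  refine summable_of_ne_finset_zero (s := Finset.range (n + 1)) fun m hm => ?_
  rw [wpTerm_eq_zero_of_lt hn (by simpa using hm), mul_zero]

lemma summable_wpTerm_of_or (hq : ‖q‖ < 1) (ha : ‖a‖ < 1) (hb : ‖b‖ < 1) (hc : ‖c‖ < 1)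
    (hω : IsTameWeight ω) (hd0 : d ≠ 0) (hy0 : y ≠ 0)
    (h : ‖q / (d * y)‖ < 1 ∨ ∃ n : ℕ, u * q ^ n = 1) :
    Summable fun n => ω n (a * b * c * y / q) * wpTerm q a b c d u v y n := by
  rcases h with h | h
  · exact summable_wpTerm hq ha hb hc hω hd0 hy0 h
  · exact summable_wpTerm_of_terminating h _

/-- The telescoping principle: if the partial sums of a combination have a closed form tending to
zero, the combination of the full sums is zero. -/
lemma linear_tsum_eq_zero {f g h : ℕ → ℂ} (hf : Summable f) (hg : Summable g) (hh : Summable h)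
    {α β γ : ℂ} {C : ℕ → ℂ}
    (hC : ∀ N, ∑ n ∈ Finset.range (N + 1), (α * f n + β * g n + γ * h n) = C N)
    (hC0 : Tendsto C atTop (𝓝 0)) : α * ∑' n, f n + β * ∑' n, g n + γ * ∑' n, h n = 0 := by
  have h1 := (((hf.hasSum.mul_left α).add (hg.hasSum.mul_left β)).add
    (hh.hasSum.mul_left γ)).tendsto_sum_nat
  refine tendsto_nhds_unique ((tendsto_add_atTop_iff_nat 1).2 h1) (hC0.congr fun N => (hC N).symm)

lemma tendsto_mul_pow_succ_zero {X : ℕ → ℂ} {x t : ℂ} (hX : Tendsto X atTop (𝓝 x)) (ht : ‖t‖ < 1) :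
    Tendsto (fun N => X N * t ^ (N + 1)) atTop (𝓝 0) := by
  simpa using hX.mul
    ((tendsto_add_atTop_iff_nat 1).2 (tendsto_pow_atTop_nhds_zero_of_norm_lt_one ht))

lemma tendsto_qPoch_succ (hq : ‖q‖ < 1) (x : ℂ) :
    Tendsto (fun n => qPoch x q (n + 1)) atTop (𝓝 (qPochInf x q)) :=
  (tendsto_add_atTop_iff_nat 1).2 (tendsto_qPoch hq x)

lemma tendsto_qPochInf_mul_pow_add (hq : ‖q‖ < 1) (x : ℂ) (k : ℕ) :
    Tendsto (fun n : ℕ => qPochInf (x * q ^ (n + k)) q) atTop (𝓝 1) :=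
  (tendsto_add_atTop_iff_nat k).2 (tendsto_qPochInf_mul_pow hq x)

lemma tendsto_comp_pow_succ (hq : ‖q‖ < 1) {f : ℂ → ℂ} (hf : Continuous f) :
    Tendsto (fun n : ℕ => f (q ^ (n + 1))) atTop (𝓝 (f 0)) :=
  (hf.tendsto 0).comp ((tendsto_add_atTop_iff_nat 1).2
    (tendsto_pow_atTop_nhds_zero_of_norm_lt_one hq))

/-- All factors of the certificate have finite limits except the power of 1/(dw), which tends to
zero. -/
lemma tendsto_lowerCert (hq : ‖q‖ < 1) (ha : ‖a‖ < 1) (hb : ‖b‖ < 1) (hc : ‖c‖ < 1)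
    (ht : ‖1 / (d * w)‖ < 1) : Tendsto (lowerCert q a b c d u v w) atTop (𝓝 0) := by
  have hg : Continuous (lowerPoly q a b c w) := by unfold lowerPoly; fun_prop
  have h1 := (((tendsto_qPoch_succ hq u).mul (tendsto_qPoch_succ hq (v * d / q))).mul
    (((tendsto_qPoch hq (a * w * q)).mul (tendsto_qPoch hq (b * w * q))).mul
      (tendsto_qPoch hq (c * w * q)))).mul (tendsto_qPoch hq (a * b * c * w))
  have h2 := (tendsto_qPoch hq q).mul (((tendsto_qPoch_succ hq (a * b)).mul
    (tendsto_qPoch_succ hq (a * c))).mul (tendsto_qPoch_succ hq (b * c)))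
  have h3 := h1.div h2 (mul_ne_zero (qPochInf_ne_zero_of_norm_lt_one hq hq) (mul_ne_zero
    (mul_ne_zero (qPochInf_ne_zero_of_norm_lt_one hq (norm_mul_lt_one ha hb))
      (qPochInf_ne_zero_of_norm_lt_one hq (norm_mul_lt_one ha hc)))
    (qPochInf_ne_zero_of_norm_lt_one hq (norm_mul_lt_one hb hc))))
  have h4 := ((tendsto_mul_pow_succ_zero h3 ht).mul
    ((tendsto_qPochInf_mul_pow_add hq (v * w) 1).mul
      (tendsto_qPochInf_mul_pow_add hq (u * w / d) 2))).mul (tendsto_comp_pow_succ hq hg)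
  simp only [zero_mul] at h4
  exact h4

/-- Either the power of 1/(dz) tends to zero, or (uq; q)_N eventually vanishes. The second
alternative imposes no condition on z, as is needed for terminating series. -/
lemma tendsto_raiseCert (hq : ‖q‖ < 1) (ha : ‖a‖ < 1) (hb : ‖b‖ < 1) (hc : ‖c‖ < 1)
    (ht : ‖1 / (d * z)‖ < 1 ∨ ∃ n : ℕ, u * q * q ^ n = 1) :
    Tendsto (raiseCert q a b c d u v z) atTop (𝓝 0) := by
  rcases ht with ht | ⟨n, hn⟩
  · have hg : Continuous (raisePoly q a b c d z u v) := by unfold raisePoly; fun_prop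
    have h1 := (((tendsto_qPoch hq (u * q)).mul (tendsto_qPoch hq (v * d / q * q))).mul
      (((tendsto_qPoch_succ hq (a * z)).mul (tendsto_qPoch_succ hq (b * z))).mul
        (tendsto_qPoch_succ hq (c * z)))).mul (tendsto_qPoch hq (a * b * c * z))
    have h2 := (tendsto_qPoch hq q).mul (((tendsto_qPoch hq (a * b * q)).mul
      (tendsto_qPoch hq (a * c * q))).mul (tendsto_qPoch hq (b * c * q)))
    have nz : ∀ {x y : ℂ}, ‖x‖ < 1 → ‖y‖ < 1 → qPochInf (x * y * q) q ≠ 0 := fun hx hy =>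
      qPochInf_ne_zero_of_norm_lt_one hq (norm_mul_lt_one (norm_mul_lt_one hx hy) hq)
    have h3 := h1.div h2 (mul_ne_zero (qPochInf_ne_zero_of_norm_lt_one hq hq) (mul_ne_zero
      (mul_ne_zero (nz ha hb) (nz ha hc)) (nz hb hc)))
    have h4 := ((tendsto_mul_pow_succ_zero h3 ht).mul
      ((tendsto_qPochInf_mul_pow_add hq (v * z) 1).mul
        (tendsto_qPochInf_mul_pow_add hq (u * z / d) 2))).mul (tendsto_comp_pow_succ hq hg)
    simp only [zero_mul] at h4
    exact h4
  · refine tendsto_const_nhds.congr' ?_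
    filter_upwards [eventually_gt_atTop n] with N hN
    simp [raiseCert, qPoch_eq_zero_of_lt hn hN]

lemma norm_sq_eq (hs : s * s = q) : ‖s‖ * ‖s‖ = ‖q‖ := by rw [← norm_mul, hs]

lemma norm_lt_one_of_sq (hs : s * s = q) (hq : ‖q‖ < 1) : ‖s‖ < 1 := by
  have := norm_sq_eq hs
  nlinarith [norm_nonneg s]

/-- The lowering relation. -/
lemma wpSum_lower (hs : s * s = q) (hq0 : q ≠ 0) (hq : ‖q‖ < 1) (ha : ‖a‖ < 1) (hb : ‖b‖ < 1)
    (hc : ‖c‖ < 1) (hd : d ≠ 0) (hw : w ≠ 0) (hu : u ≠ 0) (huv : u * v = a * b * c)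
    (ht : ‖1 / (d * w)‖ < 1) :
    (1 - q * w / d) * (1 - a * b * c * w) * wpSum q a b c d u v (q * w)
      - (1 - 1 / (d * w)) * wpSum q a b c d u v w
      + 1 / d * ((1 - u) * (1 - v * d / q)) / ((1 - a * b) * (1 - a * c) * (1 - b * c)) *
        (q * w - 1 / w) * ((1 - a * b * c * w) * (1 - a * b * c * w * q)) *
        wpSum q (s * a) (s * b) (s * c) (s * d) (u * q) (v * s) (s * w) = 0 := by
  have hs0 : s ≠ 0 := by rintro rfl; simp at hs; exact hq0 hs.symm
  have hs1 := norm_lt_one_of_sq hs hq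
  have e1 : q / (d * (q * w)) = 1 / (d * w) := by field_simp
  have e2 : q / (s * d * (s * w)) = 1 / (d * w) := by rw [← hs]; field_simp
  have e3 : a * b * c * (q * w) / q = a * b * c * w := by field_simp
  have e4 : s * a * (s * b) * (s * c) * (s * w) / q = a * b * c * w * q := by rw [← hs]; field_simp
  have e5 : ‖q / (d * w)‖ < 1 := by
    rw [← mul_one_div, norm_mul]
    exact mul_lt_one_of_nonneg_of_lt_one_left (norm_nonneg _) hq ht.le
  have S1 := summable_wpTerm (u := u) (v := v) hq ha hb hc (isTameWeight_wpWeight hq) hd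
    (mul_ne_zero hq0 hw) (e1 ▸ ht)
  have S2 := summable_wpTerm (u := u) (v := v) hq ha hb hc (isTameWeight_wpWeight hq) hd hw e5
  have S3 := summable_wpTerm (u := u * q) (v := v * s) hq (norm_mul_lt_one hs1 ha)
    (norm_mul_lt_one hs1 hb) (norm_mul_lt_one hs1 hc)
    (isTameWeight_wpWeight hq) (mul_ne_zero hs0 hd) (mul_ne_zero hs0 hw) (e2 ▸ ht)
  rw [e3] at S1
  rw [e4] at S3
  have key := linear_tsum_eq_zero S1 S2 S3 (α := (1 - q * w / d) * (1 - a * b * c * w)) (β := -1)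
    (γ := 1 / d * ((1 - u) * (1 - v * d / q)) / ((1 - a * b) * (1 - a * c) * (1 - b * c)) *
      (q * w - 1 / w) * ((1 - a * b * c * w) * (1 - a * b * c * w * q)))
    (C := lowerCert q a b c d u v w)
    (fun N => by
      rw [← sum_lower hs hq0 hq ha hb hc hd hw hu huv N]
      exact Finset.sum_congr rfl fun n _ => by ring) (tendsto_lowerCert hq ha hb hc ht)
  unfold wpSum
  -- The infinite prefactor at w lacks the factor 1 - 1/(dw) that the other two prefactors contain;
  -- this produces the coefficient of the middle term.
  rw [e1, e2, e3, e4, show q / (d * w) = 1 / (d * w) * q by ring, qPochInf_eq hq (1 / (d * w))]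
  linear_combination ((1 - 1 / (d * w)) * qPochInf (1 / (d * w) * q) q) * key

/-- The raising relation. -/
lemma wpSum_raise (hs : s * s = q) (hq0 : q ≠ 0) (hq : ‖q‖ < 1) (ha : ‖a‖ < 1) (hb : ‖b‖ < 1)
    (hc : ‖c‖ < 1) (hd : d ≠ 0) (hz : z ≠ 0) (hu : u ≠ 0) (huv : u * v = a * b * c)
    (ht : ‖1 / (d * z)‖ < 1 ∨ ∃ n : ℕ, u * q * q ^ n = 1) :
    z * ((1 - a / z) * (1 - b / z) * (1 - c / z)) * (1 - a * b * c * z) *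
        wpSum q (s * a) (s * b) (s * c) (s * d) (u * q) (v * s) (z / s)
      - 1 / z * ((1 - a * z) * (1 - b * z) * (1 - c * z)) *
        ((1 - a * b * c * z) * (1 - a * b * c * z * q)) *
        wpSum q (s * a) (s * b) (s * c) (s * d) (u * q) (v * s) (s * z)
      - (1 - a * b) * (1 - a * c) * (1 - b * c) * (z - 1 / z) * wpSum q a b c d u v z = 0 := by
  have hs0 : s ≠ 0 := by rintro rfl; simp at hs; exact hq0 hs.symm
  have hs1 := norm_lt_one_of_sq hs hq
  have e1 : q / (s * d * (z / s)) = q / (d * z) := by field_simp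
  have e2 : q / (s * d * (s * z)) = 1 / (d * z) := by rw [← hs]; field_simp
  have e3 : s * a * (s * b) * (s * c) * (z / s) / q = a * b * c * z := by rw [← hs]; field_simp
  have e4 : s * a * (s * b) * (s * c) * (s * z) / q = a * b * c * z * q := by rw [← hs]; field_simp
  have ht2 : ‖q / (d * z)‖ < 1 ∨ ∃ n : ℕ, u * q * q ^ n = 1 := by
    refine ht.imp_left fun ht => ?_
    rw [← mul_one_div, norm_mul]
    exact mul_lt_one_of_nonneg_of_lt_one_left (norm_nonneg _) hq ht.le
  have ht3 : ‖q / (d * z)‖ < 1 ∨ ∃ n : ℕ, u * q ^ n = 1 := by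
    refine ht2.imp_right fun ⟨n, hn⟩ => ⟨n + 1, ?_⟩
    rw [← hn]; ring
  have S1 := summable_wpTerm_of_or (v := v * s) hq (norm_mul_lt_one hs1 ha)
    (norm_mul_lt_one hs1 hb) (norm_mul_lt_one hs1 hc) (isTameWeight_wpWeight hq)
    (mul_ne_zero hs0 hd) (div_ne_zero hz hs0) (e1 ▸ ht2)
  have S2 := summable_wpTerm_of_or (v := v * s) hq (norm_mul_lt_one hs1 ha)
    (norm_mul_lt_one hs1 hb) (norm_mul_lt_one hs1 hc) (isTameWeight_wpWeight hq)
    (mul_ne_zero hs0 hd) (mul_ne_zero hs0 hz) (e2 ▸ ht)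
  have S3 := summable_wpTerm_of_or (v := v) hq ha hb hc (isTameWeight_wpWeight hq) hd hz ht3
  rw [e3] at S1
  rw [e4] at S2
  have key := linear_tsum_eq_zero S1 S2 S3
    (α := z * ((1 - a / z) * (1 - b / z) * (1 - c / z)) * (1 - a * b * c * z))
    (β := -(1 / z * ((1 - a * z) * (1 - b * z) * (1 - c * z)) *
      ((1 - a * b * c * z) * (1 - a * b * c * z * q)) * (1 - 1 / (d * z))))
    (γ := -((1 - a * b) * (1 - a * c) * (1 - b * c) * (z - 1 / z)))
    (C := raiseCert q a b c d u v z)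
    (fun N => by
      rw [← sum_raise hs hq0 hq ha hb hc hd hz hu huv N]
      exact Finset.sum_congr rfl fun n _ => by ring) (tendsto_raiseCert hq ha hb hc ht)
  unfold wpSum
  rw [e1, e2, e3, e4, qPochInf_eq hq (1 / (d * z)), show 1 / (d * z) * q = q / (d * z) by ring]
  linear_combination qPochInf (q / (d * z)) q * key

end Relations

/-! ### Symmetry under y ↦ 1/y for terminating series -/

section Symmetry

variable {q a b c d u v w y z s : ℂ}

lemma wpSum_one : wpSum q a b c d 1 v y =
    qPochInf (q / (d * y)) q * (qPochInf (v * y) q * qPochInf (y / d * q) q) := by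
  unfold wpSum
  rw [tsum_eq_single 0 fun n hn => ?_]
  · simp [wpWeight, wpTerm, qPoch_zero]
  · rw [wpTerm_eq_zero_of_lt (n := 0) (by simp) (Nat.pos_of_ne_zero hn), mul_zero]

/-- Symmetry of the terminating series. -/
lemma wpSum_symm_of_terminating (hq0 : q ≠ 0) (hq : ‖q‖ < 1) (n : ℕ) : ∀ {a b c d u v y : ℂ},
    ‖a‖ < 1 → ‖b‖ < 1 → ‖c‖ < 1 → d ≠ 0 → y ≠ 0 → u * q ^ n = 1 → u * v = a * b * c →
    qPochInf (a * b * c * y) q ≠ 0 → qPochInf (a * b * c / y) q ≠ 0 →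
    wpSum q a b c d u v y * qPochInf (a * b * c / y) q =
      wpSum q a b c d u v y⁻¹ * qPochInf (a * b * c * y) q := by
  obtain ⟨s, hs⟩ : ∃ s : ℂ, s * s = q := ⟨q ^ (1 / 2 : ℂ), by
    rw [← Complex.cpow_add _ _ hq0]; norm_num⟩
  have hs0 : s ≠ 0 := by rintro rfl; simp at hs; exact hq0 hs.symm
  have hs1 := norm_lt_one_of_sq hs hq
  induction n with
  | zero =>
    intro a b c d u v y ha hb hc hd hy hu huv _ _
    rw [pow_zero, mul_one] at hu
    subst hu
    rw [one_mul] at huv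
    subst huv
    rw [wpSum_one, wpSum_one, show q / (d * y⁻¹) = y / d * q by field_simp,
      show y⁻¹ / d * q = q / (d * y) by field_simp,
      show a * b * c / y = a * b * c * y⁻¹ from div_eq_mul_inv _ _]
    ring
  | succ n ih =>
    intro a b c d u v y ha hb hc hd hy hu huv h1 h2
    have hu0 : u ≠ 0 := by rintro rfl; simp at hu
    -- At the fixed points y = ±1 the raising relation says nothing about the function, but the
    -- symmetry is trivial.
    by_cases hyy : y - 1 / y = 0
    · have : y⁻¹ = y := by rw [← one_div]; linear_combination -hyy
      rw [div_eq_mul_inv, this]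
    have hu' : u * q * q ^ n = 1 := by rw [← hu]; ring
    -- For uq the series terminates one step earlier. Raising at y and at 1/y expresses both sides
    -- by shifted functions at s y^{±1} and y^{±1}/s, which the induction hypothesis exchanges in
    -- pairs.
    have R1 := wpSum_raise hs hq0 hq ha hb hc hd hy hu0 huv (.inr ⟨n, hu'⟩)
    have R2 := wpSum_raise hs hq0 hq ha hb hc hd (inv_ne_zero hy) hu0 huv (.inr ⟨n, hu'⟩)
    rw [div_eq_mul_inv] at h2
    have f1 := qPochInf_eq hq (a * b * c * y)
    have f2 := qPochInf_eq hq (a * b * c * y⁻¹)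
    have f3 := qPochInf_eq hq (a * b * c * y * q)
    have f4 := qPochInf_eq hq (a * b * c * y⁻¹ * q)
    have huv' : u * q * (v * s) = s * a * (s * b) * (s * c) := by
      rw [← hs]; linear_combination s * s * s * huv
    have I1 := ih (norm_mul_lt_one hs1 ha) (norm_mul_lt_one hs1 hb) (norm_mul_lt_one hs1 hc)
      (mul_ne_zero hs0 hd) (y := s * y) (mul_ne_zero hs0 hy) hu' huv'
    have I2 := ih (norm_mul_lt_one hs1 ha) (norm_mul_lt_one hs1 hb) (norm_mul_lt_one hs1 hc)
      (mul_ne_zero hs0 hd) (y := s * y⁻¹) (mul_ne_zero hs0 (inv_ne_zero hy)) hu' huv'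
    have g1 : ∀ y : ℂ, s * a * (s * b) * (s * c) * (s * y) = a * b * c * y * q * q := fun y => by
      rw [← hs]; ring
    have g2 : s * a * (s * b) * (s * c) / (s * y) = a * b * c * y⁻¹ * q := by
      rw [← hs]; field_simp
    have g3 : s * a * (s * b) * (s * c) / (s * y⁻¹) = a * b * c * y * q := by
      rw [← hs]; field_simp
    have g4 : (s * y)⁻¹ = y⁻¹ / s := by rw [mul_inv]; ring
    have g5 : (s * y⁻¹)⁻¹ = y / s := by rw [mul_inv, inv_inv]; ring
    rw [g1, g2, g4] at I1
    rw [g1, g3, g5] at I2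
    rw [f1, f3] at h1
    rw [f2, f4] at h2
    obtain ⟨h11, h12⟩ := mul_ne_zero_iff.1 h1
    obtain ⟨h13, h14⟩ := mul_ne_zero_iff.1 h12
    obtain ⟨h21, h22⟩ := mul_ne_zero_iff.1 h2
    obtain ⟨h23, h24⟩ := mul_ne_zero_iff.1 h22
    have I1 := I1 h14 (by rw [f4]; exact h22)
    have I2 := I2 h24 (by rw [f3]; exact h12)
    have hab := one_sub_ne_zero_of_norm_lt_one (norm_mul_lt_one ha hb)
    have hac := one_sub_ne_zero_of_norm_lt_one (norm_mul_lt_one ha hc)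
    have hbc := one_sub_ne_zero_of_norm_lt_one (norm_mul_lt_one hb hc)
    rw [f4] at I1
    rw [f3] at I2
    rw [div_eq_mul_inv, f1, f2, f3, f4]
    simp only [one_mul, inv_inv, div_eq_mul_inv _ y, div_eq_mul_inv _ y⁻¹] at R1 R2 hyy ⊢
    have hne : (1 - a * b) * (1 - a * c) * (1 - b * c) * (y - y⁻¹) ≠ 0 :=
      mul_ne_zero (mul_ne_zero (mul_ne_zero hab hac) hbc) hyy
    apply mul_left_cancel₀ hne
    generalize wpSum q (s * a) (s * b) (s * c) (s * d) (u * q) (v * s) (s * y) = X1 at *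
    generalize wpSum q (s * a) (s * b) (s * c) (s * d) (u * q) (v * s) (s * y⁻¹) = X2 at *
    generalize wpSum q (s * a) (s * b) (s * c) (s * d) (u * q) (v * s) (y * s⁻¹) = X3 at *
    generalize wpSum q (s * a) (s * b) (s * c) (s * d) (u * q) (v * s) (y⁻¹ * s⁻¹) = X4 at *
    linear_combination
      -((1 - a * b * c * y⁻¹) * (1 - a * b * c * y⁻¹ * q) *
        qPochInf (a * b * c * y⁻¹ * q * q) q) * R1 -
      ((1 - a * b * c * y) * (1 - a * b * c * y * q) * qPochInf (a * b * c * y * q * q) q) * R2 -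
      y * ((1 - a * y⁻¹) * (1 - b * y⁻¹) * (1 - c * y⁻¹)) * ((1 - a * b * c * y) *
        (1 - a * b * c * y⁻¹) * (1 - a * b * c * y⁻¹ * q)) * I2 -
      y⁻¹ * ((1 - a * y) * (1 - b * y) * (1 - c * y)) * ((1 - a * b * c * y) *
        (1 - a * b * c * y⁻¹) * (1 - a * b * c * y * q)) * I1

end Symmetry

/-! ### Quotients by functions with simple zeros, and maximum principles -/

section Quotient

lemma exists_differentiableOn_div {S : Set ℂ} (hS : IsOpen S) {f g : ℂ → ℂ}
    (hf : DifferentiableOn ℂ f S) (hg : DifferentiableOn ℂ g S)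
    (h : ∀ z ∈ S, g z = 0 → f z = 0 ∧ deriv g z ≠ 0) :
    ∃ k : ℂ → ℂ, DifferentiableOn ℂ k S ∧ ∀ z ∈ S, f z = g z * k z := by
  classical
  -- At a zero of g the quotient takes the value given by l'Hôpital's rule; near it, f/g is the
  -- quotient of the difference slopes, which are analytic.
  refine ⟨fun z => if g z = 0 then deriv f z / deriv g z else f z / g z, fun z hz => ?_,
    fun z hz => ?_⟩
  · have hSz := hS.mem_nhds hz
    apply DifferentiableAt.differentiableWithinAt
    by_cases h0 : g z = 0
    · obtain ⟨hf0, hg0⟩ := h z hz h0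
      have df := ((Complex.differentiableOn_dslope hSz).2 hf).differentiableAt hSz
      have dg := ((Complex.differentiableOn_dslope hSz).2 hg).differentiableAt hSz
      have hne : dslope g z z ≠ 0 := by rwa [dslope_same]
      refine (df.div dg hne).congr_of_eventuallyEq ?_
      filter_upwards [dg.continuousAt.eventually_ne hne] with w hw
      have e1 := sub_smul_dslope f z w
      have e2 := sub_smul_dslope g z w
      rw [hf0, sub_zero, smul_eq_mul] at e1
      rw [h0, sub_zero, smul_eq_mul] at e2
      by_cases hwz : w = z
      · subst hwz
        simp [h0, dslope_same]
      · have hwz' : w - z ≠ 0 := sub_ne_zero.2 hwz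
        have : g w ≠ 0 := by rw [← e2]; exact mul_ne_zero hwz' hw
        simp only [this, if_false, Pi.div_apply]
        rw [← e1, ← e2, mul_div_mul_left _ _ hwz']
    · have df := hf.differentiableAt hSz
      have dg := hg.differentiableAt hSz
      refine (df.div dg h0).congr_of_eventuallyEq ?_
      filter_upwards [dg.continuousAt.eventually_ne h0] with w hw
      simp [hw]
  · by_cases h0 : g z = 0
    · simp [h0, (h z hz h0).1]
    · simp only [h0, if_false]
      field_simp

/-- By the maximum principle the value at u is bounded by the bound on every larger circle, and
these bounds tend to zero. -/
lemma eq_zero_of_norm_le_circle {h : ℂ → ℂ} (hh : Differentiable ℂ h) {R S : ℕ → ℝ}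
    (hR : Tendsto R atTop atTop) (hS : Tendsto S atTop (𝓝 0))
    (hb : ∀ᶠ N in atTop, ∀ u, ‖u‖ = R N → ‖h u‖ ≤ S N) (u : ℂ) : h u = 0 := by
  rw [← norm_le_zero_iff]
  refine ge_of_tendsto hS ?_
  filter_upwards [hb, hR.eventually_gt_atTop ‖u‖] with N hN hu
  refine Complex.norm_le_of_forall_mem_frontier_norm_le (U := Metric.ball 0 (R N))
    Metric.isBounded_ball hh.diffContOnCl (fun z hz => hN z ?_) (subset_closure (by simpa using hu))
  rw [frontier_ball _ ((norm_nonneg u).trans_lt hu).ne'] at hz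
  simpa using hz

/-- The same argument on annuli around the origin. The map u ↦ E/u carries the outer circle to the
inner one, so no behaviour at the origin itself has to be known. -/
lemma eq_zero_of_norm_le_two_circles {h : ℂ → ℂ} (hh : DifferentiableOn ℂ h {0}ᶜ) {R S : ℕ → ℝ}
    {E : ℂ} (hE : E ≠ 0) (hR : Tendsto R atTop atTop) (hS : Tendsto S atTop (𝓝 0))
    (hb : ∀ᶠ N in atTop, ∀ u, ‖u‖ = R N → ‖h u‖ ≤ S N ∧ ‖h (E / u)‖ ≤ S N) {u : ℂ}
    (hu : u ≠ 0) : h u = 0 := by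
  rw [← norm_le_zero_iff]
  refine ge_of_tendsto hS ?_
  have hu' : 0 < ‖u‖ := norm_pos_iff.2 hu
  filter_upwards [hb, hR.eventually_gt_atTop ‖u‖, hR.eventually_gt_atTop (‖E‖ / ‖u‖)] with
    N hN h1 h2
  have hRp : 0 < R N := hu'.trans h1
  have hEp : 0 < ‖E‖ := norm_pos_iff.2 hE
  have h3 : ‖E‖ / R N < ‖u‖ := by
    rw [div_lt_iff₀ hu'] at h2
    rw [div_lt_iff₀ hRp, mul_comm]
    exact h2
  have hcl : closure {z : ℂ | ‖E‖ / R N < ‖z‖ ∧ ‖z‖ < R N} ⊆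
      {z : ℂ | ‖E‖ / R N ≤ ‖z‖ ∧ ‖z‖ ≤ R N} :=
    closure_minimal (fun z hz => ⟨hz.1.le, hz.2.le⟩)
      ((isClosed_le continuous_const continuous_norm).inter
        (isClosed_le continuous_norm continuous_const))
  have hop : IsOpen {z : ℂ | ‖E‖ / R N < ‖z‖ ∧ ‖z‖ < R N} :=
    (isOpen_lt continuous_const continuous_norm).inter (isOpen_lt continuous_norm continuous_const)
  refine Complex.norm_le_of_forall_mem_frontier_norm_le
    (U := {z : ℂ | ‖E‖ / R N < ‖z‖ ∧ ‖z‖ < R N})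
    ((Metric.isBounded_ball (x := (0 : ℂ)) (r := R N)).subset fun z hz => by simpa using hz.2)
    (DifferentiableOn.diffContOnCl (hh.mono fun z hz => ?_)) (fun z hz => ?_)
    (subset_closure ⟨h3, h1⟩)
  · rintro rfl
    have := (hcl hz).1
    rw [norm_zero] at this
    exact absurd (div_pos hEp hRp) this.not_gt
  · have h4 := hcl hz.1
    have h5 : ¬ (‖E‖ / R N < ‖z‖ ∧ ‖z‖ < R N) := by
      have := hz.2
      rwa [hop.interior_eq] at this
    rcases h4.2.lt_or_eq with h6 | h6
    · have h7 : ‖z‖ = ‖E‖ / R N := le_antisymm (not_lt.1 fun h => h5 ⟨h, h6⟩) h4.1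
      have h8 : z ≠ 0 := by
        rw [← norm_pos_iff, h7]; positivity
      have := (hN (E / z) (by rw [norm_div, h7]; field_simp)).2
      rwa [show E / (E / z) = z by field_simp] at this
    · exact (hN z h6).1

end Quotient

/-! ### Growth of the series on circles |u| = |q|^{1/2-N} -/

section Growth

variable {q a b c d u v w y z s : ℂ}

/-- An entire function of w with value 1 at the origin has isolated zeros, also when x = 0. -/
lemma eventually_qPochInf_mul_ne_zero (hq : ‖q‖ < 1) (x y : ℂ) :
    ∀ᶠ w in 𝓝[≠] y, qPochInf (x * w) q ≠ 0 := by
  have hd : Differentiable ℂ fun w => qPochInf (x * w) q :=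
    (differentiable_qPochInf hq).comp (by fun_prop : Differentiable ℂ fun w => x * w)
  have ha : AnalyticOnNhd ℂ (fun w => qPochInf (x * w) q) Set.univ :=
    hd.differentiableOn.analyticOnNhd isOpen_univ
  refine ((ha y trivial).eventually_eq_zero_or_eventually_ne_zero).resolve_left fun h => ?_
  have := ha.eqOn_zero_of_preconnected_of_eventuallyEq_zero isPreconnected_univ (Set.mem_univ y) h
    (Set.mem_univ 0)
  simp [qPochInf_zero] at this

lemma eventually_qPochInf_div_ne_zero (hq : ‖q‖ < 1) (x : ℂ) (hy : y ≠ 0) :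
    ∀ᶠ w in 𝓝[≠] y, qPochInf (x / w) q ≠ 0 := by
  have h : Tendsto (fun w : ℂ => w⁻¹) (𝓝[≠] y) (𝓝[≠] y⁻¹) := by
    refine tendsto_nhdsWithin_iff.2
      ⟨((continuousAt_inv₀ hy).tendsto).mono_left nhdsWithin_le_nhds, ?_⟩
    filter_upwards [self_mem_nhdsWithin] with w hw
    simpa using hw
  filter_upwards [h.eventually (eventually_qPochInf_mul_ne_zero hq x y⁻¹)] with w hw
  rwa [div_eq_mul_inv]

lemma sq_norm_lt (hs : s * s = q) (hq0 : q ≠ 0) (hq : ‖q‖ < 1) : ‖q‖ < ‖s‖ := by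
  have h1 := norm_lt_one_of_sq hs hq
  have h2 := norm_sq_eq hs
  have h3 : 0 < ‖s‖ := norm_pos_iff.2 (by rintro rfl; simp at hs; exact hq0 hs.symm)
  nlinarith

/-- The zeros have modulus an integral power of |q|, whereas |x| is a half-integral power, since |s|
= |q|^{1/2}. -/
lemma qPochInf_ne_zero_of_norm_eq (hs : s * s = q) (hq0 : q ≠ 0) (hq : ‖q‖ < 1) {m : ℕ} {x : ℂ}
    (hx : ‖x‖ = ‖s‖ / ‖q‖ ^ m) : qPochInf x q ≠ 0 := by
  rw [qPochInf_ne_zero_iff hq]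
  intro k hk
  have hqp : 0 < ‖q‖ := norm_pos_iff.2 hq0
  have h1 : ‖s‖ * ‖q‖ ^ k = ‖q‖ ^ m := by
    have := congrArg norm hk
    rw [norm_mul, norm_pow, hx, norm_one] at this
    field_simp at this
    exact this
  have h2 : ‖q‖ ^ (2 * k + 1) = ‖q‖ ^ (2 * m) := by
    rw [pow_mul', ← h1, pow_succ, pow_mul', ← norm_sq_eq hs]; ring
  have := pow_right_injective₀ hqp hq.ne h2
  omega

/-- The first m factors of (σx; q)_∞/(x; q)_∞ on |x| = |q|^{1/2-m} have moduli close to |σ| when the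
argument is large, so their product decays like a geometric sequence; the remaining factors live in
the disc of radius |s|, where the ratio is bounded. -/
lemma exists_qPochInf_ratio_le (hs : s * s = q) (hq0 : q ≠ 0) (hq : ‖q‖ < 1) {σ : ℂ}
    (hσ : ‖σ‖ < 1) : ∃ p : ℕ → ℝ, (∀ n, 0 ≤ p n) ∧ Tendsto p atTop (𝓝 0) ∧
      (∀ m x, ‖x‖ = ‖s‖ / ‖q‖ ^ m → ‖qPochInf (σ * x) q‖ ≤ p m * ‖qPochInf x q‖) ∧
      (∀ x, ‖x‖ ≤ ‖s‖ → ‖qPochInf (σ * x) q‖ ≤ p 0 * ‖qPochInf x q‖) := by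
  have hs1 := norm_lt_one_of_sq hs hq
  have hqs := sq_norm_lt hs hq0 hq
  have hqp : 0 < ‖q‖ := norm_pos_iff.2 hq0
  have hsp : 0 < ‖s‖ := hqp.trans hqs
  obtain ⟨C, hC⟩ := (isCompact_closedBall (0 : ℂ) ‖s‖).exists_bound_of_continuousOn
    (f := fun x => qPochInf (σ * x) q / qPochInf x q)
    (ContinuousOn.div (((continuous_qPochInf hq).comp (continuous_const_mul σ)).continuousOn)
      (continuous_qPochInf hq).continuousOn fun x hx =>
        qPochInf_ne_zero_of_norm_lt_one hq ((by simpa using hx : ‖x‖ ≤ ‖s‖).trans_lt hs1))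
  have hC0 : 0 ≤ C := (norm_nonneg _).trans (hC 0 (by simp))
  set X : ℕ → ℝ := fun i => ‖s‖ / ‖q‖ ^ (i + 1) with hX
  have hX1 : ∀ i, 1 < X i := fun i => by
    rw [hX]
    simp only
    rw [one_lt_div (by positivity)]
    calc ‖q‖ ^ (i + 1) ≤ ‖q‖ ^ 1 := pow_le_pow_of_le_one hqp.le hq.le (by omega)
      _ < ‖s‖ := by simpa using hqs
  -- P m bounds the ratio of the first m factors, whose arguments have the moduli X 0, …, X (m-1).
  -- All these exceed 1, so the denominators are positive.
  set P : ℕ → ℝ := fun n => ∏ i ∈ Finset.range n, (1 + ‖σ‖ * X i) / (X i - 1) with hP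
  have hPpos : ∀ n, 0 < P n := fun n => Finset.prod_pos fun i _ =>
    div_pos (by nlinarith [norm_nonneg σ, hX1 i]) (by linarith [hX1 i])
  have hP0 : Tendsto P atTop (𝓝 0) := by
    refine (summable_of_ratio_test_tendsto_lt_one hσ
      (Eventually.of_forall fun n => (hPpos n).ne') ?_).tendsto_atTop_zero
    have h1 : Tendsto (fun n : ℕ => ‖q‖ ^ (n + 1) / ‖s‖) atTop (𝓝 0) := by
      simpa using ((tendsto_add_atTop_iff_nat 1).2
        (tendsto_pow_atTop_nhds_zero_of_lt_one hqp.le hq)).div_const ‖s‖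
    have h2 := (h1.add_const ‖σ‖).div (h1.const_sub 1) (by simp)
    simp only [zero_add, sub_zero, div_one] at h2
    refine h2.congr fun n => ?_
    rw [Real.norm_of_nonneg (hPpos _).le, Real.norm_of_nonneg (hPpos _).le]
    simp only [Pi.div_apply]
    rw [hP]
    simp only [Finset.prod_range_succ]
    rw [mul_div_cancel_left₀ _ (hPpos n).ne']
    have h3 := hX1 n
    have h4 : ‖q‖ ^ (n + 1) / ‖s‖ = 1 / X n := by rw [hX]; simp
    rw [h4]
    have h5 : X n - 1 ≠ 0 := by linarith
    have h6 : X n ≠ 0 := by linarith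
    have h7 : 1 - 1 / X n ≠ 0 := by
      rw [one_sub_div h6]; exact div_ne_zero h5 h6
    field_simp
  have small : ∀ x, ‖x‖ ≤ ‖s‖ → ‖qPochInf (σ * x) q‖ ≤ C * ‖qPochInf x q‖ := fun x hx => by
    have h1 := hC x (by simpa using hx)
    rwa [norm_div, div_le_iff₀ (norm_pos_iff.2
      (qPochInf_ne_zero_of_norm_lt_one hq (hx.trans_lt hs1)))] at h1
  refine ⟨fun n => C * P n, fun n => mul_nonneg hC0 (hPpos n).le, by simpa using hP0.const_mul C,
    fun m => ?_, fun x hx => by simpa [hP] using small x hx⟩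
  induction m with
  | zero => intro x hx; simpa [hP] using small x (by simpa using hx.le)
  | succ m ih =>
    intro x hx
    have hx' : ‖x‖ = X m := hx
    have h1 := ih (x * q) (by rw [norm_mul, hx, pow_succ]; field_simp)
    rw [qPochInf_eq hq (σ * x), qPochInf_eq hq x, norm_mul, norm_mul, mul_assoc σ]
    have h2 : ‖1 - σ * x‖ ≤ 1 + ‖σ‖ * X m := by
      refine (norm_sub_le _ _).trans ?_
      rw [norm_one, norm_mul, hx']
    have h3 : X m - 1 ≤ ‖1 - x‖ := by
      have := norm_sub_norm_le x 1
      rw [norm_one, hx', norm_sub_rev] at this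
      exact this
    have h4 := hX1 m
    have h5 : P (m + 1) = P m * ((1 + ‖σ‖ * X m) / (X m - 1)) := Finset.prod_range_succ _ _
    calc ‖1 - σ * x‖ * ‖qPochInf (σ * (x * q)) q‖
        ≤ (1 + ‖σ‖ * X m) * (C * P m * ‖qPochInf (x * q) q‖) :=
          mul_le_mul h2 h1 (norm_nonneg _) (by nlinarith [norm_nonneg σ])
      _ = C * P (m + 1) * ((X m - 1) * ‖qPochInf (x * q) q‖) := by
          have h6 : X m - 1 ≠ 0 := by linarith
          rw [h5]; field_simp
      _ ≤ C * P (m + 1) * (‖1 - x‖ * ‖qPochInf (x * q) q‖) :=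
          mul_le_mul_of_nonneg_left (mul_le_mul_of_nonneg_right h3 (norm_nonneg _))
            (mul_nonneg hC0 (hPpos _).le)

/-- In the n-th term, (u; q)_n times the ratio estimate at x = u q^n, σ = qy/d, reproduces (u; q)_∞
with a small factor p(N - n). Summing against the geometric series and letting N → ∞ under
domination gives a factor tending to zero. -/
lemma exists_norm_wpSum_le_circle (hs : s * s = q) (hq0 : q ≠ 0) (hq : ‖q‖ < 1) (ha : ‖a‖ < 1)
    (hb : ‖b‖ < 1) (hc : ‖c‖ < 1) (ht : ‖q / (d * y)‖ < 1) (ht' : ‖q * y / d‖ < 1) (k : ℂ) :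
    ∃ S : ℕ → ℝ, Tendsto S atTop (𝓝 0) ∧ ∀ N u, ‖u‖ = ‖s‖ / ‖q‖ ^ N →
      ‖wpSum q a b c d u (k / u) y‖ ≤ S N * ‖qPochInf u q‖ := by
  obtain ⟨p, hp0, hp, hpm, hps⟩ := exists_qPochInf_ratio_le hs hq0 hq ht'
  have hqp : 0 < ‖q‖ := norm_pos_iff.2 hq0
  have hsp : 0 < ‖s‖ := hqp.trans (sq_norm_lt hs hq0 hq)
  obtain ⟨K1, hK1, hω⟩ := (isTameWeight_wpWeight hq).2 ‖a * b * c * y / q‖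
  obtain ⟨K, hK, hterm⟩ := exists_norm_wpTerm_div_le hq ha hb hc
    (max (‖k * d / q‖ / ‖s‖) (max (‖k * y‖ / ‖s‖) ‖y‖))
  obtain ⟨B, hB⟩ := hp.bddAbove_range
  have hB' : ∀ n, p n ≤ B := fun n => hB ⟨n, rfl⟩
  have hB0 : 0 ≤ B := (hp0 0).trans (hB' 0)
  set r := ‖q / (d * y)‖ with hr
  have hr0 : 0 ≤ r := norm_nonneg _
  have hgeo := (summable_geometric_of_lt_one hr0 ht).mul_left (K1 * K * B)
  have hle : ∀ N n, ‖K1 * K * r ^ n * p (N - n)‖ ≤ K1 * K * B * r ^ n := fun N n => by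
    have := hp0 (N - n)
    rw [Real.norm_of_nonneg (by positivity), mul_right_comm _ B]
    exact mul_le_mul_of_nonneg_left (hB' _) (by positivity)
  have hsum : ∀ N, Summable fun n => K1 * K * r ^ n * p (N - n) := fun N =>
    Summable.of_norm_bounded hgeo (hle N)
  refine ⟨fun N => ‖qPochInf (q / (d * y)) q‖ * ∑' n, K1 * K * r ^ n * p (N - n), ?_,
    fun N u hu => ?_⟩
  · have h1 := tendsto_tsum_of_dominated_convergence (𝓕 := atTop)
      (f := fun N n => K1 * K * r ^ n * p (N - n)) (g := fun _ => 0) hgeo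
      (fun n => by
        have := (hp.comp (tendsto_sub_atTop_nat n)).const_mul (K1 * K * r ^ n)
        simpa using this) (Eventually.of_forall hle)
    simpa using h1.const_mul ‖qPochInf (q / (d * y)) q‖
  · unfold wpSum
    rw [norm_mul, mul_assoc ‖qPochInf (q / (d * y)) q‖]
    refine mul_le_mul_of_nonneg_left ?_ (norm_nonneg _)
    refine tsum_of_norm_bounded ((hsum N).hasSum.mul_right ‖qPochInf u q‖) fun n => ?_
    have hus : ‖s‖ ≤ ‖u‖ := by
      rw [hu, le_div_iff₀ (by positivity)]
      exact mul_le_of_le_one_right hsp.le (pow_le_one₀ hqp.le hq.le)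
    have g : ∀ x : ℂ, ‖x / u‖ ≤ ‖x‖ / ‖s‖ := fun x => by
      rw [norm_div]; exact div_le_div_of_nonneg_left (norm_nonneg _) hsp hus
    have g1 : ‖k / u * d / q‖ ≤ ‖k * d / q‖ / ‖s‖ := by
      rw [show k / u * d / q = k * d / q / u by ring]; exact g _
    have g2 : ‖k / u * y‖ ≤ ‖k * y‖ / ‖s‖ := by
      rw [show k / u * y = k * y / u by ring]; exact g _
    have h2 := hterm d (k / u) y n
      (g1.trans (le_max_left _ _)) (g2.trans ((le_max_left _ _).trans (le_max_right _ _)))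
      ((le_max_right _ _).trans (le_max_right _ _)) u
    have h3 : ‖qPochInf (q * y / d * (u * q ^ n)) q‖ ≤ p (N - n) * ‖qPochInf (u * q ^ n) q‖ := by
      have hn : ‖u * q ^ n‖ = ‖s‖ / ‖q‖ ^ N * ‖q‖ ^ n := by rw [norm_mul, norm_pow, hu]
      -- For n > N the subtraction truncates to 0, and p 0 is the right bound because |u q^n| ≤ |s|.
      rcases le_total n N with hnN | hnN
      · refine hpm _ _ ?_
        rw [hn, div_mul_eq_mul_div, div_eq_div_iff (by positivity) (by positivity), mul_assoc,
          ← pow_add, Nat.add_sub_cancel' hnN]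
      · rw [Nat.sub_eq_zero_of_le hnN]
        refine hps _ ?_
        rw [hn, div_mul_eq_mul_div, div_le_iff₀ (by positivity : 0 < ‖q‖ ^ N)]
        exact mul_le_mul_of_nonneg_left (pow_le_pow_of_le_one hqp.le hq.le hnN) hsp.le
    rw [norm_mul]
    calc ‖wpWeight q n (a * b * c * y / q)‖ * ‖wpTerm q a b c d u (k / u) y n‖
        ≤ K1 * (K * r ^ n * ‖qPoch u q n * qPochInf (u * y / d * q ^ (n + 1)) q‖) :=
          mul_le_mul (hω n _ le_rfl) h2 (norm_nonneg _) hK1.le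
      _ ≤ K1 * (K * r ^ n * (p (N - n) * ‖qPochInf u q‖)) := by
          rw [qPochInf_eq_qPoch_mul hq u n, norm_mul, norm_mul, mul_left_comm (p (N - n)),
            show u * y / d * q ^ (n + 1) = q * y / d * (u * q ^ n) by ring]
          gcongr
      _ = K1 * K * r ^ n * p (N - n) * ‖qPochInf u q‖ := by ring

end Growth

/-! ### Symmetry under y ↦ 1/y for arbitrary u -/

section NonterminatingSymmetry

variable {q a b c d u v w y z s : ℂ}

/-- The series is symmetric in u and vd/q. With v = abc/u this is the involution u ↦ E/u, E =
abcd/q, which yields a second sequence of terminating cases. -/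
lemma wpSum_swap (hq0 : q ≠ 0) (hd : d ≠ 0) :
    wpSum q a b c d (v * d / q) (u * q / d) y = wpSum q a b c d u v y := by
  unfold wpSum wpTerm
  congr 1
  refine tsum_congr fun n => ?_
  rw [show u * q / d * d / q = u by field_simp,
    show v * d / q * y / d * q ^ (n + 1) = v * y * q ^ n by field_simp; ring,
    show u * q / d * y * q ^ n = u * y / d * q ^ (n + 1) by ring]
  ring

lemma exists_mul_pow_eq_one (hq : ‖q‖ < 1) {x : ℂ} (hx : qPochInf x q = 0) :
    ∃ n : ℕ, x * q ^ n = 1 := by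
  by_contra! h
  exact (qPochInf_ne_zero_iff hq x).2 h hx

lemma tendsto_norm_div_pow (hq0 : q ≠ 0) (hq : ‖q‖ < 1) (hs : s ≠ 0) :
    Tendsto (fun N : ℕ => ‖s‖ / ‖q‖ ^ N) atTop atTop := by
  have h1 : Tendsto (fun N : ℕ => (‖q‖⁻¹) ^ N) atTop atTop :=
    tendsto_pow_atTop_atTop_of_one_lt ((one_lt_inv₀ (norm_pos_iff.2 hq0)).2 hq)
  exact (h1.const_mul_atTop (norm_pos_iff.2 hs)).congr fun N => by rw [inv_pow]; rfl

/-- The difference f of the two sides, as a function of u, vanishes whenever the series terminates,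
that is, at all zeros of g(u) = (u, E/u; q)_∞. These zeros are simple for generic d, so f/g is
analytic away from the origin; it tends to zero on large circles and, by invariance under u ↦ E/u,
on small ones, hence it is zero. -/
lemma wpSum_symm_of_generic (hq0 : q ≠ 0) (hq : ‖q‖ < 1) (ha : ‖a‖ < 1)
    (hb : ‖b‖ < 1) (hc : ‖c‖ < 1) (hd : d ≠ 0) (hy : y ≠ 0) (ht : ‖q / (d * y)‖ < 1)
    (ht' : ‖q * y / d‖ < 1) (h1 : qPochInf (a * b * c * y) q ≠ 0)
    (h2 : qPochInf (a * b * c / y) q ≠ 0) (h3 : qPochInf (a * b * c * d / q) q ≠ 0)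
    (hu : u ≠ 0) :
    wpSum q a b c d u (a * b * c / u) y * qPochInf (a * b * c / y) q =
      wpSum q a b c d u (a * b * c / u) y⁻¹ * qPochInf (a * b * c * y) q := by
  obtain ⟨s, hs⟩ : ∃ s : ℂ, s * s = q := ⟨q ^ (1 / 2 : ℂ), by
    rw [← Complex.cpow_add _ _ hq0]; norm_num⟩
  have hs0 : s ≠ 0 := by rintro rfl; simp at hs; exact hq0 hs.symm
  set k := a * b * c with hk
  set E := k * d / q with hE
  have hyi : y⁻¹ ≠ 0 := inv_ne_zero hy
  have hti : ‖q / (d * y⁻¹)‖ < 1 := by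
    rwa [show q / (d * y⁻¹) = q * y / d by field_simp]
  have hti' : ‖q * y⁻¹ / d‖ < 1 := by
    rwa [show q * y⁻¹ / d = q / (d * y) by field_simp]
  set f : ℂ → ℂ := fun u => wpSum q a b c d u (k / u) y * qPochInf (k / y) q -
    wpSum q a b c d u (k / u) y⁻¹ * qPochInf (k * y) q with hf
  set g : ℂ → ℂ := fun u => qPochInf u q * qPochInf (E / u) q with hg
  suffices f u = 0 from sub_eq_zero.1 this
  have fpow : ∀ (n : ℕ) (x : ℂ), x * q ^ n = 1 → f x = 0 := fun n x hx => by
    have hx0 : x ≠ 0 := by rintro rfl; simp at hx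
    exact sub_eq_zero.2 (wpSum_symm_of_terminating hq0 hq n ha hb hc hd hy hx
      (mul_div_cancel₀ _ hx0) h1 h2)
  have fE : ∀ x, E ≠ 0 → x ≠ 0 → f (E / x) = f x := fun x hE0 hx => by
    have hk0 : k ≠ 0 := by rintro h; simp [hE, h] at hE0
    simp only [hf]
    rw [show E / x = k / x * d / q by rw [hE]; field_simp,
      show k / (k / x * d / q) = x * q / d by field_simp, wpSum_swap hq0 hd, wpSum_swap hq0 hd]
  obtain ⟨S1, hS1, hb1⟩ := exists_norm_wpSum_le_circle hs hq0 hq ha hb hc ht ht' k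
  obtain ⟨S2, hS2, hb2⟩ := exists_norm_wpSum_le_circle hs hq0 hq ha hb hc hti hti' k
  -- The factor 2 absorbs the lower bound 1/2 for |(E/u; q)_∞|, valid once |u| is large.
  set S : ℕ → ℝ := fun N => 2 * (S1 N * ‖qPochInf (k / y) q‖ + S2 N * ‖qPochInf (k * y) q‖) with hS
  have hS0 : Tendsto S atTop (𝓝 0) := by
    simpa using ((hS1.mul_const ‖qPochInf (k / y) q‖).add
      (hS2.mul_const ‖qPochInf (k * y) q‖)).const_mul 2
  have hR := tendsto_norm_div_pow hq0 hq hs0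
  have hgl : ∀ᶠ N : ℕ in atTop, ∀ u : ℂ, ‖u‖ = ‖s‖ / ‖q‖ ^ N → g u ≠ 0 ∧ ‖f u‖ ≤ S N * ‖g u‖ := by
    have c1 : ContinuousAt (fun x => ‖qPochInf x q‖) 0 := (continuous_qPochInf hq).norm.continuousAt
    have c2 := c1.eventually (lt_mem_nhds (a := 1 / 2) (by simp [qPochInf_zero]; norm_num))
    obtain ⟨ε, hε, hε'⟩ := Metric.eventually_nhds_iff.1 c2
    filter_upwards [hR.eventually_gt_atTop (‖E‖ / ε)] with N hN u hu
    have hup : 0 < ‖u‖ := by rw [hu]; exact lt_of_le_of_lt (by positivity) hN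
    have h5 : 1 / 2 < ‖qPochInf (E / u) q‖ := by
      refine hε' ?_
      rw [dist_zero_right, norm_div]
      rw [← hu, div_lt_iff₀ hε] at hN
      rw [div_lt_iff₀ hup]
      linarith
    have h6 := qPochInf_ne_zero_of_norm_eq hs hq0 hq hu
    have h7 : qPochInf (E / u) q ≠ 0 := norm_pos_iff.1 (by linarith)
    refine ⟨mul_ne_zero h6 h7, ?_⟩
    have h8 : ‖f u‖ ≤ S N / 2 * ‖qPochInf u q‖ := by
      refine (norm_sub_le _ _).trans ?_
      rw [norm_mul, norm_mul]
      have e1 := mul_le_mul_of_nonneg_right (hb1 N u hu) (norm_nonneg (qPochInf (k / y) q))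
      have e2 := mul_le_mul_of_nonneg_right (hb2 N u hu) (norm_nonneg (qPochInf (k * y) q))
      simp only [hS]
      linarith
    have h9 : 0 ≤ S N / 2 * ‖qPochInf u q‖ := (norm_nonneg _).trans h8
    rw [hg]
    simp only
    rw [norm_mul]
    nlinarith
  have simple : ∀ x, x ≠ 0 → g x = 0 → f x = 0 ∧ deriv g x ≠ 0 := by
    intro x hx hgx
    have d1 : HasDerivAt (fun x => qPochInf x q) (deriv (fun x => qPochInf x q) x) x :=
      ((differentiable_qPochInf hq) x).hasDerivAt
    have d2 : HasDerivAt (fun x => qPochInf (E / x) q)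
        (deriv (fun x => qPochInf x q) (E / x) * (-E / x ^ 2)) x := by
      have h := ((differentiable_qPochInf hq) (E / x)).hasDerivAt.comp x
        ((hasDerivAt_inv hx).const_mul E)
      have e : -E / x ^ 2 = E * (-(x ^ 2)⁻¹) := by ring
      rw [e]
      exact h
    have d3 : deriv g x = _ := (d1.mul d2).deriv
    rw [d3]
    by_cases hx1 : qPochInf x q = 0
    · obtain ⟨n, hn⟩ := exists_mul_pow_eq_one hq hx1
      refine ⟨fpow n x hn, ?_⟩
      rw [hx1, zero_mul, add_zero]
      refine mul_ne_zero (deriv_qPochInf_ne_zero hq hq0 hx1) ?_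
      rw [qPochInf_ne_zero_iff hq]
      -- A common zero of the two factors of g would give E q^(n+m) = 1, which `h3` excludes.
      intro m hm
      refine (qPochInf_ne_zero_iff hq E).1 h3 (n + m) ?_
      have : E * q ^ m = x := by field_simp at hm; exact hm
      rw [pow_add, ← hn, ← this]; ring
    · have hx2 : qPochInf (E / x) q = 0 := (mul_eq_zero.1 hgx).resolve_left hx1
      have hE0 : E ≠ 0 := by
        intro h
        rw [h, zero_div, qPochInf_zero] at hx2
        exact one_ne_zero hx2
      obtain ⟨n, hn⟩ := exists_mul_pow_eq_one hq hx2
      refine ⟨by rw [← fE x hE0 hx]; exact fpow n _ hn, ?_⟩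
      rw [hx2, mul_zero, zero_add]
      exact mul_ne_zero hx1 (mul_ne_zero (deriv_qPochInf_ne_zero hq hq0 hx2)
        (div_ne_zero (neg_ne_zero.2 hE0) (pow_ne_zero _ hx)))
  have dU : ∀ {T : Set ℂ}, IsOpen T → DifferentiableOn ℂ (fun u => k / u) T →
      DifferentiableOn ℂ f T := fun hT hv =>
    ((differentiableOn_wpSum hq ha hb hc hT hd differentiableOn_id hv
      (differentiableOn_const y) (fun _ _ => hy) fun _ _ => ht).mul_const _).sub
    ((differentiableOn_wpSum hq ha hb hc hT hd differentiableOn_id hv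
      (differentiableOn_const y⁻¹) (fun _ _ => hyi) fun _ _ => hti).mul_const _)
  have quot_le : ∀ {N : ℕ} {x h : ℂ}, g x ≠ 0 → ‖f x‖ ≤ S N * ‖g x‖ → f x = g x * h →
      ‖h‖ ≤ S N := fun {N x h} hgx hfx hh => by
    rw [hh, norm_mul, mul_comm] at hfx
    exact le_of_mul_le_mul_right hfx (norm_pos_iff.2 hgx)
  -- If abc = 0 then E = 0 and v = 0: the functions are entire in u, and large circles suffice.
  by_cases hk0 : k = 0
  · have hE0 : E = 0 := by rw [hE, hk0]; simp
    have hg' : g = fun u => qPochInf u q := by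
      rw [hg, hE0]; simp [qPochInf_zero]
    obtain ⟨h, hh, hfh⟩ := exists_differentiableOn_div isOpen_univ (f := f) (g := g)
      (dU isOpen_univ (by simp only [hk0, zero_div]; exact differentiableOn_const 0))
      (by rw [hg']; exact (differentiable_qPochInf hq).differentiableOn) (fun x _ hx => by
        refine simple x ?_ hx
        rintro rfl
        simp [hg', qPochInf_zero] at hx)
    rw [differentiableOn_univ] at hh
    rw [hfh u trivial, eq_zero_of_norm_le_circle hh hR hS0 ?_, mul_zero]
    filter_upwards [hgl] with N hN x hx
    exact quot_le (hN x hx).1 (hN x hx).2 (hfh x trivial)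
  · have hE0 : E ≠ 0 := div_ne_zero (mul_ne_zero hk0 hd) hq0
    have dv : ∀ x : ℂ, DifferentiableOn ℂ (fun u => x / u) {0}ᶜ := fun x =>
      (differentiableOn_const x).div differentiableOn_id fun z hz => hz
    obtain ⟨h, hh, hfh⟩ := exists_differentiableOn_div (isOpen_compl_singleton (x := (0 : ℂ)))
      (f := f) (g := g) (dU isOpen_compl_singleton (dv k))
      ((differentiable_qPochInf hq).differentiableOn.mul ((dv E).qPochInf hq))
      (fun x hx => simple x hx)
    rw [hfh u hu, eq_zero_of_norm_le_two_circles hh hE0 hR hS0 ?_ hu, mul_zero]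
    filter_upwards [hgl, hR.eventually_gt_atTop 0] with N hN hN0 x hx
    have hx0 : x ≠ 0 := by rw [← norm_pos_iff, hx]; exact hN0
    have hgE : g (E / x) = g x := by
      simp only [hg]
      rw [show E / (E / x) = x by field_simp, mul_comm]
    refine ⟨quot_le (hN x hx).1 (hN x hx).2 (hfh x hx0), ?_⟩
    refine quot_le (x := E / x) ?_ ?_ (hfh _ (div_ne_zero hE0 hx0))
    · rw [hgE]; exact (hN x hx).1
    · rw [hgE, fE x hE0 hx0]; exact (hN x hx).2

/-- The symmetry under `y ↦ 1 / y`. -/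
lemma wpSum_symm (hq0 : q ≠ 0) (hq : ‖q‖ < 1) (ha : ‖a‖ < 1)
    (hb : ‖b‖ < 1) (hc : ‖c‖ < 1) (hd : d ≠ 0) (hy : y ≠ 0) (ht : ‖q / (d * y)‖ < 1)
    (ht' : ‖q * y / d‖ < 1) (hu : u ≠ 0) (huv : u * v = a * b * c) :
    wpSum q a b c d u v y * qPochInf (a * b * c / y) q =
      wpSum q a b c d u v y⁻¹ * qPochInf (a * b * c * y) q := by
  obtain rfl : v = a * b * c / u := by rw [← huv]; field_simp
  -- The generic conditions are removed in two limits: inside `key` in y, for the zeros of (abcy;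
  -- q)_∞ and (abc/y; q)_∞, and afterwards in d, for those of (abcd/q; q)_∞.
  have key : ∀ d : ℂ, d ≠ 0 → ‖q / (d * y)‖ < 1 → ‖q * y / d‖ < 1 →
      qPochInf (a * b * c * d / q) q ≠ 0 →
      wpSum q a b c d u (a * b * c / u) y * qPochInf (a * b * c / y) q =
      wpSum q a b c d u (a * b * c / u) y⁻¹ * qPochInf (a * b * c * y) q := by
    intro d hd ht ht' h3
    have hti : ‖q / (d * y⁻¹)‖ < 1 := by
      rwa [show q / (d * y⁻¹) = q * y / d by field_simp]
    have ty : Tendsto (fun y : ℂ => y) (𝓝[≠] y) (𝓝 y) := nhdsWithin_le_nhds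
    have tyi : Tendsto (fun y : ℂ => y⁻¹) (𝓝[≠] y) (𝓝 y⁻¹) :=
      (continuousAt_inv₀ hy).tendsto.mono_left nhdsWithin_le_nhds
    have P : ∀ {f : ℂ → ℂ} {f₀ : ℂ} {l : Filter ℂ}, Tendsto f l (𝓝 f₀) →
      Tendsto (fun x => qPochInf (f x) q) l (𝓝 (qPochInf f₀ q)) := fun hf =>
        ((continuous_qPochInf hq).tendsto _).comp hf
    have T1 := (tendsto_wpSum hq ha hb hc (tendsto_const_nhds (x := d)) (tendsto_const_nhds (x := u))
      (tendsto_const_nhds (x := a * b * c / u)) ty hd hy ht).mul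
      (P (tendsto_const_nhds (x := a * b * c) |>.div ty hy))
    have T2 := (tendsto_wpSum hq ha hb hc (tendsto_const_nhds (x := d)) (tendsto_const_nhds (x := u))
      (tendsto_const_nhds (x := a * b * c / u)) tyi hd (inv_ne_zero hy) hti).mul
      (P (ty.const_mul (a * b * c)))
    refine tendsto_nhds_unique_of_eventuallyEq T1 T2 ?_
    have o1 : ContinuousAt (fun y => ‖q / (d * y)‖) y :=
      (continuousAt_const.div (continuousAt_id.const_mul d) (mul_ne_zero hd hy)).norm
    have o2 : ContinuousAt (fun y => ‖q * y / d‖) y :=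
      ((continuousAt_id.const_mul q).div_const d).norm
    filter_upwards [eventually_qPochInf_mul_ne_zero hq (a * b * c) y,
      eventually_qPochInf_div_ne_zero hq (a * b * c) hy,
      nhdsWithin_le_nhds (o1.eventually_lt_const ht), nhdsWithin_le_nhds (o2.eventually_lt_const ht'),
      nhdsWithin_le_nhds (continuousAt_id.eventually_ne hy)] with z h1 h2 h4 h5 h6
    exact wpSum_symm_of_generic hq0 hq ha hb hc hd h6 h4 h5 h1 h2 h3 hu
  have hti : ‖q / (d * y⁻¹)‖ < 1 := by
    rwa [show q / (d * y⁻¹) = q * y / d by field_simp]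
  have td : Tendsto (fun d : ℂ => d) (𝓝[≠] d) (𝓝 d) := nhdsWithin_le_nhds
  have T1 := (tendsto_wpSum hq ha hb hc td (tendsto_const_nhds (x := u))
    (tendsto_const_nhds (x := a * b * c / u)) (tendsto_const_nhds (x := y)) hd hy ht).mul_const
    (qPochInf (a * b * c / y) q)
  have T2 := (tendsto_wpSum hq ha hb hc td (tendsto_const_nhds (x := u))
    (tendsto_const_nhds (x := a * b * c / u)) (tendsto_const_nhds (x := y⁻¹)) hd
    (inv_ne_zero hy) hti).mul_const (qPochInf (a * b * c * y) q)
  refine tendsto_nhds_unique_of_eventuallyEq T1 T2 ?_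
  have o1 : ContinuousAt (fun d => ‖q / (d * y)‖) d :=
    (continuousAt_const.div (continuousAt_id.mul_const y) (mul_ne_zero hd hy)).norm
  have o2 : ContinuousAt (fun d => ‖q * y / d‖) d :=
    (continuousAt_const.div continuousAt_id hd).norm
  filter_upwards [eventually_qPochInf_mul_ne_zero hq (a * b * c / q) d,
    nhdsWithin_le_nhds (o1.eventually_lt_const ht), nhdsWithin_le_nhds (o2.eventually_lt_const ht'),
    nhdsWithin_le_nhds (continuousAt_id.eventually_ne hd)] with z h1 h2 h4 h5
  exact key z h5 h2 h4 (by rwa [div_mul_eq_mul_div] at h1)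

end NonterminatingSymmetry

/-- The annulus is the image of a vertical strip under the exponential map. -/
lemma isPreconnected_annulus {r : ℝ} (hr : 0 < r) (R : ℝ) :
    IsPreconnected {z : ℂ | r < ‖z‖ ∧ ‖z‖ < R} := by
  have h1 : Convex ℝ (Complex.re ⁻¹' Set.Ioo (Real.log r) (Real.log R)) :=
    (convex_Ioo _ _).is_linear_preimage Complex.reLm.isLinear
  rcases le_or_gt R 0 with hR | hR
  · rw [show {z : ℂ | r < ‖z‖ ∧ ‖z‖ < R} = ∅ from Set.eq_empty_of_forall_notMem fun z hz =>
      absurd (hz.2.trans_le hR) (norm_nonneg z).not_gt]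
    exact isPreconnected_empty
  have h2 : Complex.exp '' (Complex.re ⁻¹' Set.Ioo (Real.log r) (Real.log R)) =
      {z : ℂ | r < ‖z‖ ∧ ‖z‖ < R} := by
    ext z
    constructor
    · rintro ⟨w, hw, rfl⟩
      rw [Set.mem_ofPred_eq, Complex.norm_exp]
      exact ⟨(Real.log_lt_iff_lt_exp hr).1 hw.1, (Real.lt_log_iff_exp_lt hR).1 hw.2⟩
    · rintro ⟨h3, h4⟩
      have hz : z ≠ 0 := norm_pos_iff.1 (hr.trans h3)
      refine ⟨Complex.log z, ?_, Complex.exp_log hz⟩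
      rw [Set.mem_preimage, Complex.log_re]
      exact ⟨Real.log_lt_log hr h3, Real.log_lt_log (hr.trans h3) h4⟩
  rw [← h2]
  exact h1.isPreconnected.image _ Complex.continuous_exp.continuousOn

/-- `v_ν` with all removable singularities removed, for `u = q^{-ν}` and `u v = a b c`. -/
noncomputable def vSum (q a b c d u v y : ℂ) : ℂ :=
  regSum q a b c d u v y / qPochInf (a * b * c * y * q) q

/-! ### The regularized function v_ν: symmetry and the q-difference equation -/

section VSum

variable {q a b c d u v w y z s : ℂ} {X : Type*} {l : Filter X}

/-- Only the factors of (abcy; q)_∞ after the first must be nonzero. A zero of the first one is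
already cancelled in `regSum`, so abcy = 1 is permitted. -/
lemma wpSum_eq_vSum (hq0 : q ≠ 0) (hq : ‖q‖ < 1) (ha : ‖a‖ < 1) (hb : ‖b‖ < 1)
    (hc : ‖c‖ < 1) (hd : d ≠ 0) (hy : y ≠ 0) (ht : ‖q / (d * y)‖ < 1)
    (huv : u * v = a * b * c) (h : qPochInf (a * b * c * y * q) q ≠ 0) :
    wpSum q a b c d u v y = vSum q a b c d u v y * qPochInf (a * b * c * y) q := by
  rw [wpSum_eq_mul_regSum hq0 hq ha hb hc hd hy ht huv, vSum, qPochInf_eq hq (a * b * c * y)]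
  field_simp

lemma tendsto_vSum (hq : ‖q‖ < 1) (ha : ‖a‖ < 1) (hb : ‖b‖ < 1) (hc : ‖c‖ < 1)
    {d u v y : X → ℂ} {d₀ u₀ v₀ y₀ : ℂ} (hd : Tendsto d l (𝓝 d₀))
    (hu : Tendsto u l (𝓝 u₀)) (hv : Tendsto v l (𝓝 v₀)) (hy : Tendsto y l (𝓝 y₀))
    (hd0 : d₀ ≠ 0) (hy0 : y₀ ≠ 0) (ht : ‖q / (d₀ * y₀)‖ < 1)
    (h : qPochInf (a * b * c * y₀ * q) q ≠ 0) :
    Tendsto (fun x => vSum q a b c (d x) (u x) (v x) (y x)) l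
      (𝓝 (vSum q a b c d₀ u₀ v₀ y₀)) :=
  (tendsto_regSum hq ha hb hc hd hu hv hy hd0 hy0 ht).div
    (((continuous_qPochInf hq).tendsto _).comp ((hy.const_mul _).mul_const q)) h

lemma differentiableOn_vSum (hq : ‖q‖ < 1) (ha : ‖a‖ < 1) (hb : ‖b‖ < 1) (hc : ‖c‖ < 1)
    {s : Set ℂ} {u v y : ℂ → ℂ}
    (hs : IsOpen s) (hd : d ≠ 0) (hu : DifferentiableOn ℂ u s)
    (hv : DifferentiableOn ℂ v s) (hy : DifferentiableOn ℂ y s) (hy0 : ∀ z ∈ s, y z ≠ 0)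
    (ht : ∀ z ∈ s, ‖q / (d * y z)‖ < 1) (h : ∀ z ∈ s, qPochInf (a * b * c * y z * q) q ≠ 0) :
    DifferentiableOn ℂ (fun z => vSum q a b c d (u z) (v z) (y z)) s :=
  (differentiableOn_regSum hq ha hb hc hs hd hu hv hy hy0 ht).div
    (((hy.const_mul _).mul_const q).qPochInf hq) h

lemma norm_lt_one_of_mul_eq (ha : ‖a‖ < 1) (hb : ‖b‖ < 1) (hc : ‖c‖ < 1) (hy : ‖y * q‖ ≤ 1) :
    ‖a * b * c * y * q‖ < 1 := by
  rw [mul_assoc _ y q, norm_mul]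
  exact mul_lt_one_of_nonneg_of_lt_one_left (norm_nonneg _)
    (norm_mul_lt_one (norm_mul_lt_one ha hb) hc) hy

/-- The symmetry of `v_ν` under `y ↦ 1 / y`. -/
lemma vSum_symm (hq0 : q ≠ 0) (hq : ‖q‖ < 1) (ha : ‖a‖ < 1)
    (hb : ‖b‖ < 1) (hc : ‖c‖ < 1) (hd : d ≠ 0) (hy : y ≠ 0) (ht : ‖q / (d * y)‖ < 1)
    (ht' : ‖q * y / d‖ < 1) (hu : u ≠ 0) (huv : u * v = a * b * c)
    (h1 : qPochInf (a * b * c * y * q) q ≠ 0) (h2 : qPochInf (a * b * c * y⁻¹ * q) q ≠ 0) :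
    vSum q a b c d u v y⁻¹ = vSum q a b c d u v y := by
  have hti : ∀ y : ℂ, q / (d * y⁻¹) = q * y / d := fun y => by
    rw [div_mul_eq_div_div, div_inv_eq_mul, div_mul_eq_mul_div]
  have ty : Tendsto (fun y : ℂ => y) (𝓝[≠] y) (𝓝 y) := nhdsWithin_le_nhds
  have tyi : Tendsto (fun y : ℂ => y⁻¹) (𝓝[≠] y) (𝓝 y⁻¹) :=
    (continuousAt_inv₀ hy).tendsto.mono_left nhdsWithin_le_nhds
  have T1 := tendsto_vSum hq ha hb hc (tendsto_const_nhds (x := d)) (tendsto_const_nhds (x := u))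
    (tendsto_const_nhds (x := v)) ty hd hy ht h1
  have T2 := tendsto_vSum hq ha hb hc (tendsto_const_nhds (x := d)) (tendsto_const_nhds (x := u))
    (tendsto_const_nhds (x := v)) tyi hd (inv_ne_zero hy) ((hti y).symm ▸ ht') h2
  refine tendsto_nhds_unique_of_eventuallyEq T2 T1 ?_
  have o1 : ContinuousAt (fun y => ‖q / (d * y)‖) y :=
    (continuousAt_const.div (continuousAt_id.const_mul d) (mul_ne_zero hd hy)).norm
  have o2 : ContinuousAt (fun y => ‖q * y / d‖) y :=
    ((continuousAt_id.const_mul q).div_const d).norm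
  filter_upwards [eventually_qPochInf_mul_ne_zero hq (a * b * c) y,
    eventually_qPochInf_div_ne_zero hq (a * b * c) hy,
    nhdsWithin_le_nhds (o1.eventually_lt_const ht), nhdsWithin_le_nhds (o2.eventually_lt_const ht'),
    nhdsWithin_le_nhds (continuousAt_id.eventually_ne hy)] with z g1 g2 g4 g5 g6
  have S := wpSum_symm hq0 hq ha hb hc hd g6 g4 g5 hu huv
  have g1' := g1
  have g2' := g2
  rw [qPochInf_eq hq] at g1'
  rw [qPochInf_eq hq, div_eq_mul_inv] at g2'
  rw [wpSum_eq_vSum hq0 hq ha hb hc hd g6 g4 huv (right_ne_zero_of_mul g1'),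
    wpSum_eq_vSum hq0 hq ha hb hc hd (inv_ne_zero g6) ((hti z).symm ▸ g5) huv
      (right_ne_zero_of_mul g2'), ← div_eq_mul_inv] at S
  refine (mul_right_cancel₀ (mul_ne_zero g1 g2) ?_).symm
  simp only [id] at S
  linear_combination S

/-- The second order `q`-difference equation. -/
lemma wpSum_second_order (hq0 : q ≠ 0) (hq : ‖q‖ < 1) (ha : ‖a‖ < 1) (hb : ‖b‖ < 1)
    (hc : ‖c‖ < 1) (hd : d ≠ 0) (hz : z ≠ 0) (hu : u ≠ 0) (huv : u * v = a * b * c)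
    (ht : ‖1 / (d * z)‖ < 1) :
    z * ((1 - a / z) * (1 - b / z) * (1 - c / z)) * (q * z - 1 / z) *
        ((1 - z / d) * (1 - a * b * c * z / q) * wpSum q a b c d u v z -
          (1 - q / (d * z)) * wpSum q a b c d u v (z / q))
      - 1 / z * ((1 - a * z) * (1 - b * z) * (1 - c * z)) * (z - q / z) *
        (1 - a * b * c * z / q) *
        ((1 - q * z / d) * (1 - a * b * c * z) * wpSum q a b c d u v (q * z) -
          (1 - 1 / (d * z)) * wpSum q a b c d u v z)
      + 1 / d * ((1 - u) * (1 - v * d / q)) * (z - 1 / z) * (1 - a * b * c * z / q) *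
        (q * z - 1 / z) * (z - q / z) * wpSum q a b c d u v z = 0 := by
  obtain ⟨s, hs⟩ : ∃ s : ℂ, s * s = q := ⟨q ^ (1 / 2 : ℂ), by
    rw [← Complex.cpow_add _ _ hq0]; norm_num⟩
  have hs0 : s ≠ 0 := by rintro rfl; simp at hs; exact hq0 hs.symm
  have e1 : 1 / (d * (z / q)) = q / (d * z) := by field_simp
  have ht1 : ‖1 / (d * (z / q))‖ < 1 := by
    rw [e1, ← mul_one_div, norm_mul]
    exact mul_lt_one_of_nonneg_of_lt_one_left (norm_nonneg _) hq ht.le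
  -- Lowering at z and at z/q gives the shifted function at sz and at z/s, which are the two values
  -- occurring in the raising relation at z.
  have L0 := wpSum_lower hs hq0 hq ha hb hc hd hz hu huv ht
  have L1 := wpSum_lower hs hq0 hq ha hb hc hd (div_ne_zero hz hq0) hu huv ht1
  have R := wpSum_raise hs hq0 hq ha hb hc hd hz hu huv (.inl ht)
  have hab := one_sub_ne_zero_of_norm_lt_one (norm_mul_lt_one ha hb)
  have hac := one_sub_ne_zero_of_norm_lt_one (norm_mul_lt_one ha hc)
  have hbc := one_sub_ne_zero_of_norm_lt_one (norm_mul_lt_one hb hc)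
  rw [show q * (z / q) = z by field_simp, e1, show s * (z / q) = z / s by rw [← hs]; field_simp,
    show 1 / (z / q) = q / z by field_simp, show a * b * c * (z / q) * q = a * b * c * z by
    field_simp, show a * b * c * (z / q) = a * b * c * z / q by ring] at L1
  generalize wpSum q (s * a) (s * b) (s * c) (s * d) (u * q) (v * s) (s * z) = X1 at *
  generalize wpSum q (s * a) (s * b) (s * c) (s * d) (u * q) (v * s) (z / s) = X3 at *
  generalize wpSum q a b c d u v z = U0 at *
  generalize wpSum q a b c d u v (q * z) = U1 at *
  generalize wpSum q a b c d u v (z / q) = U2 at *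
  generalize hF : (1 - a * b) * (1 - a * c) * (1 - b * c) = F at *
  have hF0 : F ≠ 0 := by rw [← hF]; exact mul_ne_zero (mul_ne_zero hab hac) hbc
  have R' : (z - 1 / z) * U0 = (z * ((1 - a / z) * (1 - b / z) * (1 - c / z)) *
      (1 - a * b * c * z) * X3 - 1 / z * ((1 - a * z) * (1 - b * z) * (1 - c * z)) *
        ((1 - a * b * c * z) * (1 - a * b * c * z * q)) * X1) / F := by
    rw [eq_div_iff hF0]; linear_combination -R
  linear_combination z * ((1 - a / z) * (1 - b / z) * (1 - c / z)) * (q * z - 1 / z) * L1 -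
    1 / z * ((1 - a * z) * (1 - b * z) * (1 - c * z)) * (z - q / z) *
      (1 - a * b * c * z / q) * L0 +
    1 / d * ((1 - u) * (1 - v * d / q)) * (1 - a * b * c * z / q) *
      (q * z - 1 / z) * (z - q / z) * R'

end VSum

/-! ### Continuation of the q-difference equation to the unit circle -/

section BoundaryEquation

variable {q a b c d u v w y z s : ℂ}

/-- The left-hand side of the second order equation, multiplied by `p₁ z`. -/
noncomputable def secondOrderOp (q a b c d m : ℂ) (f₁ f₂ f₃ p₁ p₂ : ℂ → ℂ) (z : ℂ) : ℂ :=
  p₁ z * (z * ((1 - a / z) * (1 - b / z) * (1 - c / z)) * (q * z - 1 / z) *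
        ((1 - z / d) * (1 - a * b * c * z / q) * f₁ z - (1 - q / (d * z)) * f₂ z)
      + 1 / z * ((1 - a * z) * (1 - b * z) * (1 - c * z)) * (z - q / z) *
        (1 - a * b * c * z / q) * ((1 - 1 / (d * z)) * f₁ z)
      + 1 / d * m * (z - 1 / z) * (1 - a * b * c * z / q) *
        (q * z - 1 / z) * (z - q / z) * f₁ z) -
    1 / z * ((1 - a * z) * (1 - b * z) * (1 - c * z)) * (z - q / z) *
        (1 - a * b * c * z / q) * ((1 - q * z / d) * p₂ z * f₃ z)

lemma differentiableAt_secondOrderOp {m : ℂ} {f₁ f₂ f₃ p₁ p₂ : ℂ → ℂ} (hd : d ≠ 0) (hz : z ≠ 0)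
    (h1 : DifferentiableAt ℂ f₁ z) (h2 : DifferentiableAt ℂ f₂ z) (h3 : DifferentiableAt ℂ f₃ z)
    (h4 : DifferentiableAt ℂ p₁ z) (h5 : DifferentiableAt ℂ p₂ z) :
    DifferentiableAt ℂ (secondOrderOp q a b c d m f₁ f₂ f₃ p₁ p₂) z := by
  have hdz : d * z ≠ 0 := mul_ne_zero hd hz
  unfold secondOrderOp
  fun_prop (disch := assumption)

/-- The direct argument needs |z| > 1/|d|, which may exclude the unit circle because |d| < 1 is
possible. Once the value at qz is replaced by that at 1/(qz), all terms are analytic on an annulus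
containing the circle, and the identity theorem carries the equation over. -/
lemma secondOrderOp_eq_zero (hq0 : q ≠ 0) (hq : ‖q‖ < 1) (ha : ‖a‖ < 1) (hb : ‖b‖ < 1)
    (hc : ‖c‖ < 1) (hd : d ≠ 0) (hqd : ‖q / d‖ < 1) (hu : u ≠ 0) (huv : u * v = a * b * c)
    (hz : ‖q / d‖ < ‖z‖ ∧ ‖z‖ < ‖d‖ / ‖q‖ ^ 2) :
    secondOrderOp q a b c d ((1 - u) * (1 - v * d / q)) (fun z => wpSum q a b c d u v z)
      (fun z => wpSum q a b c d u v (z / q)) (fun z => wpSum q a b c d u v (q * z)⁻¹)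
      (fun z => qPochInf (a * b * c / (q * z)) q) (fun z => qPochInf (a * b * c * z) q) z = 0 := by
  have hqp : 0 < ‖q‖ := norm_pos_iff.2 hq0
  have hdp : 0 < ‖d‖ := norm_pos_iff.2 hd
  have hqd' : ‖q‖ < ‖d‖ := by rwa [norm_div, div_lt_one hdp] at hqd
  set A := {z : ℂ | ‖q / d‖ < ‖z‖ ∧ ‖z‖ < ‖d‖ / ‖q‖ ^ 2} with hA
  have hAo : IsOpen A :=
    (isOpen_lt continuous_const continuous_norm).inter (isOpen_lt continuous_norm continuous_const)
  have hA0 : ∀ z ∈ A, z ≠ 0 := fun z hz => norm_pos_iff.1 ((norm_nonneg _).trans_lt hz.1)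
  have t1 : ∀ z ∈ A, ‖q / (d * z)‖ < 1 := fun z hz => by
    rw [← div_div, norm_div, div_lt_one (norm_pos_iff.2 (hA0 z hz))]; exact hz.1
  have t2 : ∀ z ∈ A, ‖q / (d * (z / q))‖ < 1 := fun z hz => by
    rw [show q / (d * (z / q)) = q / (d * z) * q by field_simp]
    exact norm_mul_lt_one (t1 z hz) hq
  have t3 : ∀ z ∈ A, ‖q * (q * z) / d‖ < 1 := fun z hz => by
    have := hz.2
    rw [lt_div_iff₀ (by positivity)] at this
    rw [norm_div, norm_mul, norm_mul, div_lt_one hdp]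
    linarith
  have t3' : ∀ z ∈ A, ‖q / (d * (q * z)⁻¹)‖ < 1 := fun z hz => by
    rw [show q / (d * (q * z)⁻¹) = q * (q * z) / d by
      have := hA0 z hz
      field_simp]
    exact t3 z hz
  have hcst : ∀ x : ℂ, DifferentiableOn ℂ (fun _ : ℂ => x) A := fun x => differentiableOn_const x
  have dv : DifferentiableOn ℂ (fun z => z / q) A := differentiableOn_id.div_const q
  have di : DifferentiableOn ℂ (fun z => (q * z)⁻¹) A :=
    (differentiableOn_id.const_mul q).inv fun z hz => mul_ne_zero hq0 (hA0 z hz)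
  have D1 := differentiableOn_wpSum hq ha hb hc hAo hd (hcst u) (hcst v) differentiableOn_id hA0 t1
  have D2 := differentiableOn_wpSum hq ha hb hc hAo hd (hcst u) (hcst v) dv
    (fun z hz => div_ne_zero (hA0 z hz) hq0) t2
  have D3 := differentiableOn_wpSum hq ha hb hc hAo hd (hcst u) (hcst v) di
    (fun z hz => inv_ne_zero (mul_ne_zero hq0 (hA0 z hz))) t3'
  have D4 : DifferentiableOn ℂ (fun z => qPochInf (a * b * c / (q * z)) q) A :=
    ((hcst (a * b * c)).div (differentiableOn_id.const_mul q)
      fun z hz => mul_ne_zero hq0 (hA0 z hz)).qPochInf hq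
  have D5 : DifferentiableOn ℂ (fun z => qPochInf (a * b * c * z) q) A :=
    (differentiableOn_id.const_mul (a * b * c)).qPochInf hq
  have DA : DifferentiableOn ℂ (secondOrderOp q a b c d ((1 - u) * (1 - v * d / q))
      (fun z => wpSum q a b c d u v z) (fun z => wpSum q a b c d u v (z / q))
      (fun z => wpSum q a b c d u v (q * z)⁻¹) (fun z => qPochInf (a * b * c / (q * z)) q)
      (fun z => qPochInf (a * b * c * z) q)) A := fun z hz =>
    (differentiableAt_secondOrderOp hd (hA0 z hz) (D1.differentiableAt (hAo.mem_nhds hz))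
      (D2.differentiableAt (hAo.mem_nhds hz)) (D3.differentiableAt (hAo.mem_nhds hz))
      (D4.differentiableAt (hAo.mem_nhds hz))
      (D5.differentiableAt (hAo.mem_nhds hz))).differentiableWithinAt
  have key : ∀ z ∈ A, 1 / ‖d‖ < ‖z‖ → secondOrderOp q a b c d ((1 - u) * (1 - v * d / q))
      (fun z => wpSum q a b c d u v z) (fun z => wpSum q a b c d u v (z / q))
      (fun z => wpSum q a b c d u v (q * z)⁻¹) (fun z => qPochInf (a * b * c / (q * z)) q)
      (fun z => qPochInf (a * b * c * z) q) z = 0 := by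
    intro z hz hz1
    have hz0 := hA0 z hz
    have ht : ‖1 / (d * z)‖ < 1 := by
      rw [← div_div, norm_div, norm_div, norm_one, div_lt_one (norm_pos_iff.2 hz0)]
      exact hz1
    have E := wpSum_second_order hq0 hq ha hb hc hd hz0 hu huv ht
    have S := wpSum_symm hq0 hq ha hb hc hd (mul_ne_zero hq0 hz0)
      (by rwa [show q / (d * (q * z)) = 1 / (d * z) by field_simp]) (t3 z hz) hu huv
    have K := qPochInf_eq hq (a * b * c * z)
    rw [show a * b * c * (q * z) = a * b * c * z * q by ring] at S
    unfold secondOrderOp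
    beta_reduce
    rw [K]
    linear_combination qPochInf (a * b * c / (q * z)) q * E +
      1 / z * ((1 - a * z) * (1 - b * z) * (1 - c * z)) * (z - q / z) *
        (1 - a * b * c * z / q) * ((1 - q * z / d) * (1 - a * b * c * z)) * S
  set x : ℝ := max (1 / ‖d‖) (‖q / d‖) with hx
  have hxd : x < ‖d‖ / ‖q‖ ^ 2 := by
    rw [hx, max_lt_iff, norm_div]
    constructor
    · rw [div_lt_div_iff₀ hdp (by positivity)]; nlinarith
    · rw [div_lt_div_iff₀ hdp (by positivity)]
      have : ‖q‖ * ‖q‖ ^ 2 ≤ ‖q‖ ^ 2 := by nlinarith [sq_nonneg ‖q‖]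
      nlinarith
  -- A point of the annulus near which the direct argument applies; it exists because |q| < |d|.
  obtain ⟨y, hy1, hy2⟩ := exists_between hxd
  have hy0 : 0 < y := ((norm_nonneg _).trans (le_max_right _ _)).trans_lt hy1
  have hyn : ‖(y : ℂ)‖ = y := by rw [Complex.norm_real, Real.norm_of_nonneg hy0.le]
  have hyA : (y : ℂ) ∈ A := ⟨by rw [hyn]; exact (le_max_right _ _).trans_lt hy1, by rwa [hyn]⟩
  have hev : ∀ᶠ w in 𝓝 (y : ℂ), w ∈ A ∧ 1 / ‖d‖ < ‖w‖ :=
    Eventually.and (hAo.mem_nhds hyA)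
      (continuous_norm.continuousAt.eventually (lt_mem_nhds
        (by beta_reduce; rw [hyn]; exact (le_max_left _ _).trans_lt hy1)))
  exact (DA.analyticOnNhd hAo).eqOn_zero_of_preconnected_of_eventuallyEq_zero
    (isPreconnected_annulus (norm_pos_iff.2 (div_ne_zero hq0 hd)) _) hyA
    (hev.mono fun w hw => key w hw.1 hw.2) hz

/-- The second order equation on the unit circle. -/
lemma vSum_second_order (hq0 : q ≠ 0) (hq : ‖q‖ < 1) (ha : ‖a‖ < 1) (hb : ‖b‖ < 1)
    (hc : ‖c‖ < 1) (hd : d ≠ 0) (hqd : ‖q / d‖ < 1) (hu : u ≠ 0) (huv : u * v = a * b * c)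
    (hz : ‖z‖ = 1) :
    z * ((1 - a / z) * (1 - b / z) * (1 - c / z)) * (q * z - 1 / z) *
        ((1 - z / d) * vSum q a b c d u v z - (1 - q / (d * z)) * vSum q a b c d u v (z / q))
      - 1 / z * ((1 - a * z) * (1 - b * z) * (1 - c * z)) * (z - q / z) *
        ((1 - q * z / d) * vSum q a b c d u v (q * z)⁻¹ -
          (1 - 1 / (d * z)) * vSum q a b c d u v z)
      + 1 / d * ((1 - u) * (1 - v * d / q)) * (z - 1 / z) *
        (q * z - 1 / z) * (z - q / z) * vSum q a b c d u v z = 0 := by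
  have hqp : 0 < ‖q‖ := norm_pos_iff.2 hq0
  have hdp : 0 < ‖d‖ := norm_pos_iff.2 hd
  have hqd' : ‖q‖ < ‖d‖ := by rwa [norm_div, div_lt_one hdp] at hqd
  have hz0 : z ≠ 0 := norm_pos_iff.1 (by rw [hz]; exact one_pos)
  set A := {z : ℂ | (‖q / d‖ < ‖z‖ ∧ ‖z‖ < ‖d‖ / ‖q‖ ^ 2) ∧
    ‖a * b * c * z‖ < 1 ∧ ‖a * b * c / z‖ < 1} with hA
  have hk : ‖a * b * c‖ < 1 := norm_mul_lt_one (norm_mul_lt_one ha hb) hc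
  have hzA : ∀ᶠ w in 𝓝 z, w ∈ A := by
    refine Eventually.and (Eventually.and ?_ ?_) (Eventually.and ?_ ?_)
    · exact continuousAt_const.eventually_lt continuousAt_id.norm (by simpa [hz] using hqd)
    · refine continuousAt_id.norm.eventually_lt continuousAt_const ?_
      simp only [id, hz]
      rw [one_lt_div (by positivity)]
      nlinarith
    · exact (continuousAt_id.const_mul (a * b * c)).norm.eventually_lt continuousAt_const
        (by simpa [hz] using hk)
    · exact (continuousAt_const.div continuousAt_id hz0).norm.eventually_lt continuousAt_const
        (by simpa [hz] using hk)
  have t1 : ∀ z ∈ A, ‖q / (d * z)‖ < 1 := fun z hz => by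
    have := (norm_nonneg _).trans_lt hz.1.1
    rw [← div_div, norm_div, div_lt_one this]; exact hz.1.1
  have A0 : ∀ z ∈ A, z ≠ 0 := fun z hz => norm_pos_iff.1 ((norm_nonneg _).trans_lt hz.1.1)
  have t2 : ∀ z ∈ A, ‖q / (d * (z / q))‖ < 1 := fun z hz => by
    rw [show q / (d * (z / q)) = q / (d * z) * q by field_simp]
    exact norm_mul_lt_one (t1 z hz) hq
  have t3 : ∀ z ∈ A, ‖q / (d * (q * z)⁻¹)‖ < 1 := fun z hz => by
    have h0 := A0 z hz
    have := hz.1.2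
    rw [lt_div_iff₀ (by positivity)] at this
    rw [show q / (d * (q * z)⁻¹) = q * (q * z) / d by field_simp, norm_div, norm_mul, norm_mul,
      div_lt_one hdp]
    linarith
  have p1 : ∀ z ∈ A, qPochInf (a * b * c * z * q) q ≠ 0 := fun z hz =>
    qPochInf_ne_zero_of_norm_lt_one hq (norm_mul_lt_one hz.2.1 hq)
  have p2 : ∀ z ∈ A, qPochInf (a * b * c * (z / q) * q) q ≠ 0 := fun z hz => by
    rw [show a * b * c * (z / q) * q = a * b * c * z by field_simp]
    exact qPochInf_ne_zero_of_norm_lt_one hq hz.2.1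
  have p3 : ∀ z ∈ A, qPochInf (a * b * c * (q * z)⁻¹ * q) q ≠ 0 := fun z hz => by
    have h0 := A0 z hz
    rw [show a * b * c * (q * z)⁻¹ * q = a * b * c / z by field_simp]
    exact qPochInf_ne_zero_of_norm_lt_one hq hz.2.2
  have hzA' := hzA.self_of_nhds
  have C0 : ∀ x : ℂ, Tendsto (fun _ : ℂ => x) (𝓝[≠] z) (𝓝 x) := fun x => tendsto_const_nhds
  have ty : Tendsto (fun y : ℂ => y) (𝓝[≠] z) (𝓝 z) := nhdsWithin_le_nhds
  have T1 := tendsto_vSum hq ha hb hc (C0 d) (C0 u) (C0 v) ty hd hz0 (t1 z hzA') (p1 z hzA')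
  have T2 := tendsto_vSum hq ha hb hc (C0 d) (C0 u) (C0 v) (ty.div_const q) hd
    (div_ne_zero hz0 hq0) (t2 z hzA') (p2 z hzA')
  have T3 := tendsto_vSum hq ha hb hc (C0 d) (C0 u) (C0 v)
    ((ty.const_mul q).inv₀ (mul_ne_zero hq0 hz0)) hd
    (inv_ne_zero (mul_ne_zero hq0 hz0)) (t3 z hzA') (p3 z hzA')
  have R : ∀ x : ℂ, Tendsto (fun y : ℂ => x / y) (𝓝[≠] z) (𝓝 (x / z)) := fun x =>
    (C0 x).div ty hz0
  have Rd : ∀ x : ℂ, Tendsto (fun y : ℂ => x / (d * y)) (𝓝[≠] z) (𝓝 (x / (d * z))) := fun x =>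
    (C0 x).div (ty.const_mul d) (mul_ne_zero hd hz0)
  have S : ∀ {f : ℂ → ℂ} {f₀ : ℂ}, Tendsto f (𝓝[≠] z) (𝓝 f₀) →
      Tendsto (fun y => 1 - f y) (𝓝[≠] z) (𝓝 (1 - f₀)) := fun hf => hf.const_sub 1
  have T := (((ty.mul (((S (R a)).mul (S (R b))).mul (S (R c)))).mul
      ((ty.const_mul q).sub (R 1))).mul
        (((S (ty.div_const d)).mul T1).sub ((S (Rd q)).mul T2))).sub
    ((((R 1).mul (((S (ty.const_mul a)).mul (S (ty.const_mul b))).mul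
      (S (ty.const_mul c)))).mul (ty.sub (R q))).mul
        (((S ((ty.const_mul q).div_const d)).mul T3).sub ((S (Rd 1)).mul T1))) |>.add
    (((((C0 (1 / d * ((1 - u) * (1 - v * d / q)))).mul (ty.sub (R 1))).mul
      ((ty.const_mul q).sub (R 1))).mul (ty.sub (R q))).mul T1)
  refine tendsto_nhds_unique_of_eventuallyEq T (C0 0) ?_
  -- The equation is divided by (abcw/q; q)_∞ and (abc/(qw); q)_∞, which may vanish on the unit
  -- circle. Their zeros are isolated, so the result extends by continuity.
  filter_upwards [nhdsWithin_le_nhds hzA, eventually_qPochInf_mul_ne_zero hq (a * b * c / q) z,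
    eventually_qPochInf_div_ne_zero hq (a * b * c / q) hz0] with w hw g1 g2
  have hw0 := A0 w hw
  have E := secondOrderOp_eq_zero hq0 hq ha hb hc hd hqd hu huv hw.1
  unfold secondOrderOp at E
  beta_reduce at E
  rw [wpSum_eq_vSum hq0 hq ha hb hc hd hw0 (t1 w hw) huv (p1 w hw),
    wpSum_eq_vSum hq0 hq ha hb hc hd (div_ne_zero hw0 hq0) (t2 w hw) huv (p2 w hw),
    wpSum_eq_vSum hq0 hq ha hb hc hd (inv_ne_zero (mul_ne_zero hq0 hw0)) (t3 w hw) huv (p3 w hw),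
    show a * b * c * (q * w)⁻¹ = a * b * c / q / w by field_simp,
    show a * b * c / (q * w) = a * b * c / q / w by field_simp,
    show a * b * c * (w / q) = a * b * c / q * w by ring] at E
  have K := qPochInf_eq hq (a * b * c / q * w)
  rw [show a * b * c / q * w * q = a * b * c * w by field_simp] at K
  refine mul_left_cancel₀ (mul_ne_zero g1 g2) ?_
  rw [mul_zero, ← E, K]
  ring

end BoundaryEquation

/-! ### Identification with the given ₈φ₇ expression -/

section Expression

variable {q a b c d ν y A r : ℂ}

lemma qPoch_mul_qPoch_neg (x q : ℂ) (n : ℕ) :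
    qPoch x q n * qPoch (-x) q n = ∏ k ∈ Finset.range n, (1 - x * x * q ^ (2 * k)) := by
  rw [qPoch, qPoch, ← Finset.prod_mul_distrib]
  exact Finset.prod_congr rfl fun k _ => by ring

/-- The symbols at ±√A and ±q√A combine to ∏(1 - Aq^{2k+2})/(1 - Aq^{2k}), which telescopes; the
factor 1 - A then cancels against (A; q)_n. -/
lemma wpWeight_eq_div (hr : r * r = A) (hA : ∀ k : ℕ, A * q ^ k ≠ 1) (n : ℕ) :
    qPoch A q n * (qPoch (q * r) q n * qPoch (-(q * r)) q n) / (qPoch r q n * qPoch (-r) q n) =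
      wpWeight q n A := by
  have h0 : ∀ k : ℕ, 1 - A * q ^ k ≠ 0 := fun k => sub_ne_zero.2 (hA k).symm
  have hA1 : 1 - A ≠ 0 := by simpa using h0 0
  rw [qPoch_mul_qPoch_neg, qPoch_mul_qPoch_neg, hr]
  have h1 : (∏ k ∈ Finset.range n, (1 - q * r * (q * r) * q ^ (2 * k))) * (1 - A) =
      (∏ k ∈ Finset.range n, (1 - A * q ^ (2 * k))) * (1 - A * q ^ (2 * n)) := by
    rw [← Finset.prod_range_succ, Finset.prod_range_succ']
    simp only [mul_zero, pow_zero, mul_one]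
    congr 1
    refine Finset.prod_congr rfl fun k _ => ?_
    rw [← hr]; ring
  have h2 : ∏ k ∈ Finset.range n, (1 - A * q ^ (2 * k)) ≠ 0 :=
    Finset.prod_ne_zero_iff.2 fun k _ => h0 _
  rw [div_eq_iff h2]
  apply mul_right_cancel₀ hA1
  rw [mul_assoc, h1]
  rcases n with _ | n
  · simp [wpWeight, qPoch_zero]
  · rw [qPoch_succ', wpWeight]
    ring

/-- The infinite products in front absorb the y-dependent denominators through (x; q)_∞ = (x; q)_n
(x q^n; q)_∞. The hypotheses exclude exactly those y for which the cancelled factors vanish; `vFun`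
sees the others only as punctured limits. -/
lemma vExpr_eq_wpSum_div (hq0 : q ≠ 0) (hq : ‖q‖ < 1)
    (h1 : qPochInf (a * b * c * q ^ ν * y) q ≠ 0) (h2 : qPochInf (q ^ (-ν) * q / d * y) q ≠ 0)
    (h3 : qPochInf (a * b * c / q * y) q ≠ 0) :
    vExpr q a b c d ν y = wpSum q a b c d (q ^ (-ν)) (a * b * c * q ^ ν) y /
      qPochInf (a * b * c * y) q := by
  set A := a * b * c * y / q with hA
  have hA' : a * b * c / q * y = A := by rw [hA]; ring
  have hr : A ^ (1 / 2 : ℂ) * A ^ (1 / 2 : ℂ) = A := by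
    by_cases h : A = 0
    · simp [h]
    · rw [← Complex.cpow_add _ _ h]; norm_num
  rw [hA'] at h3
  have hA1 := (qPochInf_ne_zero_iff hq A).1 h3
  have e1 : q ^ (1 - ν) * y / d = q ^ (-ν) * q / d * y := by
    rw [sub_eq_neg_add, Complex.cpow_add _ _ hq0, Complex.cpow_one]; ring
  have e2 : a * b * c * y * q ^ ν = a * b * c * q ^ ν * y := by ring
  have e3 : a * b * c * d * q ^ (ν - 1) = a * b * c * q ^ ν * d / q := by
    rw [Complex.cpow_sub _ _ hq0, Complex.cpow_one]; ring
  unfold vExpr wpSum basicHyp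
  rw [← hA, e1, e2, e3]
  rw [div_mul_eq_mul_div, mul_assoc, mul_assoc, ← tsum_mul_left, ← tsum_mul_left]
  congr 2
  refine tsum_congr fun n => ?_
  simp only [List.map_cons, List.map_nil, List.prod_cons, List.prod_nil, List.length_cons,
    List.length_nil]
  rw [← wpWeight_eq_div hr hA1 n, wpTerm, qPochInf_eq_qPoch_mul hq (a * b * c * q ^ ν * y) n,
    qPochInf_eq_qPoch_mul hq (q ^ (-ν) * q / d * y) n,
    show q ^ (-ν) * q / d * y * q ^ n = q ^ (-ν) * y / d * q ^ (n + 1) by rw [pow_succ]; ring]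
  have n1 := qPoch_ne_zero_of_qPochInf_ne_zero hq h1 n
  have n2 := qPoch_ne_zero_of_qPochInf_ne_zero hq h2 n
  generalize qPochInf (a * b * c * q ^ ν * y * q ^ n) q = X1
  generalize qPochInf (q ^ (-ν) * y / d * q ^ (n + 1)) q = X2
  generalize qPochInf (q / (d * y)) q = X3
  generalize (q / (d * y)) ^ n = X4
  generalize qPoch (a * b * c * q ^ ν * y) q n = Y1 at *
  generalize qPoch (q ^ (-ν) * q / d * y) q n = Y2 at *
  generalize qPoch (A ^ (1 / 2 : ℂ)) q n = Y3
  generalize qPoch (-A ^ (1 / 2 : ℂ)) q n = Y4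
  generalize qPoch (q * A ^ (1 / 2 : ℂ)) q n = Y5
  generalize qPoch (-(q * A ^ (1 / 2 : ℂ))) q n = Y6
  generalize qPoch A q n = Y7
  generalize qPoch q q n = Y8
  generalize qPoch (q ^ (-ν)) q n = Y9
  generalize qPoch (a * b * c * q ^ ν * d / q) q n = Y10
  -- With eight numerator and seven further denominator parameters, the exponent of the sign and of
  -- the power of q is zero.
  have e : (1 + ((0 + 1 + 1 + 1 + 1 + 1 + 1 + 1 : ℕ) : ℤ) -
    ((0 + 1 + 1 + 1 + 1 + 1 + 1 + 1 + 1 : ℕ) : ℤ)) = 0 := by norm_num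
  rw [e, zpow_zero]
  generalize qPoch (a * y) q n = Y11
  generalize qPoch (b * y) q n = Y12
  generalize qPoch (c * y) q n = Y13
  generalize qPoch (b * c) q n = Y14
  generalize qPoch (a * c) q n = Y15
  generalize qPoch (a * b) q n = Y16
  have m1 := mul_inv_cancel₀ n1
  have m2 := mul_inv_cancel₀ n2
  linear_combination (Y7 * (Y5 * Y6) / (Y3 * Y4) * (Y9 * Y10 * Y11 * Y12 * Y13 /
    (Y8 * Y16 * Y15 * Y14) * X4 * (X1 * X2))) * (Y2 * Y2⁻¹ * m1 + m2)

/-- `v_ν` as the value of `vSum`. -/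
lemma vFun_eq_vSum (hq0 : q ≠ 0) (hq : ‖q‖ < 1) (ha : ‖a‖ < 1) (hb : ‖b‖ < 1)
    (hc : ‖c‖ < 1) (hd : d ≠ 0) (hy : y ≠ 0) (ht : ‖q / (d * y)‖ < 1)
    (h : qPochInf (a * b * c * y * q) q ≠ 0) :
    vFun q a b c d ν y = vSum q a b c d (q ^ (-ν)) (a * b * c * q ^ ν) y := by
  have ty : Tendsto (fun y : ℂ => y) (𝓝[≠] y) (𝓝 y) := nhdsWithin_le_nhds
  have T := tendsto_vSum hq ha hb hc (tendsto_const_nhds (x := d))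
    (tendsto_const_nhds (x := q ^ (-ν))) (tendsto_const_nhds (x := a * b * c * q ^ ν)) ty hd hy ht h
  refine (T.congr' ?_).limUnder_eq
  have o1 : ContinuousAt (fun y => ‖q / (d * y)‖) y :=
    (continuousAt_const.div (continuousAt_id.const_mul d) (mul_ne_zero hd hy)).norm
  filter_upwards [eventually_qPochInf_mul_ne_zero hq (a * b * c * q ^ ν) y,
    eventually_qPochInf_mul_ne_zero hq (q ^ (-ν) * q / d) y,
    eventually_qPochInf_mul_ne_zero hq (a * b * c / q) y,
    nhdsWithin_le_nhds (o1.eventually_lt_const ht),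
    nhdsWithin_le_nhds (continuousAt_id.eventually_ne hy)] with w h1 h2 h3 h4 h5
  have hw : w ≠ 0 := h5
  have h6 := h3
  rw [qPochInf_eq hq, show a * b * c / q * w * q = a * b * c * w by field_simp] at h6
  have h7 := right_ne_zero_of_mul h6
  have h8 := h7
  rw [qPochInf_eq hq] at h8
  have huv : q ^ (-ν) * (a * b * c * q ^ ν) = a * b * c := by
    rw [Complex.cpow_neg]
    have : q ^ ν ≠ 0 := by simp [Complex.cpow_eq_zero_iff, hq0]
    field_simp
  rw [vExpr_eq_wpSum_div hq0 hq h1 h2 h3,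
    wpSum_eq_vSum hq0 hq ha hb hc hd hw h4 huv (right_ne_zero_of_mul h8), mul_div_cancel_right₀ _ h7]

end Expression

open ComplexConjugate

/-! ### Reality of v_ν on the unit circle -/

section Conj

variable {q a b c d u v y z : ℂ}

lemma conj_qPoch (x q : ℂ) (n : ℕ) : conj (qPoch x q n) = qPoch (conj x) (conj q) n := by
  simp [qPoch, map_prod]

lemma conj_qPochInf (hq : ‖q‖ < 1) (x : ℂ) : conj (qPochInf x q) = qPochInf (conj x) (conj q) := by
  refine tendsto_nhds_unique ((Complex.continuous_conj.tendsto _).comp (tendsto_qPoch hq x)) ?_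
  refine (tendsto_qPoch (q := conj q) (by rwa [RCLike.norm_conj]) (conj x)).congr fun n => ?_
  rw [Function.comp, conj_qPoch]

lemma conj_wpTerm (hq : ‖q‖ < 1) (n : ℕ) : conj (wpTerm q a b c d u v y n) =
    wpTerm (conj q) (conj a) (conj b) (conj c) (conj d) (conj u) (conj v) (conj y) n := by
  simp only [wpTerm, map_mul, map_div₀, map_pow, conj_qPoch, conj_qPochInf hq]

lemma conj_regWeight (n : ℕ) (A : ℂ) : conj (regWeight q n A) = regWeight (conj q) n (conj A) := by
  rcases n with _ | _ | n <;> simp [regWeight, conj_qPoch]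

lemma conj_vSum (hq : ‖q‖ < 1) : conj (vSum q a b c d u v y) =
    vSum (conj q) (conj a) (conj b) (conj c) (conj d) (conj u) (conj v) (conj y) := by
  simp only [vSum, regSum, regHead, map_mul, map_div₀, map_pow, map_add, map_sub, map_neg, map_one,
    conj_qPochInf hq, Complex.conj_tsum, conj_wpTerm hq, conj_regWeight]

lemma vSum_comm_left : vSum q b a c d u v y = vSum q a b c d u v y := by
  have h : ∀ n, wpTerm q b a c d u v y n = wpTerm q a b c d u v y n := fun n => by
    unfold wpTerm; rw [mul_comm b a]; ring
  simp only [vSum, regSum, regHead, h, mul_comm b a]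
  ring_nf

lemma vSum_comm_right : vSum q a c b d u v y = vSum q a b c d u v y := by
  have h : ∀ n, wpTerm q a c b d u v y n = wpTerm q a b c d u v y n := fun n => by
    unfold wpTerm; rw [mul_comm c b]; ring
  simp only [vSum, regSum, regHead, h, mul_comm c b, mul_right_comm a c b]
  ring_nf

/-- Conjugation replaces z by 1/z, which the symmetry undoes, and permutes a, b, c, in which the
function is symmetric; q, d, u and v are fixed. -/
lemma conj_vSum_of_norm_eq_one {q d u v : ℝ} (hq0 : 0 < q) (hq1 : q < 1)
    (habc : (a.im = 0 ∧ b.im = 0 ∧ c.im = 0) ∨ (b = conj a ∧ c.im = 0) ∨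
      (c = conj a ∧ b.im = 0) ∨ (c = conj b ∧ a.im = 0))
    (ha : ‖a‖ < 1) (hb : ‖b‖ < 1) (hc : ‖c‖ < 1) (hd0 : d ≠ 0) (hd : ‖(q : ℂ) / d‖ < 1)
    (hu : u ≠ 0) (huv : (u : ℂ) * v = a * b * c) (hz : ‖z‖ = 1) :
    conj (vSum q a b c d u v z) = vSum q a b c d u v z := by
  have hqn : ‖(q : ℂ)‖ < 1 := by rwa [Complex.norm_real, Real.norm_of_nonneg hq0.le]
  have hz0 : z ≠ 0 := norm_pos_iff.1 (by rw [hz]; exact one_pos)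
  have hk : ‖a * b * c‖ < 1 := norm_mul_lt_one (norm_mul_lt_one ha hb) hc
  have hp : ∀ x : ℂ, ‖x‖ = 1 → qPochInf (a * b * c * x * q) q ≠ 0 := fun x hx =>
    qPochInf_ne_zero_of_norm_lt_one hqn (norm_mul_lt_one (by rwa [norm_mul, hx, mul_one]) hqn)
  have S := vSum_symm (Complex.ofReal_ne_zero.2 hq0.ne') hqn ha hb hc (Complex.ofReal_ne_zero.2 hd0)
    hz0 (by rwa [← div_div, norm_div, hz, div_one])
    (by rwa [mul_div_right_comm, norm_mul, hz, mul_one])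
    (Complex.ofReal_ne_zero.2 hu) huv (hp z hz) (hp z⁻¹ (by rw [norm_inv, hz, inv_one]))
  rw [conj_vSum hqn, ← Complex.inv_eq_conj hz]
  simp only [Complex.conj_ofReal]
  rw [← S]
  rcases habc with ⟨h1, h2, h3⟩ | ⟨rfl, h2⟩ | ⟨rfl, h2⟩ | ⟨rfl, h2⟩
  · rw [Complex.conj_eq_iff_im.2 h1, Complex.conj_eq_iff_im.2 h2, Complex.conj_eq_iff_im.2 h3]
  · rw [Complex.conj_eq_iff_im.2 h2, Complex.conj_conj, vSum_comm_left]
  · rw [Complex.conj_eq_iff_im.2 h2, Complex.conj_conj, vSum_comm_left, vSum_comm_right,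
      vSum_comm_left]
  · rw [Complex.conj_eq_iff_im.2 h2, Complex.conj_conj, vSum_comm_right]

end Conj

/-! ### Nonvanishing of terminating series, and an Abelian theorem -/

section Nonvanishing

variable {q a b c d u v y z : ℂ}

/-- If a terminating series vanishes for all large `y`, it is not of the form considered here. -/
lemma not_wpSum_eq_zero_of_terminating (hq0 : q ≠ 0) (hq : ‖q‖ < 1) (n : ℕ) :
    ∀ {a b c d u v : ℂ}, ‖a‖ < 1 → ‖b‖ < 1 → ‖c‖ < 1 → d ≠ 0 → u * q ^ n = 1 →
    u * v = a * b * c → ¬ ∃ R : ℝ, ∀ y : ℂ, R < ‖y‖ → wpSum q a b c d u v y = 0 := by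
  obtain ⟨s, hs⟩ : ∃ s : ℂ, s * s = q := ⟨q ^ (1 / 2 : ℂ), by
    rw [← Complex.cpow_add _ _ hq0]; norm_num⟩
  have hs0 : s ≠ 0 := by rintro rfl; simp at hs; exact hq0 hs.symm
  have hs1 := norm_lt_one_of_sq hs hq
  -- For u = 1 the sum is an explicit product of three infinite products with isolated zeros.
  have base : ∀ {a b c d v : ℂ}, d ≠ 0 →
      ¬ ∃ R : ℝ, ∀ y : ℂ, R < ‖y‖ → wpSum q a b c d 1 v y = 0 := by
    rintro a b c d v hd ⟨R, hR⟩
    have hRp : 0 < |R| + 1 := by positivity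
    have hy0 : ((|R| + 1 : ℝ) : ℂ) ≠ 0 := Complex.ofReal_ne_zero.2 hRp.ne'
    have h1 : ∀ᶠ y in 𝓝[≠] ((|R| + 1 : ℝ) : ℂ), R < ‖y‖ := by
      refine nhdsWithin_le_nhds (continuous_norm.continuousAt.eventually (lt_mem_nhds ?_))
      beta_reduce
      rw [Complex.norm_real, Real.norm_of_nonneg hRp.le]
      linarith [le_abs_self R]
    obtain ⟨y, hy, g1, g2, g3⟩ := (h1.and ((eventually_qPochInf_mul_ne_zero hq v _).and
      ((eventually_qPochInf_mul_ne_zero hq (q / d) _).and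
        (eventually_qPochInf_div_ne_zero hq (q / d) hy0)))).exists
    have h := hR y hy
    rw [wpSum_one, ← div_div, show y / d * q = q / d * y by ring] at h
    exact mul_ne_zero g3 (mul_ne_zero g1 g2) h
  induction n with
  | zero =>
    intro a b c d u v ha hb hc hd hu huv
    rw [pow_zero, mul_one] at hu
    subst hu
    exact base hd
  | succ n ih =>
    rintro a b c d u v ha hb hc hd hu huv ⟨R, hR⟩
    have hu0 : u ≠ 0 := by rintro rfl; simp at hu
    by_cases h1 : u = 1
    · subst h1
      exact base hd ⟨R, hR⟩
    -- Here the lowering coefficient vanishes, but after exchanging u and vd/q the series has a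
    -- single term.
    by_cases h2 : v * d / q = 1
    · refine base (a := a) (b := b) (c := c) (v := u * q / d) hd ⟨R, fun y hy => ?_⟩
      have := hR y hy
      rwa [← wpSum_swap hq0 hd, h2] at this
    refine ih (a := s * a) (b := s * b) (c := s * c) (d := s * d) (u := u * q) (v := v * s)
      (norm_mul_lt_one hs1 ha) (norm_mul_lt_one hs1 hb) (norm_mul_lt_one hs1 hc)
      (mul_ne_zero hs0 hd) (by rw [← hu]; ring)
      (by rw [← hs]; linear_combination s * s * s * huv) ?_
    have hqp : 0 < ‖q‖ := norm_pos_iff.2 hq0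
    have hdp : 0 < ‖d‖ := norm_pos_iff.2 hd
    have hsp : 0 < ‖s‖ := norm_pos_iff.2 hs0
    have hk : ‖a * b * c‖ < 1 := norm_mul_lt_one (norm_mul_lt_one ha hb) hc
    -- For y = sw this bound ensures |qw| > R, convergence at qw, and that none of qw - 1/w, 1 -
    -- abcw and 1 - abcwq vanishes. Lowering then carries the vanishing to the shifted series.
    refine ⟨‖s‖ * ((|R| + 1 + 1 / ‖a * b * c‖) / ‖q‖ + 1 / ‖d‖ + 1 / ‖q‖ +
      1 / (‖a * b * c‖ * ‖q‖)), fun y hy => ?_⟩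
    obtain ⟨w, rfl⟩ : ∃ w, y = s * w := ⟨y / s, by field_simp⟩
    rw [norm_mul s w] at hy
    have hw := lt_of_mul_lt_mul_left hy hsp.le
    have p1 : 0 ≤ 1 / ‖a * b * c‖ := by positivity
    have p2 : 0 ≤ 1 / ‖d‖ := by positivity
    have p3 : 0 ≤ 1 / ‖q‖ := by positivity
    have p4 : 0 ≤ 1 / (‖a * b * c‖ * ‖q‖) := by positivity
    have p5 : |R| + 1 + 1 / ‖a * b * c‖ ≤ (|R| + 1 + 1 / ‖a * b * c‖) / ‖q‖ :=
      le_div_self (by positivity) hqp hq.le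
    have p6 := abs_nonneg R
    have hw1 : 1 < ‖w‖ := by linarith
    have hw0 : w ≠ 0 := norm_pos_iff.1 (by linarith)
    have hwR : R < ‖w‖ := by linarith [le_abs_self R]
    have hqw : (|R| + 1 + 1 / ‖a * b * c‖) + 1 < ‖q * w‖ := by
      rw [norm_mul q w, mul_comm ‖q‖]
      have : (|R| + 1 + 1 / ‖a * b * c‖) / ‖q‖ + 1 / ‖q‖ < ‖w‖ := by linarith
      rw [← add_div, div_lt_iff₀ hqp] at this
      exact this
    have hdw : ‖1 / (d * w)‖ < 1 := by
      rw [← div_div, norm_div, norm_div, norm_one, div_lt_one (by linarith)]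
      linarith
    have L := wpSum_lower hs hq0 hq ha hb hc hd hw0 hu0 huv hdw
    rw [hR w hwR, hR (q * w) (by linarith [le_abs_self R])] at L
    have hab := one_sub_ne_zero_of_norm_lt_one (norm_mul_lt_one ha hb)
    have hac := one_sub_ne_zero_of_norm_lt_one (norm_mul_lt_one ha hc)
    have hbc := one_sub_ne_zero_of_norm_lt_one (norm_mul_lt_one hb hc)
    have n1 : q * w - 1 / w ≠ 0 := by
      intro h
      have h3 : ‖q * w‖ = ‖1 / w‖ := by rw [sub_eq_zero.1 h]
      have h4 : ‖1 / w‖ < 1 := by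
        rw [norm_div, norm_one, div_lt_one (by linarith)]; exact hw1
      linarith
    have n2 : ∀ x : ℂ, 1 / ‖a * b * c‖ < ‖x‖ → 1 - a * b * c * x ≠ 0 := fun x hx h => by
      have h3 : ‖a * b * c‖ * ‖x‖ = 1 := by
        rw [← norm_mul, ← sub_eq_zero.1 h, norm_one]
      have h4 : 0 < ‖a * b * c‖ := by
        by_contra h5
        rw [le_antisymm (not_lt.1 h5) (norm_nonneg _)] at h3
        simp at h3
      rw [div_lt_iff₀ h4] at hx
      linarith
    have n3 : 1 - a * b * c * w * q ≠ 0 := by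
      rw [show a * b * c * w * q = a * b * c * (q * w) by ring]
      exact n2 _ (by linarith)
    simp only [mul_zero, sub_zero, zero_add] at L
    refine (mul_eq_zero.1 L).resolve_left ?_
    exact mul_ne_zero (mul_ne_zero (div_ne_zero (mul_ne_zero (one_div_ne_zero hd) (mul_ne_zero
      (sub_ne_zero.2 (Ne.symm h1)) (sub_ne_zero.2 (Ne.symm h2))))
      (mul_ne_zero (mul_ne_zero hab hac) hbc)) n1) (mul_ne_zero (n2 w (by linarith)) n3)

/-- An Abelian theorem with a parameter. -/
lemma eq_zero_of_abel {β : ℕ → ℝ → ℂ} {L : ℂ}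
    (hβ : Tendsto (fun p : ℕ × ℝ => β p.1 p.2) (atTop ×ˢ 𝓝[<] 1) (𝓝 L)) {B : ℝ}
    (hB : ∀ᶠ t : ℝ in 𝓝[<] 1, ∀ n, ‖β n t‖ ≤ B)
    (h0 : ∀ᶠ t : ℝ in 𝓝[<] 1, ∑' n, β n t * (t : ℂ) ^ n = 0) : L = 0 := by
  by_contra hL
  have hLp : 0 < ‖L‖ := norm_pos_iff.2 hL
  have h1 := hβ.eventually (Metric.ball_mem_nhds L (half_pos hLp))
  obtain ⟨P, hP, Q, hQ, hPQ⟩ := eventually_prod_iff.1 h1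
  obtain ⟨N, hN⟩ := eventually_atTop.1 hP
  have h2 : ∀ᶠ t : ℝ in 𝓝[<] 1, ‖L‖ / 2 ≤ (1 - t) * (N * (‖L‖ + B)) := by
    have hpos : ∀ᶠ t : ℝ in 𝓝[<] 1, 0 < t :=
      nhdsWithin_le_nhds (lt_mem_nhds one_pos)
    filter_upwards [hQ, hB, h0, self_mem_nhdsWithin, hpos] with t hQt hBt h0t ht ht0
    have ht1 : t < 1 := ht
    have htn : ‖(t : ℂ)‖ = t := by rw [Complex.norm_real, Real.norm_of_nonneg ht0.le]
    have htn1 : ‖(t : ℂ)‖ < 1 := by rwa [htn]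
    have hB0 : 0 ≤ B := (norm_nonneg _).trans (hBt 0)
    have sg := summable_geometric_of_lt_one ht0.le ht1
    have S1 : Summable fun n => β n t * (t : ℂ) ^ n :=
      Summable.of_norm_bounded (sg.mul_left B) fun n => by
        rw [norm_mul, norm_pow, htn]
        exact mul_le_mul_of_nonneg_right (hBt n) (by positivity)
    have S2 : HasSum (fun n => L * (t : ℂ) ^ n) (L * (1 - (t : ℂ))⁻¹) :=
      (hasSum_geometric_of_norm_lt_one htn1).mul_left L
    have S3 := S2.sub S1.hasSum
    rw [h0t, sub_zero] at S3
    -- The majorant of Σ (L - β_n(t)) t^n: terms with n ≥ N are close to their limit, and the first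
    -- N contribute a constant. Multiplication by 1 - t removes the constant as t → 1.
    have S4 : HasSum (fun n => ‖L‖ / 2 * t ^ n + if n < N then (‖L‖ + B) else 0)
        (‖L‖ / 2 * (1 - t)⁻¹ + N * (‖L‖ + B)) := by
      refine ((hasSum_geometric_of_lt_one ht0.le ht1).mul_left _).add ?_
      have : HasSum (fun n => if n < N then (‖L‖ + B) else 0)
          (∑ n ∈ Finset.range N, if n < N then (‖L‖ + B) else 0) :=
        hasSum_sum_of_ne_finset_zero fun n hn => if_neg (by simpa using hn)
      rwa [Finset.sum_ite_of_true (fun n hn => by simpa using hn), Finset.sum_const,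
        Finset.card_range, nsmul_eq_mul] at this
    have S5 := S3.norm_le_of_bounded S4 fun n => by
      rw [← sub_mul, norm_mul, norm_pow, htn]
      by_cases hn : n < N
      · rw [if_pos hn]
        have h3 : ‖L - β n t‖ ≤ ‖L‖ + B := (norm_sub_le _ _).trans (by linarith [hBt n])
        have h4 : t ^ n ≤ 1 := pow_le_one₀ ht0.le ht1.le
        have h5 : 0 ≤ ‖L‖ / 2 * t ^ n := by positivity
        nlinarith [norm_nonneg (L - β n t)]
      · rw [if_neg hn, add_zero]
        have h3 : dist (β n t) L < ‖L‖ / 2 := hPQ (hN n (not_lt.1 hn)) hQt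
        rw [dist_comm, dist_eq_norm] at h3
        exact mul_le_mul_of_nonneg_right h3.le (by positivity)
    have h6 : ‖L * (1 - (t : ℂ))⁻¹‖ = ‖L‖ * (1 - t)⁻¹ := by
      rw [norm_mul, norm_inv, ← Complex.ofReal_one, ← Complex.ofReal_sub, Complex.norm_real,
        Real.norm_of_nonneg (by linarith)]
    rw [h6] at S5
    have h7 : 0 < 1 - t := by linarith
    have h8 : ‖L‖ / 2 * (1 - t)⁻¹ ≤ N * (‖L‖ + B) := by linarith
    rw [← div_eq_mul_inv, div_le_iff₀ h7] at h8
    linarith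
  have h3 : Tendsto (fun t : ℝ => (1 - t) * (N * (‖L‖ + B))) (𝓝[<] 1) (𝓝 0) := by
    have : Continuous fun t : ℝ => (1 - t) * (N * (‖L‖ + B)) := by fun_prop
    have h4 := this.tendsto 1
    rw [sub_self, zero_mul] at h4
    exact h4.mono_left nhdsWithin_le_nhds
  have := ge_of_tendsto h3 h2
  linarith

end Nonvanishing

/-! ### v_ν does not vanish identically on the unit circle -/

section Nonvanishing

variable {q a b c d u v y z : ℂ}

/-- Base and length move together; writing (x; q)_N as (x; q)_∞/(x q^N; q)_∞ reduces the claim to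
continuity of the infinite product. -/
lemma tendsto_qPoch_comp {X : Type*} {l : Filter X} (hq : ‖q‖ < 1) {f : X → ℂ} {N : X → ℕ} {x : ℂ}
    (hf : Tendsto f l (𝓝 x)) (hN : Tendsto N l atTop) :
    Tendsto (fun p => qPoch (f p) q (N p)) l (𝓝 (qPochInf x q)) := by
  have PI : ∀ {f : X → ℂ} {x : ℂ}, Tendsto f l (𝓝 x) →
      Tendsto (fun p => qPochInf (f p) q) l (𝓝 (qPochInf x q)) := fun hf =>
    ((continuous_qPochInf hq).tendsto _).comp hf
  have h1 : Tendsto (fun p => qPochInf (f p * q ^ N p) q) l (𝓝 1) := by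
    have := PI (hf.mul ((tendsto_pow_atTop_nhds_zero_of_norm_lt_one hq).comp hN))
    rwa [mul_zero, qPochInf_zero] at this
  have h2 := (PI hf).div h1 one_ne_zero
  rw [div_one] at h2
  refine h2.congr' ?_
  filter_upwards [h1.eventually_ne one_ne_zero] with p hp
  rw [Pi.div_apply, qPochInf_eq_qPoch_mul hq (f p) (N p), mul_div_cancel_right₀ _ hp]

/-- As y approaches q/d, the argument t = q/(dy) of the series tends to 1, and the coefficients of
t^n tend to a product of infinite factorials. By Abel's theorem this product is zero, and since
|q/d| < 1 only (u; q)_∞ and (vd/q; q)_∞ can be responsible. -/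
lemma terminating_of_wpSum_eq_zero (hq0 : q ≠ 0) (hq : ‖q‖ < 1) (ha : ‖a‖ < 1) (hb : ‖b‖ < 1)
    (hc : ‖c‖ < 1) (hd : d ≠ 0) (hqd : ‖q / d‖ < 1)
    (h0 : ∀ y : ℂ, ‖q / d‖ < ‖y‖ → wpSum q a b c d u v y = 0) :
    qPochInf u q = 0 ∨ qPochInf (v * d / q) q = 0 := by
  set k := a * b * c with hk
  set Y : ℝ → ℂ := fun t => q / (d * t) with hY
  set l : Filter (ℕ × ℝ) := atTop ×ˢ 𝓝[<] 1 with hl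
  set C : ℂ := qPochInf q q * qPochInf (a * b) q * qPochInf (a * c) q * qPochInf (b * c) q with hC
  have hC0 : C ≠ 0 := by
    refine mul_ne_zero (mul_ne_zero (mul_ne_zero ?_ ?_) ?_) ?_
    exacts [qPochInf_ne_zero_of_norm_lt_one hq hq,
      qPochInf_ne_zero_of_norm_lt_one hq (norm_mul_lt_one ha hb),
      qPochInf_ne_zero_of_norm_lt_one hq (norm_mul_lt_one ha hc),
      qPochInf_ne_zero_of_norm_lt_one hq (norm_mul_lt_one hb hc)]
  have hkn : ‖k‖ < 1 := norm_mul_lt_one (norm_mul_lt_one ha hb) hc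
  have hqd0 : q / d ≠ 0 := div_ne_zero hq0 hd
  have hof : Tendsto (fun t : ℝ => (t : ℂ)) (𝓝[<] 1) (𝓝 1) := by
    have := Complex.continuous_ofReal.tendsto 1
    rw [Complex.ofReal_one] at this
    exact this.mono_left nhdsWithin_le_nhds
  have hY1 : Tendsto Y (𝓝[<] 1) (𝓝 (q / d)) := by
    have := (tendsto_const_nhds (x := q)).div (hof.const_mul d) (by rwa [mul_one])
    rwa [mul_one] at this
  have hYl : Tendsto (fun p : ℕ × ℝ => Y p.2) l (𝓝 (q / d)) := hY1.comp tendsto_snd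
  have hNl : Tendsto (fun p : ℕ × ℝ => p.1) l atTop := tendsto_fst
  have hNl' : Tendsto (fun p : ℕ × ℝ => p.1 - 1) l atTop := (tendsto_sub_atTop_nat 1).comp hNl
  have pos : ∀ᶠ t : ℝ in 𝓝[<] 1, 0 < t ∧ t < 1 :=
    Eventually.and (nhdsWithin_le_nhds (lt_mem_nhds one_pos)) self_mem_nhdsWithin
  have tq : ∀ t : ℝ, t ≠ 0 → q / (d * Y t) = t := fun t ht => by
    have : (t : ℂ) ≠ 0 := Complex.ofReal_ne_zero.2 ht
    rw [hY]; field_simp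
  -- The terms still depend on t beyond the power t^n, whence the Abelian theorem with a parameter.
  set β : ℕ → ℝ → ℂ := fun n t => wpWeight q n (k * Y t / q) *
    wpTerm q a b c d u v (Y t) n / (t : ℂ) ^ n with hβ
  have lim : Tendsto (fun p : ℕ × ℝ => β p.1 p.2) l (𝓝 ((1 - 0) * qPochInf (k * (q / d)) q *
      (qPochInf u q * qPochInf (v * d / q) q * qPochInf (a * (q / d)) q *
        qPochInf (b * (q / d)) q * qPochInf (c * (q / d)) q / C * (1 * 1)))) := by
    have Q : ∀ x : ℂ, Tendsto (fun p : ℕ × ℝ => qPoch (x * Y p.2) q p.1) l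
        (𝓝 (qPochInf (x * (q / d)) q)) := fun x => tendsto_qPoch_comp hq (hYl.const_mul x) hNl
    have Q0 : ∀ x : ℂ, Tendsto (fun p : ℕ × ℝ => qPoch x q p.1) l (𝓝 (qPochInf x q)) := fun x =>
      tendsto_qPoch_comp hq tendsto_const_nhds hNl
    have hpow := (tendsto_pow_atTop_nhds_zero_of_norm_lt_one hq).comp hNl
    have PI1 : ∀ {f : ℕ × ℝ → ℂ}, Tendsto f l (𝓝 0) →
        Tendsto (fun p => qPochInf (f p) q) l (𝓝 1) := fun {f} hf => by
      have := ((continuous_qPochInf hq).tendsto 0).comp hf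
      rwa [qPochInf_zero] at this
    have W1 : Tendsto (fun p : ℕ × ℝ => k * Y p.2 / q * (q ^ p.1 * q ^ p.1)) l (𝓝 0) := by
      simpa using ((hYl.const_mul k).div_const q).mul (hpow.mul hpow)
    have P1 : Tendsto (fun p : ℕ × ℝ => qPochInf (v * Y p.2 * q ^ p.1) q) l (𝓝 1) :=
      PI1 (by simpa using (hYl.const_mul v).mul hpow)
    have P2 : Tendsto (fun p : ℕ × ℝ => qPochInf (u * Y p.2 / d * (q ^ p.1 * q)) q) l (𝓝 1) :=
      PI1 (by simpa using ((hYl.const_mul u).div_const d).mul (hpow.mul_const q))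
    have W2 : Tendsto (fun p : ℕ × ℝ => qPoch (k * Y p.2) q (p.1 - 1)) l
        (𝓝 (qPochInf (k * (q / d)) q)) := tendsto_qPoch_comp hq (hYl.const_mul k) hNl'
    have T := ((W1.const_sub 1).mul W2).mul ((((((Q0 u).mul (Q0 (v * d / q))).mul (Q a)).mul
      (Q b)).mul (Q c)).div ((((Q0 q).mul (Q0 (a * b))).mul (Q0 (a * c))).mul (Q0 (b * c)))
        hC0 |>.mul (P1.mul P2))
    refine T.congr' ?_
    filter_upwards [hNl.eventually_ge_atTop 1, tendsto_snd.eventually pos] with p hp1 hp2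
    obtain ⟨n, t⟩ := p
    obtain ⟨m, rfl⟩ : ∃ m, n = m + 1 := ⟨n - 1, by simp only at hp1; omega⟩
    simp only at hp2
    have ht : (t : ℂ) ≠ 0 := Complex.ofReal_ne_zero.2 hp2.1.ne'
    simp only [hβ, Pi.div_apply, wpWeight, wpTerm, add_tsub_cancel_right]
    rw [tq t hp2.1.ne', div_mul_cancel₀ _ hq0, pow_succ q (m + 1), mul_comm 2, pow_mul, pow_two,
      eq_div_iff (pow_ne_zero _ ht)]
    ring
  obtain ⟨K, hK, hterm⟩ := exists_norm_wpTerm_le hq ha hb hc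
    (max ‖u‖ (max ‖v * d / q‖ (max (‖v‖ * (‖q / d‖ + 1)) (max (‖u / d‖ * (‖q / d‖ + 1))
      (‖q / d‖ + 1)))))
  obtain ⟨K1, hK1, hω⟩ := (isTameWeight_wpWeight hq).2 (‖k / q‖ * (‖q / d‖ + 1))
  have hYb : ∀ᶠ t in 𝓝[<] (1 : ℝ), ‖Y t‖ < ‖q / d‖ + 1 :=
    hY1.norm.eventually_lt_const (lt_add_one _)
  have hL := eq_zero_of_abel (B := K1 * K) lim (by
    filter_upwards [hYb, pos] with t hYt ht n
    have htn : ‖(t : ℂ)‖ = t := by rw [Complex.norm_real, Real.norm_of_nonneg ht.1.le]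
    have e1 : ‖v * Y t‖ ≤ ‖v‖ * (‖q / d‖ + 1) := by
      rw [norm_mul]; exact mul_le_mul_of_nonneg_left hYt.le (norm_nonneg _)
    have e2 : ‖u * Y t / d‖ ≤ ‖u / d‖ * (‖q / d‖ + 1) := by
      rw [mul_div_right_comm, norm_mul]; exact mul_le_mul_of_nonneg_left hYt.le (norm_nonneg _)
    have e3 : ‖k * Y t / q‖ ≤ ‖k / q‖ * (‖q / d‖ + 1) := by
      rw [mul_div_right_comm, norm_mul]; exact mul_le_mul_of_nonneg_left hYt.le (norm_nonneg _)
    have h1 := hterm d u v (Y t) n (le_max_left _ _) ((le_max_left _ _).trans (le_max_right _ _))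
      (e1.trans ((le_max_left _ _).trans ((le_max_right _ _).trans (le_max_right _ _))))
      (e2.trans ((le_max_left _ _).trans ((le_max_right _ _).trans
        ((le_max_right _ _).trans (le_max_right _ _)))))
      (hYt.le.trans ((le_max_right _ _).trans ((le_max_right _ _).trans
        ((le_max_right _ _).trans (le_max_right _ _)))))
    rw [tq t ht.1.ne', htn] at h1
    simp only [hβ]
    rw [norm_div, norm_mul, norm_pow, htn, div_le_iff₀ (pow_pos ht.1 n), mul_assoc K1]
    exact mul_le_mul (hω n _ e3) h1 (norm_nonneg _) hK1.le) (by
    filter_upwards [pos] with t ht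
    have htc : (t : ℂ) ≠ 0 := Complex.ofReal_ne_zero.2 ht.1.ne'
    have htn : ‖(t : ℂ)‖ = t := by rw [Complex.norm_real, Real.norm_of_nonneg ht.1.le]
    have h1 := h0 (Y t) (by
      rw [hY]
      simp only
      rw [← div_div, norm_div (q / d), htn, lt_div_iff₀ ht.1]
      have := norm_pos_iff.2 hqd0
      nlinarith [ht.2])
    unfold wpSum at h1
    rw [tq t ht.1.ne'] at h1
    have h2 := (mul_eq_zero.1 h1).resolve_left
      (qPochInf_ne_zero_of_norm_lt_one hq (by rw [htn]; exact ht.2))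
    rw [← h2]
    refine tsum_congr fun n => ?_
    simp only [hβ]
    rw [div_mul_cancel₀ _ (pow_ne_zero _ htc)])
  have nz : ∀ x : ℂ, ‖x‖ < 1 → qPochInf (x * (q / d)) q ≠ 0 := fun x hx =>
    qPochInf_ne_zero_of_norm_lt_one hq (norm_mul_lt_one hx hqd)
  by_contra! h
  refine mul_ne_zero (mul_ne_zero (by simp) (nz k hkn)) (mul_ne_zero (div_ne_zero
    (mul_ne_zero (mul_ne_zero (mul_ne_zero (mul_ne_zero h.1 h.2) (nz a ha)) (nz b hb))
      (nz c hc)) hC0) (by simp)) hL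

/-- Vanishing on the circle propagates by the identity theorem to the whole region |y| > |q/d|. Then
the series terminates, possibly after exchanging u and vd/q, and a terminating series is not
identically zero. -/
lemma exists_vSum_ne_zero (hq0 : q ≠ 0) (hq : ‖q‖ < 1) (ha : ‖a‖ < 1) (hb : ‖b‖ < 1)
    (hc : ‖c‖ < 1) (hd : d ≠ 0) (hqd : ‖q / d‖ < 1) (hu : u ≠ 0) (huv : u * v = a * b * c) :
    ∃ z : ℂ, ‖z‖ = 1 ∧ vSum q a b c d u v z ≠ 0 := by
  by_contra! h
  have hk : ‖a * b * c‖ < 1 := norm_mul_lt_one (norm_mul_lt_one ha hb) hc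
  have hqd0 : 0 < ‖q / d‖ := norm_pos_iff.2 (div_ne_zero hq0 hd)
  have tt : ∀ y : ℂ, ‖q / d‖ < ‖y‖ → ‖q / (d * y)‖ < 1 := fun y hy => by
    rw [← div_div, norm_div, div_lt_one ((norm_nonneg _).trans_lt hy)]; exact hy
  have hcirc : ∀ z : ℂ, ‖z‖ = 1 → wpSum q a b c d u v z = 0 := fun z hz => by
    have hz0 : z ≠ 0 := norm_pos_iff.1 (by rw [hz]; exact one_pos)
    rw [wpSum_eq_vSum hq0 hq ha hb hc hd hz0 (tt z (by rwa [hz])) huv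
      (qPochInf_ne_zero_of_norm_lt_one hq (norm_mul_lt_one (by rwa [norm_mul, hz, mul_one]) hq)),
      h z hz, zero_mul]
  have hfreq : ∃ᶠ z in 𝓝[≠] (1 : ℂ), wpSum q a b c d u v z = 0 := by
    have hS : IsPreconnected (Metric.sphere (0 : ℂ) 1) :=
      isPreconnected_sphere (Complex.rank_real_complex ▸ Nat.one_lt_ofNat) 0 1
    have hP := hS.preperfect_of_nontrivial ⟨1, by simp, -1, by simp, by norm_num⟩ 1 (by simp)
    exact (accPt_iff_frequently_nhdsNE.1 hP).mono fun z hz => hcirc z (by simpa using hz)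
  have h0 : ∀ y : ℂ, ‖q / d‖ < ‖y‖ → wpSum q a b c d u v y = 0 := by
    intro y hy
    set A := {z : ℂ | ‖q / d‖ < ‖z‖ ∧ ‖z‖ < ‖y‖ + 2} with hA
    have hAo : IsOpen A := (isOpen_lt continuous_const continuous_norm).inter
      (isOpen_lt continuous_norm continuous_const)
    have D := differentiableOn_wpSum (u := fun _ => u) (v := fun _ => v) hq ha hb hc hAo hd
      (differentiableOn_const u) (differentiableOn_const v) differentiableOn_id
      (fun z hz => norm_pos_iff.1 ((norm_nonneg _).trans_lt hz.1)) (fun z hz => tt z hz.1)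
    exact (D.analyticOnNhd hAo).eqOn_zero_of_preconnected_of_frequently_eq_zero
      (isPreconnected_annulus hqd0 _) (z₀ := 1)
      ⟨by simpa using hqd, by rw [norm_one]; linarith [norm_nonneg y]⟩ hfreq ⟨hy, by linarith⟩
  rcases terminating_of_wpSum_eq_zero hq0 hq ha hb hc hd hqd h0 with h1 | h1
  · obtain ⟨n, hn⟩ := exists_mul_pow_eq_one hq h1
    exact not_wpSum_eq_zero_of_terminating hq0 hq n ha hb hc hd hn huv ⟨_, h0⟩
  · obtain ⟨n, hn⟩ := exists_mul_pow_eq_one hq h1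
    refine not_wpSum_eq_zero_of_terminating hq0 hq n (u := v * d / q) (v := u * q / d)
      ha hb hc hd hn (by rw [← huv]; field_simp) ⟨‖q / d‖, fun y hy => ?_⟩
    rw [wpSum_swap hq0 hd]
    exact h0 y hy

end Nonvanishing

/-! ### Contour integration between |z| = 1 and |z| = q^{-1/2} -/

section Contour

lemma integral_circleMap_neg (F : ℂ → ℂ) (r : ℝ) :
    ∫ θ in (0 : ℝ)..2 * Real.pi, F (circleMap 0 r (-θ)) =
      ∫ θ in (0 : ℝ)..2 * Real.pi, F (circleMap 0 r θ) := by
  have h1 := intervalIntegral.integral_comp_neg (a := 0) (b := 2 * Real.pi)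
    fun θ => F (circleMap 0 r θ)
  have hp : Function.Periodic (fun θ => F (circleMap 0 r θ)) (2 * Real.pi) := fun θ => by
    simp only [periodic_circleMap 0 r θ]
  have h2 := hp.intervalIntegral_add_eq (-(2 * Real.pi)) 0
  rw [h1, neg_zero]
  simpa using h2

lemma inv_circleMap_one (θ : ℝ) : (circleMap 0 1 θ)⁻¹ = circleMap 0 1 (-θ) := by
  rw [circleMap_zero, circleMap_zero, mul_inv, ← Complex.exp_neg]
  push_cast
  rw [inv_one, neg_mul]

/-- On the circle of radius q^{-1/2} the involution z ↦ 1/(qz) is complex conjugation. -/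
lemma inv_mul_circleMap {q r : ℝ} (hr : 0 < r) (h : q * (r * r) = 1) (θ : ℝ) :
    ((q : ℂ) * circleMap 0 r θ)⁻¹ = circleMap 0 r (-θ) := by
  rw [circleMap_zero, circleMap_zero]
  have h1 : ((q : ℂ) * (r * r)) = 1 := by exact_mod_cast h
  have hr' : (r : ℂ) ≠ 0 := Complex.ofReal_ne_zero.2 hr.ne'
  have hq' : (q : ℂ) ≠ 0 := by
    rintro h0
    rw [h0, zero_mul] at h1
    exact zero_ne_one h1
  rw [mul_inv, mul_inv, ← Complex.exp_neg, Complex.ofReal_neg, neg_mul, ← mul_assoc]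
  congr 1
  field_simp
  linear_combination -h1

lemma circleIntegral_div_self (G : ℂ → ℂ) {r : ℝ} (hr : 0 < r) :
    (∮ z in C(0, r), G z / z) =
      Complex.I * ∫ θ in (0 : ℝ)..2 * Real.pi, G (circleMap 0 r θ) := by
  rw [circleIntegral, ← intervalIntegral.integral_const_mul]
  refine intervalIntegral.integral_congr fun θ _ => ?_
  have h0 : circleMap 0 r θ ≠ 0 := circleMap_ne_center hr.ne'
  simp only [deriv_circleMap, smul_eq_mul]
  field_simp

/-- The residue theorem for an annulus and a function with one simple pole that is antisymmetric
on the outer circle. -/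
lemma integral_div_one_sub_mul {q α : ℝ} (hq0 : 0 < q) (hα0 : Real.sqrt q < α) (hα1 : α < 1)
    {H : ℂ → ℂ} {A : Set ℂ} (hA : IsOpen A) (hA0 : ∀ z ∈ A, z ≠ 0)
    (hAs : ∀ z : ℂ, 1 ≤ ‖z‖ → ‖z‖ ≤ (Real.sqrt q)⁻¹ → z ∈ A) (hH : DifferentiableOn ℂ H A)
    (anti : ∀ z : ℂ, ‖z‖ = (Real.sqrt q)⁻¹ →
      H ((q * z)⁻¹) / (1 - α * (q * z)⁻¹) = -(H z / (1 - α * z))) :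
    ∫ θ in (0 : ℝ)..2 * Real.pi, H (circleMap 0 1 θ) / (1 - α * circleMap 0 1 θ) =
      2 * Real.pi * H (α : ℂ)⁻¹ := by
  have hs : 0 < Real.sqrt q := Real.sqrt_pos.2 hq0
  have hαp : 0 < α := hs.trans hα0
  have hαc : (α : ℂ) ≠ 0 := Complex.ofReal_ne_zero.2 hαp.ne'
  set r := (Real.sqrt q)⁻¹ with hr
  have hrp : 0 < r := inv_pos.2 hs
  have hαr : α⁻¹ < r := inv_strictAnti₀ hs hα0
  have hα1' : 1 < α⁻¹ := (one_lt_inv₀ hαp).2 hα1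
  have hqr : q * (r * r) = 1 := by
    rw [hr, ← mul_inv, Real.mul_self_sqrt hq0.le, mul_inv_cancel₀ hq0.ne']
  set p : ℂ := (α : ℂ)⁻¹ with hp
  have hpn : ‖p‖ = α⁻¹ := by rw [hp, norm_inv, Complex.norm_real, Real.norm_of_nonneg hαp.le]
  have hpA : p ∈ A := hAs p (by rw [hpn]; exact hα1'.le) (by rw [hpn]; exact hαr.le)
  set M : ℂ → ℂ := fun z => H z / z with hM
  have hMd : DifferentiableOn ℂ M A := hH.div differentiableOn_id hA0
  have hK : DifferentiableOn ℂ (dslope M p) A :=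
    (Complex.differentiableOn_dslope (hA.mem_nhds hpA)).2 hMd
  -- Splitting H(z)/z by its difference slope at p = 1/α separates the polar part from a remainder
  -- analytic on the annulus, whose integral is the same over both circles.
  have circ : ∀ x : ℝ, 1 ≤ x → x ≤ r → ‖p‖ ≠ x →
      (∮ z in C(0, x), H z / (1 - α * z) / z) =
        -(α : ℂ)⁻¹ * (M p * (∮ z in C(0, x), (z - p)⁻¹) + ∮ z in C(0, x), dslope M p z) := by
    intro x hx1 hx2 hpx
    have hx0 : 0 ≤ x := by linarith
    have hsub : ∀ z ∈ Metric.sphere (0 : ℂ) x, z ∈ A ∧ z - p ≠ 0 := fun z hz => by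
      have hz' : ‖z‖ = x := by simpa using hz
      refine ⟨hAs z (by rw [hz']; exact hx1) (by rw [hz']; exact hx2), fun h => hpx ?_⟩
      rw [← hz', sub_eq_zero.1 h]
    have I1 : CircleIntegrable (fun z => M p * (z - p)⁻¹) 0 x :=
      (continuousOn_const.mul ((continuousOn_id.sub continuousOn_const).inv₀
        fun z hz => (hsub z hz).2)).circleIntegrable hx0
    have I2 : CircleIntegrable (dslope M p) 0 x :=
      (hK.continuousOn.mono fun z hz => (hsub z hz).1).circleIntegrable hx0
    rw [← circleIntegral.integral_const_mul, ← circleIntegral.integral_add I1 I2,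
      ← circleIntegral.integral_const_mul]
    refine circleIntegral.integral_congr hx0 fun z hz => ?_
    obtain ⟨hzA, hzp⟩ := hsub z hz
    have hz0 := hA0 z hzA
    have e := sub_smul_dslope M p z
    rw [smul_eq_mul] at e
    have e1 : 1 - α * z = -(α : ℂ) * (z - p) := by rw [hp]; field_simp; ring
    have e2 : dslope M p z = (M z - M p) * (z - p)⁻¹ := by rw [← e]; field_simp
    rw [e1, e2]
    simp only [hM]
    field_simp
    ring
  have c1 := circ 1 le_rfl (hα1'.trans hαr).le (by rw [hpn]; exact hα1'.ne')
  have c2 := circ r (hα1'.trans hαr).le le_rfl (by rw [hpn]; exact hαr.ne)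
  have k1 : (∮ z in C(0, 1), (z - p)⁻¹) = 0 := by
    refine Complex.circleIntegral_eq_zero_of_differentiable_on_off_countable zero_le_one
      Set.countable_empty ?_ ?_
    · refine (continuousOn_id.sub continuousOn_const).inv₀ fun z hz h' => ?_
      have h : z - p = 0 := h'
      have : ‖z‖ ≤ 1 := by simpa using hz
      rw [sub_eq_zero.1 h] at this
      simp only [hpn] at this
      linarith
    · intro z hz
      refine (differentiableAt_id.sub (differentiableAt_const p)).inv fun h' => ?_
      have h : z - p = 0 := h'
      have : ‖z‖ < 1 := by simpa using hz.1
      rw [sub_eq_zero.1 h, hpn] at this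
      linarith
  have k2 : (∮ z in C(0, r), (z - p)⁻¹) = 2 * Real.pi * Complex.I :=
    circleIntegral.integral_sub_inv_of_mem_ball (by simpa [hpn] using hαr)
  have k3 : (∮ z in C(0, r), dslope M p z) = ∮ z in C(0, 1), dslope M p z := by
    refine Complex.circleIntegral_eq_of_differentiable_on_annulus_off_countable one_pos
      (hα1'.trans hαr).le Set.countable_empty ?_ ?_
    · refine hK.continuousOn.mono fun z hz => hAs z ?_ ?_
      · simpa using hz.2
      · simpa using hz.1
    · intro z hz
      refine hK.differentiableAt (hA.mem_nhds (hAs z ?_ ?_))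
      · have := hz.1.2
        simp only [Metric.mem_closedBall, dist_zero_right, not_le] at this
        exact this.le
      · have := hz.1.1
        simp only [Metric.mem_ball, dist_zero_right] at this
        exact this.le
  -- By antisymmetry the integral over the outer circle equals its own negative.
  have k4 : ∫ θ in (0 : ℝ)..2 * Real.pi, H (circleMap 0 r θ) / (1 - α * circleMap 0 r θ) = 0 := by
    have e1 := integral_circleMap_neg (fun z => H z / (1 - α * z)) r
    have e2 : ∫ θ in (0 : ℝ)..2 * Real.pi, H (circleMap 0 r (-θ)) /
        (1 - α * circleMap 0 r (-θ)) =
        -∫ θ in (0 : ℝ)..2 * Real.pi, H (circleMap 0 r θ) / (1 - α * circleMap 0 r θ) := by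
      rw [← intervalIntegral.integral_neg]
      refine intervalIntegral.integral_congr fun θ _ => ?_
      have h3 := anti (circleMap 0 r θ) (by rw [norm_circleMap_zero, abs_of_pos hrp])
      rw [inv_mul_circleMap hrp hqr] at h3
      exact h3
    rw [e1] at e2
    exact self_eq_neg.1 e2
  rw [circleIntegral_div_self (fun z => H z / (1 - α * z)) one_pos, k1] at c1
  rw [circleIntegral_div_self (fun z => H z / (1 - α * z)) hrp, k2, k3, k4] at c2
  have hMp : M p = α * H p := by
    simp only [hM]
    rw [hp]; field_simp
  rw [hMp] at c2
  have : Complex.I * ∫ θ in (0 : ℝ)..2 * Real.pi,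
      H (circleMap 0 1 θ) / (1 - α * circleMap 0 1 θ) =
      Complex.I * (2 * Real.pi * H p) := by
    have e : (α : ℂ)⁻¹ * α = 1 := inv_mul_cancel₀ hαc
    linear_combination c1 - c2 + (2 * Real.pi * Complex.I * H p) * e
  exact mul_left_cancel₀ Complex.I_ne_zero this

end Contour

/-- The theta function `(x, q / x; q)_∞`. -/
noncomputable def qTheta (q x : ℂ) : ℂ := qPochInf x q * qPochInf (q / x) q

/-- The product `(a z, b z, c z, q z / d; q)_∞`. -/
noncomputable def paramProd (q a b c d z : ℂ) : ℂ :=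
  qPochInf (a * z) q * qPochInf (b * z) q * qPochInf (c * z) q * qPochInf (q / d * z) q

/-- The weight function on the unit circle. -/
noncomputable def circleWeight (q α a b c d z : ℂ) : ℂ :=
  qPochInf (z * z) q * qPochInf (1 / (z * z)) q /
    (paramProd q a b c d z * paramProd q a b c d (1 / z) * (qTheta q (α * z) * qTheta q (α / z)))

/-- The weight function multiplied by the leading coefficient of the difference operator. -/
noncomputable def fluxWeight (q α a b c d z : ℂ) : ℂ :=
  z * (qPochInf (q * q * (z * z)) q * qPochInf (1 / (z * z)) q) /
    (paramProd q a b c d (q * z) * paramProd q a b c d (1 / z) *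
      (qTheta q (α * z) * qTheta q (α / z)))

/-- `fluxWeight` multiplied by `1 - α z`. -/
noncomputable def fluxNumerator (q α a b c d z : ℂ) : ℂ :=
  z * (qPochInf (q * q * (z * z)) q * qPochInf (1 / (z * z)) q) /
    (paramProd q a b c d (q * z) * paramProd q a b c d (1 / z) *
      ((qPochInf (α * z * q) q * qPochInf (q / (α * z)) q) *
        (qPochInf (α / z) q * qPochInf (q * z / α) q)))

/-! ### Theta functions, the flux weight and the pointwise Wronskian identity -/

section Weights

variable {q α a b c d x z : ℂ}

lemma qTheta_mul (hq0 : q ≠ 0) (hq : ‖q‖ < 1) (hx : x ≠ 0) :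
    qTheta q (q * x) = -(qTheta q x / x) := by
  have h1 := qPochInf_eq hq x
  have h2 := qPochInf_eq hq (1 / x)
  rw [qTheta, qTheta, h1, show q / (q * x) = 1 / x by field_simp, h2,
    show 1 / x * q = q / x by ring, mul_comm q x]
  field_simp
  ring

lemma qTheta_div (hq0 : q ≠ 0) (hq : ‖q‖ < 1) (hx : x ≠ 0) :
    qTheta q (x / q) = -(x / q * qTheta q x) := by
  have h := qTheta_mul hq0 hq (div_ne_zero hx hq0)
  rw [mul_div_cancel₀ _ hq0] at h
  rw [h]
  field_simp

/-- The factor 1 - αz is the only one of the theta functions that vanishes for 1 ≤ |z| ≤ q^{-1/2};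
it is split off so that the numerator is analytic there. -/
lemma fluxWeight_eq_div (hq0 : q ≠ 0) (hq : ‖q‖ < 1) (hα : α ≠ 0) (hz : z ≠ 0) :
    fluxWeight q α a b c d z = fluxNumerator q α a b c d z / (1 - α * z) := by
  rw [fluxWeight, fluxNumerator, qTheta, qTheta, qPochInf_eq hq (α * z),
    show q / (α / z) = q * z / α by field_simp, div_div]
  congr 1
  ring

/-- The two Pochhammer pairs are interchanged. The quasi-periodicity factors of the two theta
functions multiply to 1/(qz²), exactly the change of the leading factor z. -/
lemma fluxWeight_inv_mul (hq0 : q ≠ 0) (hq : ‖q‖ < 1) (hα : α ≠ 0) (hz : z ≠ 0) :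
    fluxWeight q α a b c d (q * z)⁻¹ = fluxWeight q α a b c d z := by
  have e1 : q * q * ((q * z)⁻¹ * (q * z)⁻¹) = 1 / (z * z) := by field_simp
  have e2 : 1 / ((q * z)⁻¹ * (q * z)⁻¹) = q * q * (z * z) := by field_simp
  have e3 : q * (q * z)⁻¹ = 1 / z := by field_simp
  have e4 : 1 / (q * z)⁻¹ = q * z := by field_simp
  have e5 : α * (q * z)⁻¹ = α / z / q := by field_simp
  have e6 : α / (q * z)⁻¹ = q * (α * z) := by field_simp
  rw [fluxWeight, fluxWeight, e1, e2, e3, e4, e5, e6, qTheta_mul hq0 hq (mul_ne_zero hα hz),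
    qTheta_div hq0 hq (div_ne_zero hα hz)]
  simp only [div_eq_mul_inv, mul_inv, neg_mul_neg, inv_inv]
  field_simp

lemma paramProd_eq (hq : ‖q‖ < 1) : paramProd q a b c d z =
    ((1 - a * z) * (1 - b * z) * (1 - c * z) * (1 - q / d * z)) * paramProd q a b c d (q * z) := by
  rw [paramProd, qPochInf_eq hq (a * z), qPochInf_eq hq (b * z), qPochInf_eq hq (c * z),
    qPochInf_eq hq (q / d * z), paramProd, show a * (q * z) = a * z * q by ring,
    show b * (q * z) = b * z * q by ring, show c * (q * z) = c * z * q by ring,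
    show q / d * (q * z) = q / d * z * q by ring]
  ring

lemma qPochInf_eq_two (hq : ‖q‖ < 1) (x : ℂ) :
    qPochInf x q = (1 - x) * (1 - q * x) * qPochInf (q * q * x) q := by
  rw [qPochInf_eq hq x, qPochInf_eq hq (x * q), show x * q * q = q * q * x by ring, mul_comm x q]
  ring

/-- The weighted Wronskian identity on the unit circle. -/
lemma fluxWeight_add_inv {u v u' v' : ℂ} (hq0 : q ≠ 0) (hq : ‖q‖ < 1) (ha : ‖a‖ < 1) (hb : ‖b‖ < 1)
    (hc : ‖c‖ < 1) (hd : d ≠ 0) (hqd : ‖q / d‖ < 1) (hu : u ≠ 0)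
    (huv : u * v = a * b * c) (hu' : u' ≠ 0) (huv' : u' * v' = a * b * c) (hz : ‖z‖ = 1) :
    fluxWeight q α a b c d z *
        (vSum q a b c d u' v' (q * z)⁻¹ * vSum q a b c d u v z -
          vSum q a b c d u v (q * z)⁻¹ * vSum q a b c d u' v' z) +
      fluxWeight q α a b c d z⁻¹ *
        (vSum q a b c d u' v' (q * z⁻¹)⁻¹ * vSum q a b c d u v z⁻¹ -
          vSum q a b c d u v (q * z⁻¹)⁻¹ * vSum q a b c d u' v' z⁻¹) =
      1 / d * ((1 - u') * (1 - v' * d / q) - (1 - u) * (1 - v * d / q)) *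
        (circleWeight q α a b c d z * (vSum q a b c d u v z * vSum q a b c d u' v' z)) := by
  have hz0 : z ≠ 0 := norm_pos_iff.1 (by rw [hz]; exact one_pos)
  have hk : ‖a * b * c‖ < 1 := norm_mul_lt_one (norm_mul_lt_one ha hb) hc
  have hp : ∀ x : ℂ, ‖x‖ = 1 → qPochInf (a * b * c * x * q) q ≠ 0 := fun x hx =>
    qPochInf_ne_zero_of_norm_lt_one hq (norm_mul_lt_one (by rwa [norm_mul, hx, mul_one]) hq)
  have S : ∀ {u v : ℂ}, u ≠ 0 → u * v = a * b * c →
      vSum q a b c d u v z⁻¹ = vSum q a b c d u v z := fun hu huv =>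
    vSum_symm hq0 hq ha hb hc hd hz0 (by rwa [← div_div, norm_div, hz, div_one])
      (by rwa [mul_div_right_comm, norm_mul, hz, mul_one]) hu huv (hp z hz)
      (hp z⁻¹ (by rw [norm_inv, hz, inv_one]))
  have E := vSum_second_order hq0 hq ha hb hc hd hqd hu huv hz
  have E' := vSum_second_order hq0 hq ha hb hc hd hqd hu' huv' hz
  have nz : ∀ x : ℂ, ‖x‖ < 1 → 1 - x * z ≠ 0 ∧ 1 - x / z ≠ 0 := fun x hx =>
    ⟨one_sub_ne_zero_of_norm_lt_one (by rwa [norm_mul, hz, mul_one]),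
      one_sub_ne_zero_of_norm_lt_one (by rwa [norm_div, hz, div_one])⟩
  rw [show (q * z⁻¹)⁻¹ = z / q by field_simp, S hu huv, S hu' huv', fluxWeight, fluxWeight,
    circleWeight]
  generalize vSum q a b c d u v z = f at *
  generalize vSum q a b c d u' v' z = g at *
  generalize vSum q a b c d u v (z / q) = f₁ at *
  generalize vSum q a b c d u' v' (z / q) = g₁ at *
  generalize vSum q a b c d u v (q * z)⁻¹ = f₂ at *
  generalize vSum q a b c d u' v' (q * z)⁻¹ = g₂ at *
  have e1 : 1 / (z⁻¹ * z⁻¹) = z * z := by field_simp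
  have e2 : z⁻¹ * z⁻¹ = 1 / (z * z) := by field_simp
  have e3 : 1 / z⁻¹ = z := by field_simp
  have e4 : α * z⁻¹ = α / z := by ring
  have e5 : α / z⁻¹ = α * z := by field_simp
  have e6 : q * z⁻¹ = q * (1 / z) := by ring
  rw [e1, e2, e3, e4, e5, e6, paramProd_eq hq (z := z), paramProd_eq hq (z := 1 / z),
    qPochInf_eq_two hq (z * z), qPochInf_eq_two hq (1 / (z * z))]
  generalize paramProd q a b c d (q * z) = R
  generalize paramProd q a b c d (q * (1 / z)) = R'
  generalize qTheta q (α * z) = T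
  generalize qTheta q (α / z) = T'
  generalize qPochInf (q * q * (z * z)) q = X
  generalize qPochInf (q * q * (1 / (z * z))) q = Y
  obtain ⟨a1, a2⟩ := nz a ha
  obtain ⟨b1, b2⟩ := nz b hb
  obtain ⟨c1, c2⟩ := nz c hc
  obtain ⟨d1, d2⟩ := nz (q / d) hqd
  have key : ∀ r r' : ℂ, r ≠ 0 → r' ≠ 0 →
      r = (1 - a * z) * (1 - b * z) * (1 - c * z) * (1 - q / d * z) →
      r' = (1 - a * (1 / z)) * (1 - b * (1 / z)) * (1 - c * (1 / z)) * (1 - q / d * (1 / z)) →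
      z * (X * ((1 - 1 / (z * z)) * (1 - q * (1 / (z * z))) * Y)) / (R * (r' * R') * (T * T')) *
          (g₂ * f - f₂ * g) +
        z⁻¹ * (Y * ((1 - z * z) * (1 - q * (z * z)) * X)) / (R' * (r * R) * (T' * T)) *
          (g₁ * f - f₁ * g) =
        1 / d * ((1 - u') * (1 - v' * d / q) - (1 - u) * (1 - v * d / q)) *
          ((1 - z * z) * (1 - q * (z * z)) * X *
            ((1 - 1 / (z * z)) * (1 - q * (1 / (z * z))) * Y) /
            (r * R * (r' * R') * (T * T')) * (f * g)) := by
    intro r r' hr hr' hr1 hr2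
    set B := X * Y * (R⁻¹ * R'⁻¹ * T⁻¹ * T'⁻¹ * r⁻¹ * r'⁻¹) with hB
    have g1 : z * (X * ((1 - 1 / (z * z)) * (1 - q * (1 / (z * z))) * Y)) /
        (R * (r' * R') * (T * T')) = z * (1 - 1 / (z * z)) * (1 - q * (1 / (z * z))) * r * B := by
      rw [hB]
      simp only [div_eq_mul_inv, mul_inv]
      linear_combination (-(z * (X * ((1 - 1 * (z⁻¹ * z⁻¹)) * (1 - q * (1 * (z⁻¹ * z⁻¹))) * Y)) *
        (R⁻¹ * r'⁻¹ * R'⁻¹ * T⁻¹ * T'⁻¹))) * mul_inv_cancel₀ hr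
    have g2 : z⁻¹ * (Y * ((1 - z * z) * (1 - q * (z * z)) * X)) / (R' * (r * R) * (T' * T)) =
        z⁻¹ * (1 - z * z) * (1 - q * (z * z)) * r' * B := by
      rw [hB]
      simp only [div_eq_mul_inv, mul_inv]
      linear_combination (-(z⁻¹ * (Y * ((1 - z * z) * (1 - q * (z * z)) * X)) *
        (R⁻¹ * r⁻¹ * R'⁻¹ * T⁻¹ * T'⁻¹))) * mul_inv_cancel₀ hr'
    have g3 : (1 - z * z) * (1 - q * (z * z)) * X *
        ((1 - 1 / (z * z)) * (1 - q * (1 / (z * z))) * Y) / (r * R * (r' * R') * (T * T')) =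
        (1 - z * z) * (1 - q * (z * z)) * (1 - 1 / (z * z)) * (1 - q * (1 / (z * z))) * B := by
      rw [hB]
      simp only [div_eq_mul_inv, mul_inv]
      ring
    rw [g1, g2, g3, hr1, hr2]
    clear_value B
    have hzi := mul_inv_cancel₀ hz0
    -- The two zeros are replaced by the left-hand sides of the equations for g and f. In f ·
    -- (equation for g) - g · (equation for f) the terms without shifts cancel, apart from the
    -- difference of the eigenvalues.
    have F : f * (z * (1 - 1 / (z * z)) * B) * (0 : ℂ) - g * (z * (1 - 1 / (z * z)) * B) * 0 = 0 := by
      ring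
    nth_rewrite 1 [← E'] at F
    nth_rewrite 1 [← E] at F
    rw [← sub_eq_zero, ← neg_eq_zero, ← F]
    field_simp
    ring
  have := key _ _ (mul_ne_zero (mul_ne_zero (mul_ne_zero a1 b1) c1) d1)
    (mul_ne_zero (mul_ne_zero (mul_ne_zero (by rwa [mul_one_div]) (by rwa [mul_one_div]))
      (by rwa [mul_one_div])) (by rwa [mul_one_div])) rfl rfl
  exact this

end Weights

/-! ### Positivity of the weight, and Green's formula -/

section Flux

variable {a b c z : ℂ} {q α d : ℝ}

/-- For |z| = 1 the factors at 1/z are the conjugates of those at z, because q, α, d are real and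
conjugation permutes a, b, c. -/
lemma circleWeight_eq_sq (hq0 : 0 < q) (hq1 : q < 1)
    (habc : (a.im = 0 ∧ b.im = 0 ∧ c.im = 0) ∨ (b = conj a ∧ c.im = 0) ∨
      (c = conj a ∧ b.im = 0) ∨ (c = conj b ∧ a.im = 0)) (hz : ‖z‖ = 1) :
    circleWeight q α a b c d z =
      ((‖qPochInf (z * z) q‖ / (‖paramProd q a b c d z‖ * ‖qTheta q (α * z)‖)) ^ 2 : ℝ) := by
  have hqn : ‖(q : ℂ)‖ < 1 := by rwa [Complex.norm_real, Real.norm_of_nonneg hq0.le]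
  have hz1 : conj z = 1 / z := by rw [one_div, Complex.inv_eq_conj hz]
  have c1 : qPochInf (1 / (z * z)) q = conj (qPochInf (z * z) q) := by
    rw [conj_qPochInf hqn, map_mul, hz1, Complex.conj_ofReal, div_mul_div_comm, one_mul]
  have c2 : qTheta q (α / z) = conj (qTheta q (α * z)) := by
    simp only [qTheta, map_mul, conj_qPochInf hqn, map_div₀, hz1, Complex.conj_ofReal, mul_one_div]
  have c3 : paramProd q a b c d (1 / z) = conj (paramProd q a b c d z) := by
    simp only [paramProd, map_mul, conj_qPochInf hqn, map_div₀, hz1, Complex.conj_ofReal]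
    rcases habc with ⟨h1, h2, h3⟩ | ⟨rfl, h2⟩ | ⟨rfl, h2⟩ | ⟨rfl, h2⟩
    · rw [Complex.conj_eq_iff_im.2 h1, Complex.conj_eq_iff_im.2 h2, Complex.conj_eq_iff_im.2 h3]
    · rw [Complex.conj_eq_iff_im.2 h2, Complex.conj_conj]; ring
    · rw [Complex.conj_eq_iff_im.2 h2, Complex.conj_conj]; ring
    · rw [Complex.conj_eq_iff_im.2 h2, Complex.conj_conj]; ring
  rw [circleWeight, c1, c2, c3, Complex.mul_conj', Complex.mul_conj', Complex.mul_conj']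
  push_cast
  rw [div_pow, mul_pow]

lemma paramProd_ne_zero {q a b c d : ℂ} (hq : ‖q‖ < 1) (ha : ‖a * z‖ < 1) (hb : ‖b * z‖ < 1)
    (hc : ‖c * z‖ < 1) (hqd : ‖q / d * z‖ < 1) : paramProd q a b c d z ≠ 0 :=
  mul_ne_zero (mul_ne_zero (mul_ne_zero (qPochInf_ne_zero_of_norm_lt_one hq ha)
    (qPochInf_ne_zero_of_norm_lt_one hq hb)) (qPochInf_ne_zero_of_norm_lt_one hq hc))
    (qPochInf_ne_zero_of_norm_lt_one hq hqd)

lemma qTheta_ne_zero {q x : ℂ} (hq : ‖q‖ < 1) (h1 : ‖x‖ < 1) (h2 : ‖q / x‖ < 1) : qTheta q x ≠ 0 :=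
  mul_ne_zero (qPochInf_ne_zero_of_norm_lt_one hq h1) (qPochInf_ne_zero_of_norm_lt_one hq h2)

/-- An annulus on which the functions in the contour integral are regular. -/
def fluxDomain (q α : ℝ) (a b c d : ℂ) : Set ℂ :=
  {z | (‖a‖ < ‖z‖ ∧ ‖b‖ < ‖z‖ ∧ ‖c‖ < ‖z‖ ∧ ‖(q : ℂ) / d‖ < ‖z‖ ∧ α < ‖z‖) ∧ ‖z‖ < α / q}

lemma isOpen_fluxDomain (q α : ℝ) (a b c d : ℂ) : IsOpen (fluxDomain q α a b c d) := by
  have h : ∀ x : ℝ, IsOpen {z : ℂ | x < ‖z‖} := fun x => isOpen_lt continuous_const continuous_norm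
  exact ((h _).inter ((h _).inter ((h _).inter ((h _).inter (h _))))).inter
    (isOpen_lt continuous_norm continuous_const)

/-- On the annulus every argument in the denominator has modulus less than 1, so no factor vanishes.
-/
lemma differentiableOn_fluxNumerator (hq0 : 0 < q) (hq1 : q < 1) (hα0 : Real.sqrt q < α)
    (hα1 : α < 1) (ha : ‖a‖ < 1) (hb : ‖b‖ < 1) (hc : ‖c‖ < 1)
    (hqd : ‖(q : ℂ) / d‖ < 1) :
    DifferentiableOn ℂ (fluxNumerator q α a b c d) (fluxDomain q α a b c d) := by
  have hqn' : ‖(q : ℂ)‖ = q := by rw [Complex.norm_real, Real.norm_of_nonneg hq0.le]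
  have hqn : ‖(q : ℂ)‖ < 1 := by rwa [hqn']
  have hαp : 0 < α := (Real.sqrt_nonneg q).trans_lt hα0
  have hαn : ‖(α : ℂ)‖ = α := by rw [Complex.norm_real, Real.norm_of_nonneg hαp.le]
  have hq2 : q < α * α := by
    have := Real.mul_self_sqrt hq0.le
    nlinarith [Real.sqrt_nonneg q]
  intro z hz
  obtain ⟨⟨h1, h2, h3, h4, h5⟩, h6⟩ := hz
  have hzp : 0 < ‖z‖ := hαp.trans h5
  have hz0 : z ≠ 0 := norm_pos_iff.1 hzp
  have hαc : (α : ℂ) ≠ 0 := Complex.ofReal_ne_zero.2 hαp.ne'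
  have h7 : q * ‖z‖ < α := by rwa [lt_div_iff₀ hq0, mul_comm] at h6
  have m1 : ∀ x : ℂ, ‖x‖ < 1 → ‖x * (q * z)‖ < 1 := fun x hx => by
    rw [norm_mul, norm_mul, hqn']
    exact mul_lt_one_of_nonneg_of_lt_one_left (norm_nonneg _) hx (h7.trans hα1).le
  have m2 : ∀ x : ℂ, ‖x‖ < ‖z‖ → ‖x * (1 / z)‖ < 1 := fun x hx => by
    rwa [mul_one_div, norm_div, div_lt_one hzp]
  have n1 : paramProd q a b c d (q * z) ≠ 0 :=
    paramProd_ne_zero hqn (m1 a ha) (m1 b hb) (m1 c hc) (m1 _ hqd)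
  have n2 : paramProd q a b c d (1 / z) ≠ 0 :=
    paramProd_ne_zero hqn (m2 a h1) (m2 b h2) (m2 c h3) (m2 _ h4)
  have n3 : qPochInf (α * z * q) q ≠ 0 := by
    refine qPochInf_ne_zero_of_norm_lt_one hqn ?_
    rw [mul_assoc, mul_comm z]
    exact m1 α (by rwa [hαn])
  have n4 : qPochInf (q / (α * z)) q ≠ 0 := by
    refine qPochInf_ne_zero_of_norm_lt_one hqn ?_
    rw [norm_div, norm_mul, hqn', hαn, div_lt_one (by positivity)]
    nlinarith
  have n5 : qPochInf (α / z) q ≠ 0 := by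
    refine qPochInf_ne_zero_of_norm_lt_one hqn ?_
    rwa [norm_div, hαn, div_lt_one hzp]
  have n6 : qPochInf (q * z / α) q ≠ 0 := by
    refine qPochInf_ne_zero_of_norm_lt_one hqn ?_
    rwa [norm_div, norm_mul, hqn', hαn, div_lt_one hαp]
  have D : ∀ {f : ℂ → ℂ}, DifferentiableAt ℂ f z →
      DifferentiableAt ℂ (fun z => qPochInf (f z) q) z := fun {f} hf =>
    ((differentiable_qPochInf hqn) (f z)).comp z hf
  have Di : DifferentiableAt ℂ (fun z : ℂ => 1 / z) z := (differentiableAt_const _).div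
    differentiableAt_id hz0
  have Dm : DifferentiableAt ℂ (fun z : ℂ => (q : ℂ) * z) z := differentiableAt_id.const_mul _
  have DR : ∀ {f : ℂ → ℂ}, DifferentiableAt ℂ f z →
      DifferentiableAt ℂ (fun z => paramProd q a b c d (f z)) z := fun {f} hf =>
    (((D (hf.const_mul a)).mul (D (hf.const_mul b))).mul (D (hf.const_mul c))).mul
      (D (hf.const_mul (q / d : ℂ)))
  refine DifferentiableAt.differentiableWithinAt ?_
  refine DifferentiableAt.div ?_ ?_ (mul_ne_zero (mul_ne_zero n1 n2)
    (mul_ne_zero (mul_ne_zero n3 n4) (mul_ne_zero n5 n6)))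
  · exact differentiableAt_id.mul ((D ((differentiableAt_id.mul differentiableAt_id).const_mul _)).mul
      (D ((differentiableAt_const _).div (differentiableAt_id.mul differentiableAt_id)
        (mul_ne_zero hz0 hz0))))
  · refine ((DR Dm).mul (DR Di)).mul (((D ((differentiableAt_id.const_mul _).mul_const _)).mul
      (D ((differentiableAt_const _).div (differentiableAt_id.const_mul _)
        (mul_ne_zero hαc hz0)))).mul ((D ((differentiableAt_const _).div differentiableAt_id
          hz0)).mul (D (Dm.div_const _))))

/-- The Wronskian integral. -/
lemma exists_integral_circleWeight_eq (hq0 : 0 < q) (hq1 : q < 1) (hα0 : Real.sqrt q < α)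
    (hα1 : α < 1) (ha : ‖a‖ < 1) (hb : ‖b‖ < 1) (hc : ‖c‖ < 1) (hd : d ≠ 0)
    (hqd : ‖(q : ℂ) / d‖ < 1) {u v : ℂ} (hu : u ≠ 0) (huv : u * v = a * b * c)
    (h0 : vSum q a b c d u v (α : ℂ)⁻¹ = 0) :
    ∃ C : ℂ, ∀ u' v' : ℂ, u' ≠ 0 → u' * v' = a * b * c →
      ((1 - u') * (1 - v' * d / q) - (1 - u) * (1 - v * d / q)) *
        (∫ θ in (0 : ℝ)..2 * Real.pi, circleWeight q α a b c d (circleMap 0 1 θ) *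
          (vSum q a b c d u v (circleMap 0 1 θ) * vSum q a b c d u' v' (circleMap 0 1 θ))) =
        C * vSum q a b c d u' v' (α : ℂ)⁻¹ := by
  have hqn' : ‖(q : ℂ)‖ = q := by rw [Complex.norm_real, Real.norm_of_nonneg hq0.le]
  have hqn : ‖(q : ℂ)‖ < 1 := by rwa [hqn']
  have hqc : (q : ℂ) ≠ 0 := Complex.ofReal_ne_zero.2 hq0.ne'
  have hdc : (d : ℂ) ≠ 0 := Complex.ofReal_ne_zero.2 hd
  have hsq : 0 < Real.sqrt q := Real.sqrt_pos.2 hq0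
  have hαp : 0 < α := hsq.trans hα0
  have hαc : (α : ℂ) ≠ 0 := Complex.ofReal_ne_zero.2 hαp.ne'
  have hαn : ‖(α : ℂ)‖ = α := by rw [Complex.norm_real, Real.norm_of_nonneg hαp.le]
  have hdp : 0 < ‖(d : ℂ)‖ := norm_pos_iff.2 hdc
  have hqd' : q < ‖(d : ℂ)‖ := by rwa [norm_div, div_lt_one hdp, hqn'] at hqd
  set A := fluxDomain q α a b c d with hA
  have hAo : IsOpen A := isOpen_fluxDomain _ _ _ _ _ _
  have hA0 : ∀ z ∈ A, z ≠ 0 := fun z hz => norm_pos_iff.1 (hαp.trans hz.1.2.2.2.2)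
  have hAs : ∀ z : ℂ, 1 ≤ ‖z‖ → ‖z‖ ≤ (Real.sqrt q)⁻¹ → z ∈ A := fun z h1 h2 =>
    ⟨⟨ha.trans_le h1, hb.trans_le h1, hc.trans_le h1, hqd.trans_le h1, hα1.trans_le h1⟩,
      h2.trans_lt (by
        rw [lt_div_iff₀ hq0]
        calc (Real.sqrt q)⁻¹ * q = Real.sqrt q := by
              nth_rewrite 2 [← Real.mul_self_sqrt hq0.le]
              field_simp
          _ < α := hα0)⟩
  have hk : ∀ z ∈ A, ‖a * b * c‖ < ‖z‖ := fun z hz => by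
    refine lt_of_le_of_lt ?_ hz.1.1
    rw [mul_assoc, norm_mul]
    exact mul_le_of_le_one_right (norm_nonneg _) (norm_mul_lt_one hb hc).le
  have hqz : ∀ z ∈ A, q * ‖z‖ < 1 := fun z hz => by
    have := hz.2
    rw [lt_div_iff₀ hq0] at this
    linarith
  have V1 : ∀ u v : ℂ, DifferentiableOn ℂ (fun z => vSum q a b c d u v z) A := fun u v =>
    differentiableOn_vSum (y := fun z => z) hqn ha hb hc hAo hdc (differentiableOn_const u)
      (differentiableOn_const v) differentiableOn_id hA0
      (fun z hz => by
        rw [← div_div, norm_div, div_lt_one (norm_pos_iff.2 (hA0 z hz))]; exact hz.1.2.2.2.1)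
      (fun z hz => qPochInf_ne_zero_of_norm_lt_one hqn (norm_lt_one_of_mul_eq ha hb hc (by
        rw [norm_mul, hqn', mul_comm]; exact (hqz z hz).le)))
  have V2 : ∀ u v : ℂ, DifferentiableOn ℂ (fun z => vSum q a b c d u v (q * z)⁻¹) A := fun u v =>
    differentiableOn_vSum (y := fun z => (q * z)⁻¹) hqn ha hb hc hAo hdc (differentiableOn_const u)
      (differentiableOn_const v)
      ((differentiableOn_id.const_mul _).inv fun z hz => mul_ne_zero hqc (hA0 z hz))
      (fun z hz => inv_ne_zero (mul_ne_zero hqc (hA0 z hz)))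
      (fun z hz => by
        have h1 := hA0 z hz
        rw [show (q : ℂ) / (d * (q * z)⁻¹) = q * (q * z) / d by field_simp, norm_div, norm_mul,
          norm_mul, hqn', div_lt_one hdp]
        nlinarith [hqz z hz])
      (fun z hz => by
        have h1 := hA0 z hz
        rw [show a * b * c * ((q : ℂ) * z)⁻¹ * q = a * b * c / z by field_simp]
        refine qPochInf_ne_zero_of_norm_lt_one hqn ?_
        rw [norm_div, div_lt_one (norm_pos_iff.2 h1)]
        exact hk z hz)
  have DN := differentiableOn_fluxNumerator hq0 hq1 hα0 hα1 ha hb hc hqd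
  -- C collects what remains at 1/α when v_{ν₀} vanishes there; it does not depend on u' and v'. The
  -- factor 4π is twice the 2π of the contour lemma, since z and 1/z each contribute once.
  refine ⟨-(4 * Real.pi * d * (fluxNumerator q α a b c d (α : ℂ)⁻¹ *
    vSum q a b c d u v (q * (α : ℂ)⁻¹)⁻¹)), fun u' v' hu' huv' => ?_⟩
  set H : ℂ → ℂ := fun z => fluxNumerator q α a b c d z *
    (vSum q a b c d u' v' (q * z)⁻¹ * vSum q a b c d u v z -
      vSum q a b c d u v (q * z)⁻¹ * vSum q a b c d u' v' z) with hH
  have HD : DifferentiableOn ℂ H A :=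
    DN.mul (((V2 u' v').mul (V1 u v)).sub ((V2 u v).mul (V1 u' v')))
  have HF : ∀ z, z ≠ 0 → H z / (1 - α * z) = fluxWeight q α a b c d z *
    (vSum q a b c d u' v' (q * z)⁻¹ * vSum q a b c d u v z -
      vSum q a b c d u v (q * z)⁻¹ * vSum q a b c d u' v' z) := fun z hz => by
    rw [fluxWeight_eq_div hqc hqn hαc hz, hH]
    ring
  -- Under z ↦ 1/(qz) the weight is unchanged and the two arguments of the Wronskian are exchanged,
  -- which reverses its sign.
  have key := integral_div_one_sub_mul hq0 hα0 hα1 hAo hA0 hAs HD fun z hz => by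
    have hz0 : z ≠ 0 := norm_pos_iff.1 (by rw [hz]; positivity)
    rw [HF z hz0, HF _ (inv_ne_zero (mul_ne_zero hqc hz0)), fluxWeight_inv_mul hqc hqn hαc hz0,
      show ((q : ℂ) * (q * z)⁻¹)⁻¹ = z by field_simp]
    ring
  set G : ℂ → ℂ := fun z => H z / (1 - α * z) with hG
  have hcm : ∀ θ : ℝ, ‖circleMap 0 1 θ‖ = 1 := fun θ => by simp
  have hmem : ∀ z : ℂ, ‖z‖ = 1 → z ∈ A := fun z hz => hAs z hz.ge (by
    rw [hz]
    exact (one_le_inv₀ hsq).2 (hα0.trans hα1).le)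
  have GC : Continuous fun θ : ℝ => G (circleMap 0 1 θ) := by
    rw [← continuousOn_univ]
    have h1 : ContinuousOn G (Metric.sphere 0 1) := by
      refine (HD.continuousOn.mono fun z hz => hmem z (by simpa using hz)).div (by fun_prop) ?_
      intro z hz
      refine one_sub_ne_zero_of_norm_lt_one ?_
      rw [norm_mul, hαn, show ‖z‖ = 1 by simpa using hz, mul_one]
      exact hα1
    exact h1.comp (continuous_circleMap 0 1).continuousOn fun θ _ => by simp
  have GC' : Continuous fun θ : ℝ => G (circleMap 0 1 (-θ)) := GC.comp continuous_neg
  have I1 : ∫ θ in (0 : ℝ)..2 * Real.pi, (G (circleMap 0 1 θ) + G (circleMap 0 1 (-θ))) =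
      4 * Real.pi * H (α : ℂ)⁻¹ := by
    rw [intervalIntegral.integral_add (GC.intervalIntegrable _ _)
      (GC'.intervalIntegrable _ _), integral_circleMap_neg G 1, key]
    ring
  have I2 : ∫ θ in (0 : ℝ)..2 * Real.pi, (G (circleMap 0 1 θ) + G (circleMap 0 1 (-θ))) =
      1 / d * ((1 - u') * (1 - v' * d / q) - (1 - u) * (1 - v * d / q)) *
        ∫ θ in (0 : ℝ)..2 * Real.pi, circleWeight q α a b c d (circleMap 0 1 θ) *
          (vSum q a b c d u v (circleMap 0 1 θ) * vSum q a b c d u' v' (circleMap 0 1 θ)) := by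
    rw [← intervalIntegral.integral_const_mul]
    refine intervalIntegral.integral_congr fun θ _ => ?_
    have hz0 : circleMap 0 1 θ ≠ 0 := circleMap_ne_center one_ne_zero
    simp only [hG]
    rw [← inv_circleMap_one, HF _ hz0, HF _ (inv_ne_zero hz0)]
    exact fluxWeight_add_inv hqc hqn ha hb hc hdc hqd hu huv hu' huv' (hcm θ)
  have hHα : H (α : ℂ)⁻¹ = -(fluxNumerator q α a b c d (α : ℂ)⁻¹ *
      vSum q a b c d u v (q * (α : ℂ)⁻¹)⁻¹ * vSum q a b c d u' v' (α : ℂ)⁻¹) := by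
    simp only [hH]
    rw [h0]
    ring
  rw [I1, hHα] at I2
  generalize (∫ θ in (0 : ℝ)..2 * Real.pi, circleWeight q α a b c d (circleMap 0 1 θ) *
    (vSum q a b c d u v (circleMap 0 1 θ) * vSum q a b c d u' v' (circleMap 0 1 θ))) = J at I2 ⊢
  have hd1 : (d : ℂ) * (1 / d) = 1 := mul_one_div_cancel hdc
  linear_combination (-(d : ℂ)) * I2 -
    (((1 - u') * (1 - v' * d / q) - (1 - u) * (1 - v * d / q)) * J) * hd1

end Flux

/-- C cannot be zero, since m and I are nonzero at nearby points. Off the zeros of m, I = CF/m is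
analytic, and its continuity makes the singularity at z₀ removable; as I z₀ ≠ 0, orders compare.
Thus only continuity of the parameter integral is needed. -/
lemma analyticOrderAt_eq_of_mul_eq_const_mul {F m I : ℂ → ℂ} {C z₀ : ℂ} (hF : AnalyticAt ℂ F z₀)
    (hm : AnalyticAt ℂ m z₀) (hm' : analyticOrderAt m z₀ ≠ ⊤) (hI : ContinuousAt I z₀)
    (hI0 : I z₀ ≠ 0) (h : ∀ z, m z * I z = C * F z) :
    analyticOrderAt F z₀ = analyticOrderAt m z₀ := by
  have hne : ∀ᶠ z in 𝓝[≠] z₀, m z ≠ 0 := hm.eventually_eq_zero_or_eventually_ne_zero.resolve_left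
    fun h => hm' (analyticOrderAt_eq_top.2 h)
  have hC : C ≠ 0 := by
    rintro rfl
    obtain ⟨z, h1, h2⟩ := (hne.and ((hI.eventually_ne hI0).filter_mono nhdsWithin_le_nhds)).exists
    exact mul_ne_zero h1 h2 (by rw [h, zero_mul])
  have hIa : AnalyticAt ℂ I z₀ := by
    refine Complex.analyticAt_of_differentiable_on_punctured_nhds_of_continuousAt ?_ hI
    filter_upwards [hne, hm.eventually_analyticAt.filter_mono nhdsWithin_le_nhds,
      hF.eventually_analyticAt.filter_mono nhdsWithin_le_nhds] with z h1 h2 h3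
    refine ((h3.differentiableAt.const_mul C).div h2.differentiableAt h1).congr_of_eventuallyEq ?_
    filter_upwards [h2.continuousAt.eventually_ne h1] with w hw
    rw [Pi.div_apply, ← h, mul_div_cancel_left₀ _ hw]
  have key : m * I = (fun _ => C) * F := funext h
  have k1 := analyticOrderAt_mul hm hIa
  rw [key, analyticOrderAt_mul analyticAt_const hF, hIa.analyticOrderAt_eq_zero.2 hI0,
    (analyticAt_const (𝕜 := ℂ) (v := C)).analyticOrderAt_eq_zero.2 hC, zero_add, add_zero] at k1
  exact k1

/-! ### The difference of eigenvalues as a function of ν -/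

section Eigenvalue

variable {q : ℝ}

lemma analyticOrderAt_cpow_neg_sub (hq0 : 0 < q) (hq1 : q < 1) (ν₀ : ℂ) :
    AnalyticAt ℂ (fun ν : ℂ => (q : ℂ) ^ (-ν₀) - (q : ℂ) ^ (-ν)) ν₀ ∧
      analyticOrderAt (fun ν : ℂ => (q : ℂ) ^ (-ν₀) - (q : ℂ) ^ (-ν)) ν₀ = 1 := by
  have hqc : (q : ℂ) ≠ 0 := Complex.ofReal_ne_zero.2 hq0.ne'
  have hlog : Complex.log q ≠ 0 := by
    rw [← Complex.ofReal_log hq0.le]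
    exact Complex.ofReal_ne_zero.2 (Real.log_neg hq0 hq1).ne
  have hD : ∀ ν : ℂ, HasDerivAt (fun ν : ℂ => (q : ℂ) ^ (-ν₀) - (q : ℂ) ^ (-ν))
      (-((q : ℂ) ^ (-ν) * Complex.log q * (-1))) ν := fun ν =>
    ((hasDerivAt_id ν).neg.const_cpow (Or.inl hqc)).const_sub _
  have hA : AnalyticAt ℂ (fun ν : ℂ => (q : ℂ) ^ (-ν₀) - (q : ℂ) ^ (-ν)) ν₀ :=
    Differentiable.analyticAt (fun ν => (hD ν).differentiableAt) ν₀
  refine ⟨hA, hA.analyticOrderAt_eq_one_of_zero_deriv_ne_zero (sub_self _) ?_⟩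
  rw [(hD ν₀).deriv]
  simp [Complex.cpow_eq_zero_iff, hlog, hqc]

lemma analyticAt_one_sub_mul_cpow (hq0 : 0 < q) (e ν₀ : ℂ) :
    AnalyticAt ℂ (fun ν : ℂ => 1 - e * (q : ℂ) ^ ν) ν₀ := by
  have hqc : (q : ℂ) ≠ 0 := Complex.ofReal_ne_zero.2 hq0.ne'
  exact Differentiable.analyticAt (fun ν =>
    ((((hasDerivAt_id ν).const_cpow (Or.inl hqc)).const_mul e).const_sub 1).differentiableAt) ν₀

lemma analyticOrderAt_one_sub_mul_cpow (hq0 : 0 < q) (hq1 : q < 1) {e ν₀ : ℂ}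
    (h : e * (q : ℂ) ^ ν₀ = 1) :
    analyticOrderAt (fun ν : ℂ => 1 - e * (q : ℂ) ^ ν) ν₀ = 1 := by
  have hqc : (q : ℂ) ≠ 0 := Complex.ofReal_ne_zero.2 hq0.ne'
  have hlog : Complex.log q ≠ 0 := by
    rw [← Complex.ofReal_log hq0.le]
    exact Complex.ofReal_ne_zero.2 (Real.log_neg hq0 hq1).ne
  have hD : HasDerivAt (fun ν : ℂ => 1 - e * (q : ℂ) ^ ν)
      (-(e * ((q : ℂ) ^ ν₀ * Complex.log q * 1))) ν₀ :=
    (((hasDerivAt_id ν₀).const_cpow (Or.inl hqc)).const_mul e).const_sub 1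
  refine (analyticAt_one_sub_mul_cpow hq0 e ν₀).analyticOrderAt_eq_one_of_zero_deriv_ne_zero
    (by rw [h, sub_self]) ?_
  rw [hD.deriv, mul_one, ← mul_assoc, h, one_mul]
  exact neg_ne_zero.2 hlog

/-- The factorization separates the zero at ν = ν₀, always present, from the zero at the reflected
point with abcd q^{ν+ν₀-1} = 1. The two collide at the branch point of λ_ν. -/
lemma eigenvalue_sub_eq (hq0 : 0 < q) (k d ν ν₀ : ℂ) :
    (1 - (q : ℂ) ^ (-ν)) * (1 - k * (q : ℂ) ^ ν * d / q) -
        (1 - (q : ℂ) ^ (-ν₀)) * (1 - k * (q : ℂ) ^ ν₀ * d / q) =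
      ((q : ℂ) ^ (-ν₀) - (q : ℂ) ^ (-ν)) * (1 - k * d / q * (q : ℂ) ^ ν₀ * (q : ℂ) ^ ν) := by
  have hqc : (q : ℂ) ≠ 0 := Complex.ofReal_ne_zero.2 hq0.ne'
  have h : ∀ x : ℂ, (q : ℂ) ^ x ≠ 0 := fun x => by simp [Complex.cpow_eq_zero_iff, hqc]
  rw [Complex.cpow_neg, Complex.cpow_neg]
  have := h ν
  have := h ν₀
  field_simp
  ring

end Eigenvalue

/-! ### Continuity of the integrand on the circle -/

section Positivity

variable {a b c : ℂ} {q α d : ℝ}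

lemma continuous_circleWeight_circleMap (hq0 : 0 < q) (hq1 : q < 1) (hα0 : q < α) (hα1 : α < 1)
    (ha : ‖a‖ < 1) (hb : ‖b‖ < 1) (hc : ‖c‖ < 1) (hqd : ‖(q : ℂ) / d‖ < 1) :
    Continuous fun θ : ℝ => circleWeight q α a b c d (circleMap 0 1 θ) := by
  have hqn' : ‖(q : ℂ)‖ = q := by rw [Complex.norm_real, Real.norm_of_nonneg hq0.le]
  have hqn : ‖(q : ℂ)‖ < 1 := by rwa [hqn']
  have hαp : 0 < α := hq0.trans hα0
  have hαn : ‖(α : ℂ)‖ = α := by rw [Complex.norm_real, Real.norm_of_nonneg hαp.le]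
  have hαc : (α : ℂ) ≠ 0 := Complex.ofReal_ne_zero.2 hαp.ne'
  have P : ∀ {f : ℝ → ℂ}, Continuous f → Continuous fun θ => qPochInf (f θ) q := fun hf =>
    (continuous_qPochInf hqn).comp hf
  have Cz : Continuous fun θ : ℝ => circleMap 0 1 θ := continuous_circleMap 0 1
  have z0 : ∀ θ : ℝ, circleMap 0 1 θ ≠ 0 := fun θ => circleMap_ne_center one_ne_zero
  have Ci : Continuous fun θ : ℝ => 1 / circleMap 0 1 θ := continuous_const.div Cz z0
  have PP : ∀ {f : ℝ → ℂ}, Continuous f → Continuous fun θ => paramProd q a b c d (f θ) :=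
    fun hf => (((P (hf.const_mul a)).mul (P (hf.const_mul b))).mul (P (hf.const_mul c))).mul
      (P (hf.const_mul (q / d : ℂ)))
  have m1 : ∀ x : ℂ, ‖x‖ < 1 → ∀ θ, ‖x * circleMap 0 1 θ‖ < 1 := fun x hx θ => by
    rw [norm_mul]; simpa using hx
  have m2 : ∀ x : ℂ, ‖x‖ < 1 → ∀ θ, ‖x * (1 / circleMap 0 1 θ)‖ < 1 := fun x hx θ => by
    rw [norm_mul]; simpa using hx
  have hα' : ‖(α : ℂ)‖ < 1 := by rwa [hαn]
  have hqα : ‖(q : ℂ) / α‖ < 1 := by rwa [norm_div, hqn', hαn, div_lt_one hαp]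
  have T1 : ∀ θ, qTheta q (α * circleMap 0 1 θ) ≠ 0 := fun θ =>
    qTheta_ne_zero hqn (m1 _ hα' θ) (by rw [← div_div, ← mul_one_div]; exact m2 _ hqα θ)
  have T2 : ∀ θ, qTheta q (α / circleMap 0 1 θ) ≠ 0 := fun θ =>
    qTheta_ne_zero hqn (by rw [← mul_one_div]; exact m2 _ hα' θ)
      (by rw [div_div_eq_mul_div, mul_div_right_comm]; exact m1 _ hqα θ)
  have T : ∀ {f : ℝ → ℂ}, Continuous f → (∀ θ, f θ ≠ 0) →
      Continuous fun θ => qTheta q (f θ) := fun hf h0 =>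
    (P hf).mul (P (continuous_const.div hf h0))
  refine Continuous.div ((P (Cz.mul Cz)).mul (P (continuous_const.div (Cz.mul Cz)
    fun θ => mul_ne_zero (z0 θ) (z0 θ)))) (((PP Cz).mul (PP Ci)).mul ((T (Cz.const_mul _)
      fun θ => mul_ne_zero hαc (z0 θ)).mul (T (continuous_const.div Cz z0)
        fun θ => div_ne_zero hαc (z0 θ)))) fun θ => ?_
  exact mul_ne_zero (mul_ne_zero
    (paramProd_ne_zero hqn (m1 _ ha θ) (m1 _ hb θ) (m1 _ hc θ) (m1 _ hqd θ))
    (paramProd_ne_zero hqn (m2 _ ha θ) (m2 _ hb θ) (m2 _ hc θ) (m2 _ hqd θ)))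
    (mul_ne_zero (T1 θ) (T2 θ))

lemma continuous_vSum_circleMap {q d : ℂ} (hq : ‖q‖ < 1) (ha : ‖a‖ < 1) (hb : ‖b‖ < 1)
    (hc : ‖c‖ < 1) (hd : d ≠ 0) (hqd : ‖q / d‖ < 1) {X : Type*} [TopologicalSpace X]
    {u v : X → ℂ} {θ : X → ℝ} (hu : Continuous u) (hv : Continuous v) (hθ : Continuous θ) :
    Continuous fun x => vSum q a b c d (u x) (v x) (circleMap 0 1 (θ x)) :=
  continuous_iff_continuousAt.2 fun x =>
    tendsto_vSum hq ha hb hc tendsto_const_nhds (hu.tendsto x) (hv.tendsto x)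
      (((continuous_circleMap 0 1).comp hθ).tendsto x) hd (circleMap_ne_center one_ne_zero)
      (by rw [← div_div, norm_div]; simpa using hqd)
      (qPochInf_ne_zero_of_norm_lt_one hq (norm_lt_one_of_mul_eq ha hb hc (by
        rw [norm_mul]; simpa using hq.le)))

/-- The circle has no isolated points, so a point with f ≠ 0 can be moved away from z = ±1, where
the weight vanishes. -/
lemma exists_circleMap_ne_zero {f : ℂ → ℂ} (hf : ContinuousOn f (Metric.sphere 0 1))
    (h : ∃ z, ‖z‖ = 1 ∧ f z ≠ 0) :
    ∃ θ ∈ Set.Icc (0 : ℝ) (2 * Real.pi), circleMap 0 1 θ * circleMap 0 1 θ ≠ 1 ∧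
      f (circleMap 0 1 θ) ≠ 0 := by
  obtain ⟨z, hz, hfz⟩ := h
  have hp := (isPreconnected_sphere (Complex.rank_real_complex ▸ Nat.one_lt_ofNat) (0 : ℂ)
    1).preperfect_of_nontrivial ⟨1, by simp, -1, by simp, by norm_num⟩ z (by simpa using hz)
  have hz' : z ∈ Metric.sphere (0 : ℂ) 1 := by simpa using hz
  have hev : ∀ᶠ w in 𝓝[≠] z, w * w ≠ 1 := by
    have h1 : AnalyticAt ℂ (fun w : ℂ => w * w - 1) z := by fun_prop
    rcases h1.eventually_eq_zero_or_eventually_ne_zero with h2 | h2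
    · have h3 := (show (fun w : ℂ => w * w - 1) =ᶠ[𝓝 z] fun _ => 0 from h2).deriv_eq
      have h4 : HasDerivAt (fun w : ℂ => w * w - 1) (1 * z + z * 1) z :=
        ((hasDerivAt_id z).mul (hasDerivAt_id z)).sub_const 1
      rw [h4.deriv, deriv_const] at h3
      have : z = 0 := by simpa [← two_mul] using h3
      simp [this] at hz
    · exact h2.mono fun w hw hw' => hw (by rw [hw', sub_self])
  have hev2 : ∀ᶠ w in 𝓝[≠] z, w ∈ Metric.sphere (0 : ℂ) 1 → f w ≠ 0 :=
    (eventually_nhdsWithin_iff.1 ((hf z hz').eventually_ne hfz)).filter_mono nhdsWithin_le_nhds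
  obtain ⟨w, hw, h1, h2⟩ := ((accPt_iff_frequently_nhdsNE.1 hp).and_eventually
    (hev.and hev2)).exists
  have hw' : w ∈ circleMap 0 1 '' Set.Ioc 0 (2 * Real.pi) := by
    rw [image_circleMap_Ioc]
    simpa using hw
  obtain ⟨θ, ⟨h3, h4⟩, rfl⟩ := hw'
  exact ⟨θ, ⟨h3.le, h4⟩, h1, h2 hw⟩

end Positivity

/-! ### Positivity of the integral and the order of the zero -/

section Positivity

variable {a b c : ℂ} {q α d : ℝ}

/-- For real u and v the function is real on the circle, so its square is a squared modulus. The
integrand is continuous, nonnegative and positive at some point. -/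
lemma integral_circleWeight_mul_self_ne_zero (hq0 : 0 < q) (hq1 : q < 1) (hα0 : q < α)
    (hα1 : α < 1)
    (habc : (a.im = 0 ∧ b.im = 0 ∧ c.im = 0) ∨ (b = conj a ∧ c.im = 0) ∨
      (c = conj a ∧ b.im = 0) ∨ (c = conj b ∧ a.im = 0))
    (ha : ‖a‖ < 1) (hb : ‖b‖ < 1) (hc : ‖c‖ < 1) (hd0 : d ≠ 0) (hqd : ‖(q : ℂ) / d‖ < 1)
    {u v : ℝ} (hu : u ≠ 0) (huv : (u : ℂ) * v = a * b * c) :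
    ∫ θ in (0 : ℝ)..2 * Real.pi, circleWeight q α a b c d (circleMap 0 1 θ) *
      (vSum q a b c d u v (circleMap 0 1 θ) * vSum q a b c d u v (circleMap 0 1 θ)) ≠ 0 := by
  have hqn' : ‖(q : ℂ)‖ = q := by rw [Complex.norm_real, Real.norm_of_nonneg hq0.le]
  have hqn : ‖(q : ℂ)‖ < 1 := by rwa [hqn']
  have hdc : (d : ℂ) ≠ 0 := Complex.ofReal_ne_zero.2 hd0
  have hαp : 0 < α := hq0.trans hα0
  have hαn : ‖(α : ℂ)‖ = α := by rw [Complex.norm_real, Real.norm_of_nonneg hαp.le]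
  have cz : ∀ θ : ℝ, ‖circleMap 0 1 θ‖ = 1 := fun θ => by simp
  set W : ℝ → ℝ := fun θ => (‖qPochInf (circleMap 0 1 θ * circleMap 0 1 θ) q‖ /
    (‖paramProd q a b c d (circleMap 0 1 θ)‖ * ‖qTheta q (α * circleMap 0 1 θ)‖)) ^ 2 with hW
  set f : ℝ → ℂ := fun θ => vSum q a b c d u v (circleMap 0 1 θ) with hf
  have hE : ∀ θ : ℝ, circleWeight q α a b c d (circleMap 0 1 θ) * (f θ * f θ) =
      ((W θ * ‖f θ‖ ^ 2 : ℝ) : ℂ) := fun θ => by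
    rw [circleWeight_eq_sq hq0 hq1 habc (cz θ)]
    have h2 := Complex.mul_conj' (f θ)
    have h3 : conj (f θ) = f θ :=
      conj_vSum_of_norm_eq_one hq0 hq1 habc ha hb hc hd0 hqd hu huv (cz θ)
    rw [h3] at h2
    rw [h2, Complex.ofReal_mul, Complex.ofReal_pow ‖f θ‖]
  have hfc : Continuous f :=
    continuous_vSum_circleMap hqn ha hb hc hdc hqd continuous_const continuous_const continuous_id
  have hWc : Continuous W := by
    have h := Complex.continuous_re.comp
      (continuous_circleWeight_circleMap (d := d) hq0 hq1 hα0 hα1 ha hb hc hqd)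
    refine h.congr fun θ => ?_
    rw [Function.comp_apply, circleWeight_eq_sq hq0 hq1 habc (cz θ), Complex.ofReal_re]
  have hs : ContinuousOn (fun z => vSum q a b c d u v z) (Metric.sphere 0 1) := fun z hz => by
    have hz : ‖z‖ = 1 := by simpa using hz
    exact tendsto_vSum hqn ha hb hc tendsto_const_nhds tendsto_const_nhds tendsto_const_nhds
      nhdsWithin_le_nhds hdc (norm_pos_iff.1 (by rw [hz]; exact one_pos))
      (by rwa [← div_div, norm_div, hz, div_one])
      (qPochInf_ne_zero_of_norm_lt_one hqn (norm_lt_one_of_mul_eq ha hb hc (by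
        rw [norm_mul, hz, one_mul]; exact hqn.le)))
  obtain ⟨θ, hθ, h1, h2⟩ := exists_circleMap_ne_zero hs
    (exists_vSum_ne_zero (Complex.ofReal_ne_zero.2 hq0.ne') hqn ha hb hc hdc hqd
      (Complex.ofReal_ne_zero.2 hu) huv)
  have hWθ : 0 < W θ := by
    have m1 : ∀ x : ℂ, ‖x‖ < 1 → ‖x * circleMap 0 1 θ‖ < 1 := fun x hx => by
      rwa [norm_mul, cz, mul_one]
    have n1 : qPochInf (circleMap 0 1 θ * circleMap 0 1 θ) q ≠ 0 := by
      refine (qPochInf_ne_zero_iff hqn _).2 fun k hk => ?_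
      rcases Nat.eq_zero_or_pos k with rfl | hk0
      · exact h1 (by simpa using hk)
      · have := congrArg norm hk
        rw [norm_mul, norm_mul, cz, norm_pow, hqn', one_mul, one_mul, norm_one] at this
        exact (pow_lt_one₀ hq0.le hq1 hk0.ne').ne this
    have n2 := paramProd_ne_zero hqn (m1 a ha) (m1 b hb) (m1 c hc) (m1 _ hqd)
    have n3 : qTheta q (α * circleMap 0 1 θ) ≠ 0 := by
      refine qTheta_ne_zero hqn (m1 _ (by rwa [hαn])) ?_
      rwa [norm_div, norm_mul, cz, mul_one, hqn', hαn, div_lt_one hαp]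
    exact pow_pos (div_pos (norm_pos_iff.2 n1)
      (mul_pos (norm_pos_iff.2 n2) (norm_pos_iff.2 n3))) 2
  have hpos : 0 < ∫ θ in (0 : ℝ)..2 * Real.pi, W θ * ‖f θ‖ ^ 2 :=
    intervalIntegral.integral_pos Real.two_pi_pos (hWc.mul (hfc.norm.pow 2)).continuousOn
      (fun θ _ => mul_nonneg (sq_nonneg _) (sq_nonneg _))
      ⟨θ, hθ, mul_pos hWθ (pow_pos (norm_pos_iff.2 h2) 2)⟩
  rw [intervalIntegral.integral_congr fun θ _ => hE θ, intervalIntegral.integral_ofReal]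
  exact Complex.ofReal_ne_zero.2 hpos.ne'

lemma exists_ofReal_eq_mul (habc : (a.im = 0 ∧ b.im = 0 ∧ c.im = 0) ∨ (b = conj a ∧ c.im = 0) ∨
      (c = conj a ∧ b.im = 0) ∨ (c = conj b ∧ a.im = 0)) : ∃ k : ℝ, a * b * c = k := by
  have h : conj (a * b * c) = a * b * c := by
    rcases habc with ⟨h1, h2, h3⟩ | ⟨rfl, h2⟩ | ⟨rfl, h2⟩ | ⟨rfl, h2⟩
    · rw [map_mul, map_mul, Complex.conj_eq_iff_im.2 h1, Complex.conj_eq_iff_im.2 h2,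
        Complex.conj_eq_iff_im.2 h3]
    all_goals
      rw [map_mul, map_mul, Complex.conj_eq_iff_im.2 h2, Complex.conj_conj]
      ring
  exact ⟨_, (Complex.conj_eq_iff_re.1 h).symm⟩

/-- Green's formula reads (difference of eigenvalues) · I = C · v_ν(η) with I(ν₀) ≠ 0, so the orders
at ν₀ agree; the factor q^{-ν₀} - q^{-ν} contributes the 1. -/
lemma analyticOrderAt_vBoundary_eq (hq0 : 0 < q) (hq1 : q < 1)
    (habc : (a.im = 0 ∧ b.im = 0 ∧ c.im = 0) ∨ (b = conj a ∧ c.im = 0) ∨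
      (c = conj a ∧ b.im = 0) ∨ (c = conj b ∧ a.im = 0))
    (ha : ‖a‖ < 1) (hb : ‖b‖ < 1) (hc : ‖c‖ < 1) (hd0 : d ≠ 0) (hqd : ‖(q : ℂ) / d‖ < 1)
    (hα0 : Real.sqrt q < α) (hα1 : α < 1) {ν₀ : ℝ} (hν₀ : vBoundary q α a b c d ν₀ = 0) :
    analyticOrderAt (fun ν : ℂ => vBoundary q α a b c d ν) ν₀ =
      1 + analyticOrderAt
        (fun ν : ℂ => 1 - a * b * c * d / q * (q : ℂ) ^ (ν₀ : ℂ) * (q : ℂ) ^ ν) ν₀ := by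
  have hqn' : ‖(q : ℂ)‖ = q := by rw [Complex.norm_real, Real.norm_of_nonneg hq0.le]
  have hqn : ‖(q : ℂ)‖ < 1 := by rwa [hqn']
  have hqc : (q : ℂ) ≠ 0 := Complex.ofReal_ne_zero.2 hq0.ne'
  have hdc : (d : ℂ) ≠ 0 := Complex.ofReal_ne_zero.2 hd0
  have hαp : 0 < α := (Real.sqrt_nonneg q).trans_lt hα0
  have hqα : q < α := by
    have := Real.mul_self_sqrt hq0.le
    nlinarith [Real.sqrt_nonneg q]
  have hαn : ‖(α : ℂ)‖ = α := by rw [Complex.norm_real, Real.norm_of_nonneg hαp.le]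
  have hαi : (α : ℂ)⁻¹ ≠ 0 := inv_ne_zero (Complex.ofReal_ne_zero.2 hαp.ne')
  have ht : ‖(q : ℂ) / (d * (α : ℂ)⁻¹)‖ < 1 := by
    rw [← div_div, div_inv_eq_mul, norm_mul, hαn]
    exact mul_lt_one_of_nonneg_of_lt_one_left (norm_nonneg _) hqd hα1.le
  -- Since q < α, only the first factor of (abc/α; q)_∞ can vanish, and that one is already removed
  -- in `vSum`.
  have hp : qPochInf (a * b * c * (α : ℂ)⁻¹ * q) q ≠ 0 :=
    qPochInf_ne_zero_of_norm_lt_one hqn (norm_lt_one_of_mul_eq ha hb hc (by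
      rw [norm_mul, norm_inv, hqn', hαn, inv_mul_le_iff₀ hαp, mul_one]
      exact hqα.le))
  have hP0 : ∀ ν : ℂ, (q : ℂ) ^ ν ≠ 0 := fun ν => by simp [Complex.cpow_eq_zero_iff, hqc]
  have huv : ∀ ν : ℂ, (q : ℂ) ^ (-ν) * (a * b * c * (q : ℂ) ^ ν) = a * b * c := fun ν => by
    rw [Complex.cpow_neg]
    have := hP0 ν
    field_simp
  have hV : ∀ ν : ℂ, vBoundary q α a b c d ν =
      vSum q a b c d ((q : ℂ) ^ (-ν)) (a * b * c * (q : ℂ) ^ ν) (α : ℂ)⁻¹ := fun ν =>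
    vFun_eq_vSum hqc hqn ha hb hc hdc hαi ht hp
  have Du : Differentiable ℂ fun ν : ℂ => (q : ℂ) ^ (-ν) := fun ν =>
    ((hasDerivAt_id ν).neg.const_cpow (Or.inl hqc)).differentiableAt
  have Dv : Differentiable ℂ fun ν : ℂ => a * b * c * (q : ℂ) ^ ν := fun ν =>
    (((hasDerivAt_id ν).const_cpow (Or.inl hqc)).const_mul (a * b * c)).differentiableAt
  have hF : AnalyticAt ℂ (fun ν : ℂ => vBoundary q α a b c d ν) ν₀ := by
    refine Differentiable.analyticAt ?_ _
    simp only [hV]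
    exact differentiableOn_univ.1 (differentiableOn_vSum (y := fun _ => (α : ℂ)⁻¹) hqn ha hb hc
      isOpen_univ hdc Du.differentiableOn Dv.differentiableOn (differentiableOn_const _)
      (fun _ _ => hαi) (fun _ _ => ht) fun _ _ => hp)
  rw [hV] at hν₀
  obtain ⟨C, hC⟩ := exists_integral_circleWeight_eq hq0 hq1 hα0 hα1 ha hb hc hd0 hqd
    (hP0 _) (huv ν₀) hν₀
  obtain ⟨h1, h1'⟩ := analyticOrderAt_cpow_neg_sub hq0 hq1 (ν₀ : ℂ)
  set e : ℂ := a * b * c * d / q * (q : ℂ) ^ (ν₀ : ℂ) with he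
  have h2 := analyticAt_one_sub_mul_cpow hq0 e (ν₀ : ℂ)
  have h3 := analyticOrderAt_mul h1 h2
  rw [h1'] at h3
  rw [← h3]
  have W := continuous_circleWeight_circleMap (d := d) hq0 hq1 hqα hα1 ha hb hc hqd
  refine analyticOrderAt_eq_of_mul_eq_const_mul (C := C) hF (h1.mul h2) ?_
    (I := fun ν => ∫ θ in (0 : ℝ)..2 * Real.pi, circleWeight q α a b c d (circleMap 0 1 θ) *
      (vSum q a b c d ((q : ℂ) ^ (-(ν₀ : ℂ))) (a * b * c * (q : ℂ) ^ (ν₀ : ℂ)) (circleMap 0 1 θ) *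
        vSum q a b c d ((q : ℂ) ^ (-ν)) (a * b * c * (q : ℂ) ^ ν) (circleMap 0 1 θ))) ?_ ?_ ?_
  · rw [h3]
    refine WithTop.add_ne_top.2 ⟨ENat.one_ne_top, ?_⟩
    by_cases h : e * (q : ℂ) ^ (ν₀ : ℂ) = 1
    · rw [analyticOrderAt_one_sub_mul_cpow hq0 hq1 h]
      exact ENat.one_ne_top
    · rw [h2.analyticOrderAt_eq_zero.2 (sub_ne_zero.2 (Ne.symm h))]
      exact ENat.zero_ne_top
  · refine (intervalIntegral.continuous_parametric_intervalIntegral_of_continuous' ?_ _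
      _).continuousAt
    exact (W.comp continuous_snd).mul
      ((continuous_vSum_circleMap hqn ha hb hc hdc hqd continuous_const continuous_const
        continuous_snd).mul (continuous_vSum_circleMap hqn ha hb hc hdc hqd
          (Du.continuous.comp continuous_fst) (Dv.continuous.comp continuous_fst) continuous_snd))
  -- Reality of ν₀ enters here: abc is real, so u and v are real at ν₀ and the positivity result
  -- applies.
  · obtain ⟨k, hk⟩ := exists_ofReal_eq_mul habc
    have e1 : (q : ℂ) ^ (-(ν₀ : ℂ)) = ((q ^ (-ν₀) : ℝ) : ℂ) := by
      rw [Complex.ofReal_cpow hq0.le, Complex.ofReal_neg]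
    have e2 : a * b * c * (q : ℂ) ^ (ν₀ : ℂ) = ((k * q ^ ν₀ : ℝ) : ℂ) := by
      rw [Complex.ofReal_mul, Complex.ofReal_cpow hq0.le, hk]
    have e3 := huv ν₀
    rw [e1, e2] at e3
    simp only [e1, e2]
    exact integral_circleWeight_mul_self_ne_zero hq0 hq1 hqα hα1 habc ha hb hc hd0 hqd
      (Real.rpow_pos_of_pos hq0 _).ne' e3
  · intro ν
    rw [hV, ← hC _ _ (hP0 _) (huv ν), eigenvalue_sub_eq hq0 (a * b * c) d ν ν₀]
    rfl

end Positivity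

theorem theorem5p3
    (q α d : ℝ) (a b c : ℂ)
    (hq0 : 0 < q) (hq1 : q < 1)
    -- `a, b, c` are all real, or two of them are complex conjugate and the third one is real
    (habc : (a.im = 0 ∧ b.im = 0 ∧ c.im = 0) ∨
      (b = (starRingEnd ℂ) a ∧ c.im = 0) ∨
      (c = (starRingEnd ℂ) a ∧ b.im = 0) ∨
      (c = (starRingEnd ℂ) b ∧ a.im = 0))
    (ha : ‖a‖ < 1) (hb : ‖b‖ < 1) (hc : ‖c‖ < 1)
    (hd0 : d ≠ 0) (hd : |q / d| < 1)
    (hα0 : Real.sqrt q < α) (hα1 : α < 1)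
    -- a real zero of the function `ν ↦ v_ν(η; a, b, c; d)`
    (ν₀ : ℝ) (hν₀ : vBoundary q α a b c d ν₀ = 0) :
    -- it is simple whenever `∂λ_ν/∂ν ≠ 0` there
    (a * b * c * d * (q : ℂ) ^ (2 * (ν₀ : ℂ) - 1) ≠ 1 →
      analyticOrderAt (fun ν : ℂ => vBoundary q α a b c d ν) (ν₀ : ℂ) = 1) ∧
    -- and at the branch point of `ν ↦ λ_ν` it is simple in `λ_ν`, that is, double in `ν`
    (a * b * c * d * (q : ℂ) ^ (2 * (ν₀ : ℂ) - 1) = 1 →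
      analyticOrderAt (fun ν : ℂ => vBoundary q α a b c d ν) (ν₀ : ℂ) = 2) := by
  have hqc : (q : ℂ) ≠ 0 := Complex.ofReal_ne_zero.2 hq0.ne'
  have hqd : ‖(q : ℂ) / d‖ < 1 := by
    rwa [← Complex.ofReal_div, Complex.norm_real, Real.norm_eq_abs]
  have key := analyticOrderAt_vBoundary_eq hq0 hq1 habc ha hb hc hd0 hqd hα0 hα1 hν₀
  -- The factor depending on ν, evaluated at ν = ν₀, carries q^{ν₀} twice.
  have he : a * b * c * d * (q : ℂ) ^ (2 * (ν₀ : ℂ) - 1) =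
      a * b * c * d / q * (q : ℂ) ^ (ν₀ : ℂ) * (q : ℂ) ^ (ν₀ : ℂ) := by
    rw [Complex.cpow_sub _ _ hqc, Complex.cpow_one, two_mul, Complex.cpow_add _ _ hqc]
    ring
  rw [he, key]
  refine ⟨fun h => ?_, fun h => ?_⟩
  · rw [(analyticAt_one_sub_mul_cpow hq0 _ (ν₀ : ℂ)).analyticOrderAt_eq_zero.2
      (sub_ne_zero.2 (Ne.symm h)), add_zero]
  · rw [analyticOrderAt_one_sub_mul_cpow hq0 hq1 h]
    norm_num
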